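/- Let $(\mathcal X,\|\cdot\|)$ be a separable real Banach space with dual $(\mathcal X^*,\|\cdot\|_*)$ that is uniformly convex of power type $2$ with constant $c_{\mathcal X}>0$: for all $\eta\in(0,2]$ and $x,y\in\mathcal X$ with $\|x\|=\|y\|=1$ and $\|x-y\|\ge\eta$ one has $\|\frac{x+y}2\|\le 1-c_{\mathcal X}\eta^2$. Let $X$ be an $\mathcal X$-valued random variable with $\mathbb E\|X\|^2<\infty$. Then: (1) $X$ has exactly one Fréchet mean, that is, $b\mapsto\mathbb E\|X-b\|^2$ has exactly one minimizer $\mu$ over $\mathcal X$. (2) Call $g:\mathcal X\to\mathcal X^*$ a measurable subgradient selection if $g$ is Borel measurable and $g(x)\in\partial(\|\cdot\|^2)(x)$ for every $x\in\mathcal X$. There is a measurable subgradient selection satisfying the first-order optimality condition $$\mathbb E\langle g(X-\mu),y\rangle=0\quad\text{for all }y\in\mathcal X,\qquad(\ast)$$ and every measurable subgradient selection satisfies $(\ast)$ if $\|\cdot\|^2$ almost surely has only one subgradient at $X-\mu$ (for instance if $\|\cdot\|$ is Gâteaux differentiable away from $0$). (3) Let $g$ be any measurable subgradient selection satisfying $(\ast)$,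 put $$\nu_p:=\sup_{\|x\|=1}\big(\mathbb E|\langle g(X-\mu),x\rangle|^p\big)^{1/p}\in[0,\infty]\quad(p\ge1),\qquad \sigma_{\rm w}^2:=\nu_2^2 .$$ Let $\varepsilon\in[0,1)$, $\delta\in(0,1)$ and $n\in\mathbb N$ be such that $$t:=\lfloor\varepsilon n\rfloor+\max\Big\{\lceil\ln(2/\delta)\rceil,\Big\lceil\tfrac{\min\{\varepsilon,\frac12-\varepsilon\}}2\,n\Big\rceil\Big\}<\frac n2 .$$ Let $X_1,\dots,X_n$ be i.i.d. copies of $X$, and let $X_1^\varepsilon,\dots,X_n^\varepsilon$ be $\mathcal X$-valued random variables on the same probability space with $\#\{i:X_i\ne X_i^\varepsilon\}\le\varepsilon n$ almost surely. For $f:\mathcal X\to\mathbb R$ let $\widehat T^\varepsilon_{n,t}(f)$ be the trimmed mean $\frac1{n-2t}\sum_{j=t+1}^{n-t}a_{(j)}$, where $a_{(1)}\le\dots\le a_{(n)}$ is the nondecreasing rearrangement of $f(X_1^\varepsilon),\dots,f(X_n^\varepsilon)$. Then there is an event of probability at least $1-\delta$ on which every $$\widehat\mu\in\operatorname*{argmin}_{b\in\mathcal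 X}\ \sup_{a\in\mathcal X}\ \widehat T^\varepsilon_{n,t}\big(\|b-\cdot\|^2-\|a-\cdot\|^2\big)$$ satisfies $$\|\widehat\mu-\mu\|\le\frac{C_\varepsilon}{C_{\mathcal X}}\left(23\sqrt{\frac{\mathbb E\|X-\mu\|^2}{C_{\mathcal X}\,n}}+\sqrt{\frac{\sigma_{\rm w}^2\log(3/\delta)}n}+\inf_{p\in[1,\infty)}\nu_p\,\varepsilon^{1-1/p}\right),$$ where $C_\varepsilon=928\Big(1+\frac{\varepsilon}{\min\{\varepsilon,\frac12-\varepsilon\}}\Big)$ (with $0/0:=0$, so $C_0=928$) and $C_{\mathcal X}>0$ is a constant that depends only on $c_{\mathcal X}$. -/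

import Mathlib

open MeasureTheory ProbabilityTheory
open scoped ENNReal

noncomputable section

namespace TrimmedFrechet

/-- Uniform convexity of power type `2` with constant `c`. -/
def UniformlyConvexTwo (E : Type*) [NormedAddCommGroup E] [NormedSpace ℝ E] (c : ℝ) : Prop :=
  ∀ η : ℝ, 0 < η → η ≤ 2 → ∀ x y : E, ‖x‖ = 1 → ‖y‖ = 1 → η ≤ ‖x - y‖ →
    ‖(1 / 2 : ℝ) • (x + y)‖ ≤ 1 - c * η ^ 2

/-- The set of subgradients of `f` at `x`. -/
def subdifferential {E : Type*} [NormedAddCommGroup E] [NormedSpace ℝ E]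
    (f : E → ℝ) (x : E) : Set (StrongDual ℝ E) :=
  {φ | ∀ y : E, φ (y - x) ≤ f y - f x}

/-- `g` is a Borel measurable selection of the subdifferential of `‖·‖²`
(the dual carries the Borel sigma-algebra of its norm). -/
def IsSubgradientSelection {E : Type*} [NormedAddCommGroup E] [NormedSpace ℝ E]
    [MeasurableSpace E] (g : E → StrongDual ℝ E) : Prop :=
  Measurable g ∧ ∀ x : E, g x ∈ subdifferential (fun z : E => ‖z‖ ^ 2) x

/-- `μ` minimizes `b ↦ 𝔼 d(X, b)²`. -/
def IsFrechetMean {Ω E : Type*} [MeasurableSpace Ω] [PseudoMetricSpace E]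
    (P : Measure Ω) (X : Ω → E) (μ : E) : Prop :=
  ∀ b : E, ∫ ω, dist (X ω) μ ^ 2 ∂P ≤ ∫ ω, dist (X ω) b ^ 2 ∂P

/-- The first-order optimality condition `𝔼 ⟨g(X - μ), y⟩ = 0` for all `y`. -/
def FirstOrderCondition {Ω E : Type*} [MeasurableSpace Ω] [NormedAddCommGroup E] [NormedSpace ℝ E]
    (P : Measure Ω) (X : Ω → E) (μ : E) (g : E → StrongDual ℝ E) : Prop :=
  ∀ y : E, ∫ ω, g (X ω - μ) y ∂P = 0

/-- `ν_p = sup_{‖x‖ = 1} (𝔼 |⟨g(X - μ), x⟩|^p)^{1/p}`, possibly infinite. -/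
def nu {Ω E : Type*} [MeasurableSpace Ω] [NormedAddCommGroup E] [NormedSpace ℝ E]
    (P : Measure Ω) (X : Ω → E) (μ : E) (g : E → StrongDual ℝ E) (p : ℝ) : ℝ≥0∞ :=
  ⨆ x ∈ Metric.sphere (0 : E) 1, eLpNorm (fun ω => g (X ω - μ) x) (ENNReal.ofReal p) P

/-- The `t`-trimmed mean of `f` over the points `x`. The function `a ∘ Tuple.sort a` is the
nondecreasing rearrangement of `a`, indexed from `0`. -/
def trimmedMean {E : Type*} {n : ℕ} (t : ℕ) (f : E → ℝ) (x : Fin n → E) : ℝ :=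
  let a : Fin n → ℝ := fun i => f (x i)
  (1 / ((n : ℝ) - 2 * (t : ℝ))) *
    ∑ j ∈ Finset.univ.filter (fun j : Fin n => t ≤ j.val ∧ j.val + t < n), a (Tuple.sort a j)

/-- `sup_a T_{n,t}(d(b,·)² - d(a,·)²)(x)`; for `2 * t < n` the supremum is over a set bounded
above by `max_i d(b, x i)²`. -/
def trimmedObjective {E : Type*} [PseudoMetricSpace E] {n : ℕ} (t : ℕ) (x : Fin n → E)
    (b : E) : ℝ :=
  ⨆ a : E, trimmedMean t (fun z => dist b z ^ 2 - dist a z ^ 2) x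

/-- `m` is a value of the trimmed min-max estimator at the data `x`. -/
def IsTrimmedFrechetMean {E : Type*} [PseudoMetricSpace E] {n : ℕ} (t : ℕ) (x : Fin n → E)
    (m : E) : Prop :=
  ∀ b : E, trimmedObjective t x m ≤ trimmedObjective t x b

/-- `⌊εn⌋ + max ⌈ln(2/δ)⌉ ⌈(min ε (1/2 - ε) / 2) n⌉`. -/
def trimLevel (n : ℕ) (ε δ : ℝ) : ℕ :=
  ⌊ε * n⌋₊ + max ⌈Real.log (2 / δ)⌉₊ ⌈min ε (1 / 2 - ε) / 2 * n⌉₊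

/-- `C_ε = 928 (1 + ε / min ε (1/2 - ε))`; here `0 / 0 = 0`, so that `C_0 = 928`. -/
def contamConst (ε : ℝ) : ℝ := 928 * (1 + ε / min ε (1 / 2 - ε))

open Classical in
/-- `Y` is an `ε`-contamination of the sample `X`. -/
def IsContamination {Ω E : Type*} [MeasurableSpace Ω] [MeasurableSpace E] {n : ℕ}
    (P : Measure Ω) (ε : ℝ) (X Y : Fin n → Ω → E) : Prop :=
  (∀ i, Measurable (Y i)) ∧
    ∀ᵐ ω ∂P, ((Finset.univ.filter fun i => X i ω ≠ Y i ω).card : ℝ) ≤ ε * n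

/-- The right-hand side of the error bound. Every extended real in it is finite when
`𝔼 ‖X‖² < ∞` and `g` is a subgradient selection. -/
def errorBound {Ω E : Type*} [MeasurableSpace Ω] [NormedAddCommGroup E] [NormedSpace ℝ E]
    (P : Measure Ω) (X : Ω → E) (μ : E) (g : E → StrongDual ℝ E) (C : ℝ) (n : ℕ) (ε δ : ℝ) : ℝ :=
  contamConst ε / C *
    (23 * √((∫ ω, ‖X ω - μ‖ ^ 2 ∂P) / (C * n))
      + √((nu P X μ g 2).toReal ^ 2 * Real.log (3 / δ) / n)
      + (⨅ p ∈ Set.Ici (1 : ℝ), nu P X μ g p * ENNReal.ofReal (ε ^ (1 - 1 / p))).toReal)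

end TrimmedFrechet

end

namespace TrimmedFrechet

/-! The estimator is analysed by linearising at `μ`. Power type 2 convexity makes `‖·‖²` strongly
midpoint convex with modulus `k = min (1/4) (c/6)`, so a subgradient satisfies `‖u‖² + g u w +
(k/2)‖w‖² ≤ ‖u + w‖²`. With `u = z - μ` this compares `d(μ,z)² - d(a,z)²` with a linear term in `a -
μ` minus a quadratic one. Suppose that the trimmed means of all functions `g(· - μ) v` are at most
`W‖v‖`. Then the min-max objective is at most `sup_r (W r - k r²/2)` at `μ` and at least `k r²/2 - W
r` at distance `r` from `μ`, so a minimizer lies within a multiple of `W / k` of `μ`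
(`IsTrimmedFrechetMean.norm_sub_le`).

It remains to bound trimmed means uniformly over unit directions. If in every direction at most `s`
clean values exceed a level `M` in absolute value and the values clipped at `M` sum to at most `B`,
then, since `t = ⌊εn⌋ + s`, all retained order statistics lie in `[-M, M]`, and the contaminated
trimmed mean is at most `(2B + 8tM)/n` (`mul_trimmedAvg_le`). Counts (through Lipschitz ramps) and
clipped sums are suprema of empirical processes. Their means are controlled by symmetrization,
contraction and type 2 of the dual: strong convexity of `E` dualizes to 2-uniform smoothness of
`StrongDual ℝ E`, whence a Rademacher average of order `√(n 𝔼‖X - μ‖² / k)`. First-order optimality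
removes the mean before clipping, and `p`-th moments control tails and clipping bias.

Two Talagrand-type inequalities, both proved by induction on the number of coordinates, control the
deviations. Control by `q` points (`integral_exp_mul_prod_le_one`) gives exponential moments of
suprema of sums of nonnegative bounded functions in terms of the mean. An infimum-convolution
inequality on the cube (`signAvg_exp_mul_signAvg_exp_neg_le_one`) gives sub-Gaussian suprema of sign
sums at the scale of the weak variance. After symmetrization the second is applied conditionally on
the sample, the first to the random variance and the Rademacher average that appear. The Rademacher
average qualifies because it is a supremum of nonnegative sums over strategies
(`signAvg_iSup_eq_iSup_strategy`).

The mean `μ` exists because minimizing sequences of a strongly convex functional are Cauchy. For an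
optimal selection, the integrated directional derivative of `‖·‖²` is nonnegative on constants.
Hahn–Banach extends the zero functional from constants to `L²(Q; E)` below it, and Riesz
representation along a dense sequence turns the extension into pointwise subgradients. These are
Borel for the dual norm because `E` is reflexive (Milman–Pettis) and its dual separable. -/

/-- Strong midpoint convexity of the squared norm with modulus `k`. -/
def SqMidpointConvex (E : Type*) [NormedAddCommGroup E] [NormedSpace ℝ E] (k : ℝ) : Prop :=
  ∀ x y : E, ‖(1 / 2 : ℝ) • (x + y)‖ ^ 2 + k / 4 * ‖x - y‖ ^ 2 ≤ (‖x‖ ^ 2 + ‖y‖ ^ 2) / 2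

/-! ### Uniform convexity, duality with smoothness, reflexivity. -/

section Geometry

variable {E : Type*} [NormedAddCommGroup E] [NormedSpace ℝ E]

/-- Two effects can create the gap. If the norms of `x` and `y` differ by at least half of `‖x -
y‖`, the scalar identity `(1 + r²)/2 - ((1 + r)/2)² = (1 - r)²/4` suffices. Otherwise `y` is not
short, and its radial projection is still far from `x`, so uniform convexity on the sphere applies.
-/
theorem UniformlyConvexTwo.sq_midpoint_of_norm_one {c k : ℝ} (hc : 0 < c) (h : UniformlyConvexTwo E c)
    (hk4 : k ≤ 1 / 4) (hkc : k ≤ c / 6) {x y : E} (hx : ‖x‖ = 1) (hy : ‖y‖ ≤ 1) :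
    ‖(1 / 2 : ℝ) • (x + y)‖ ^ 2 + k / 4 * ‖x - y‖ ^ 2 ≤ (‖x‖ ^ 2 + ‖y‖ ^ 2) / 2 := by
  set r := ‖y‖ with hr
  set d := ‖x - y‖ with hd
  have hr0 : 0 ≤ r := norm_nonneg _
  have hd0 : 0 ≤ d := norm_nonneg _
  have hd2 : d ≤ 1 + r := by
    have := norm_sub_le x y
    rw [hx] at this; exact this
  have hmid : ‖(1 / 2 : ℝ) • (x + y)‖ ≤ (1 + r) / 2 := by
    rw [norm_smul]
    have := norm_add_le x y
    rw [hx] at this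
    norm_num
    linarith
  have hN0 : 0 ≤ ‖(1 / 2 : ℝ) • (x + y)‖ := norm_nonneg _
  rw [hx]
  by_cases hcase : d / 2 ≤ 1 - r
  · have h1 : ‖(1 / 2 : ℝ) • (x + y)‖ ^ 2 ≤ ((1 + r) / 2) ^ 2 := pow_le_pow_left₀ hN0 hmid 2
    have h2 : (d / 2) ^ 2 ≤ (1 - r) ^ 2 := pow_le_pow_left₀ (by linarith) hcase 2
    nlinarith [sq_nonneg d]
  · push Not at hcase
    -- From `1 - r < d/2 ≤ (1 + r)/2`.
    have hr3 : 1 / 3 ≤ r := by linarith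
    have hdpos : 0 < d := by linarith
    have hrpos : 0 < r := by linarith
    set z : E := r⁻¹ • y with hz
    have hzn : ‖z‖ = 1 := by
      rw [hz, norm_smul, norm_inv, Real.norm_of_nonneg hr0, ← hr, inv_mul_cancel₀ hrpos.ne']
    have hyz : y = r • z := by rw [hz, smul_smul, mul_inv_cancel₀ hrpos.ne', one_smul]
    have hyzn : ‖y - z‖ = 1 - r := by
      have : y - z = (r - 1) • z := by rw [sub_smul, one_smul, ← hyz]
      rw [this, norm_smul, hzn, mul_one, Real.norm_eq_abs, abs_sub_comm, abs_of_nonneg (by linarith)]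
    have hxz : d / 2 ≤ ‖x - z‖ := by
      have := norm_sub_le_norm_sub_add_norm_sub x z y
      rw [norm_sub_rev z y, hyzn] at this
      linarith
    have hxz2 : d / 2 ≤ 2 := by linarith
    have hmain := h (d / 2) (by linarith) hxz2 x z hx hzn hxz
    have hdec : (1 / 2 : ℝ) • (x + y) = r • ((1 / 2 : ℝ) • (x + z)) + ((1 - r) / 2) • x := by
      rw [hyz]; module
    have hB : ‖(1 / 2 : ℝ) • (x + y)‖ ≤ (1 + r) / 2 - r * (c * (d / 2) ^ 2) := by
      rw [hdec]
      refine (norm_add_le _ _).trans ?_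
      rw [norm_smul r, norm_smul ((1 - r) / 2), hx, Real.norm_of_nonneg hr0,
        Real.norm_of_nonneg (by linarith)]
      nlinarith
    set N := ‖(1 / 2 : ℝ) • (x + y)‖
    set B := r * (c * (d / 2) ^ 2) with hBdef
    have hBlow : c * d ^ 2 / 12 ≤ B := by
      have : 0 ≤ c * (d / 2) ^ 2 := by positivity
      rw [hBdef]; nlinarith
    have hsq : N ^ 2 ≤ ((1 + r) / 2 - B) ^ 2 := pow_le_pow_left₀ hN0 hB 2
    have hBA : B ≤ (1 + r) / 2 := by linarith
    have hB0 : 0 ≤ B := by positivity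
    -- With `A = (1 + r)/2` and `0 ≤ B ≤ A`, one has `(A - B)² ≤ A² - A B`.
    have h3 : N ^ 2 ≤ ((1 + r) / 2) ^ 2 - (1 + r) / 2 * B := by nlinarith
    have h4 : c * d ^ 2 / 24 ≤ (1 + r) / 2 * B := by nlinarith
    have h5 : k / 4 * d ^ 2 ≤ c * d ^ 2 / 24 := by nlinarith [sq_nonneg d]
    nlinarith [sq_nonneg (1 - r)]

/-- Uniform convexity of power type two gives strong midpoint convexity of `‖·‖²`. -/
theorem UniformlyConvexTwo.sqMidpointConvex {c : ℝ} (hc : 0 < c) (h : UniformlyConvexTwo E c) :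
    SqMidpointConvex E (min (1 / 4) (c / 6)) := by
  set k := min (1 / 4 : ℝ) (c / 6)
  have hk4 : k ≤ 1 / 4 := min_le_left _ _
  have hkc : k ≤ c / 6 := min_le_right _ _
  have key : ∀ x y : E, ‖y‖ ≤ ‖x‖ →
      ‖(1 / 2 : ℝ) • (x + y)‖ ^ 2 + k / 4 * ‖x - y‖ ^ 2 ≤ (‖x‖ ^ 2 + ‖y‖ ^ 2) / 2 := by
    intro x y hxy
    rcases eq_or_ne x 0 with rfl | hx
    · have : y = 0 := by simpa using hxy
      simp [this]
    · have hr : 0 < ‖x‖ := norm_pos_iff.mpr hx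
      have h1 := h.sq_midpoint_of_norm_one hc hk4 hkc (x := ‖x‖⁻¹ • x) (y := ‖x‖⁻¹ • y)
        (by rw [norm_smul, norm_inv, norm_norm, inv_mul_cancel₀ hr.ne'])
        (by rw [norm_smul, norm_inv, norm_norm]
            exact (inv_mul_le_iff₀ hr).mpr (by simpa using hxy))
      have e1 : (1 / 2 : ℝ) • (‖x‖⁻¹ • x + ‖x‖⁻¹ • y) = ‖x‖⁻¹ • ((1 / 2 : ℝ) • (x + y)) := by module
      have e2 : ‖x‖⁻¹ • x - ‖x‖⁻¹ • y = ‖x‖⁻¹ • (x - y) := by module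
      rw [e1, e2] at h1
      simp only [norm_smul ‖x‖⁻¹, norm_inv, norm_norm] at h1
      have h2 := mul_le_mul_of_nonneg_left h1 (sq_nonneg ‖x‖)
      have hi : ‖x‖ * ‖x‖⁻¹ = 1 := mul_inv_cancel₀ hr.ne'
      have e3 : ∀ w : ℝ, ‖x‖ ^ 2 * (‖x‖⁻¹ * w) ^ 2 = w ^ 2 := by
        intro w
        rw [← mul_pow, ← mul_assoc, hi, one_mul]
      calc _ = ‖x‖ ^ 2 * ((‖x‖⁻¹ * ‖(1 / 2 : ℝ) • (x + y)‖) ^ 2 +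
                k / 4 * (‖x‖⁻¹ * ‖x - y‖) ^ 2) := by
              rw [mul_add, e3, mul_left_comm, e3]
        _ ≤ _ := h2
        _ = _ := by rw [← mul_div_assoc, mul_add, e3, e3]
  intro x y
  rcases le_total ‖y‖ ‖x‖ with hxy | hxy
  · exact key x y hxy
  · have := key y x hxy
    rw [add_comm x y, norm_sub_rev x y, add_comm (‖x‖ ^ 2)]
    exact this

/-- The subgradient inequality at the midpoint `u + w/2` bounds the left side of midpoint convexity
from below; doubling turns `k / 4` into `k / 2`. -/
theorem SqMidpointConvex.subgradient_le {k : ℝ} (h : SqMidpointConvex E k) {u : E}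
    {φ : StrongDual ℝ E} (hφ : φ ∈ subdifferential (fun z : E => ‖z‖ ^ 2) u) (w : E) :
    ‖u‖ ^ 2 + φ w + k / 2 * ‖w‖ ^ 2 ≤ ‖u + w‖ ^ 2 := by
  have h1 := hφ ((1 / 2 : ℝ) • (u + (u + w)))
  have h2 := h u (u + w)
  have e1 : (1 / 2 : ℝ) • (u + (u + w)) - u = (1 / 2 : ℝ) • w := by module
  have e2 : u - (u + w) = -w := by module
  rw [e1, map_smul, smul_eq_mul] at h1
  rw [e2, norm_neg] at h2
  simp only at h1
  linarith

theorem subgradient_apply_le {u : E} {φ : StrongDual ℝ E}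
    (hφ : φ ∈ subdifferential (fun z : E => ‖z‖ ^ 2) u) (w : E) : φ w ≤ 2 * ‖u‖ * ‖w‖ := by
  -- Difference quotient with step `s`; letting `s → 0` removes the quadratic remainder.
  have key : ∀ s : ℝ, 0 < s → φ w ≤ 2 * ‖u‖ * ‖w‖ + s * ‖w‖ ^ 2 := by
    intro s hs
    have h1 := hφ (u + s • w)
    have h2 : ‖u + s • w‖ ≤ ‖u‖ + s * ‖w‖ := by
      refine (norm_add_le _ _).trans ?_
      rw [norm_smul, Real.norm_of_nonneg hs.le]
    have h3 : ‖u + s • w‖ ^ 2 ≤ (‖u‖ + s * ‖w‖) ^ 2 := pow_le_pow_left₀ (norm_nonneg _) h2 2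
    rw [add_sub_cancel_left, map_smul, smul_eq_mul] at h1
    simp only at h1
    have : s * φ w ≤ s * (2 * ‖u‖ * ‖w‖ + s * ‖w‖ ^ 2) := by nlinarith
    exact le_of_mul_le_mul_left this hs
  refine le_of_forall_pos_le_add fun η hη => ?_
  have := key (η / (‖w‖ ^ 2 + 1)) (by positivity)
  refine this.trans ?_
  gcongr
  rw [div_mul_eq_mul_div, div_le_iff₀ (by positivity)]
  nlinarith

theorem norm_subgradient_le {u : E} {φ : StrongDual ℝ E}
    (hφ : φ ∈ subdifferential (fun z : E => ‖z‖ ^ 2) u) : ‖φ‖ ≤ 2 * ‖u‖ := by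
  refine φ.opNorm_le_bound (by positivity) fun w => ?_
  rw [Real.norm_eq_abs, abs_le]
  refine ⟨?_, subgradient_apply_le hφ w⟩
  have := subgradient_apply_le hφ (-w)
  rw [map_neg, norm_neg] at this
  linarith

/-- A functional is almost attained on the ball whose radius is its norm. -/
theorem exists_norm_le_sq_sub_le (a : StrongDual ℝ E) {η : ℝ} (hη : 0 < η) :
    ∃ x : E, ‖x‖ ≤ ‖a‖ ∧ ‖a‖ ^ 2 - η ≤ a x := by
  rcases eq_or_ne a 0 with rfl | ha
  · exact ⟨0, by simp, by simp [hη.le]⟩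
  have hpos : 0 < ‖a‖ := norm_pos_iff.mpr ha
  obtain ⟨x, hx1, hx2⟩ := a.exists_lt_apply_of_lt_opNorm (r := ‖a‖ - η / ‖a‖)
    (by have : 0 < η / ‖a‖ := by positivity
        linarith)
  have hmul : ‖a‖ * (‖a‖ - η / ‖a‖) = ‖a‖ ^ 2 - η := by field_simp
  rcases le_total 0 (a x) with hs | hs
  · refine ⟨‖a‖ • x, ?_, ?_⟩
    · rw [norm_smul, norm_norm]; nlinarith
    · rw [map_smul, smul_eq_mul, ← hmul]
      rw [Real.norm_of_nonneg hs] at hx2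
      gcongr
  · refine ⟨‖a‖ • (-x), ?_, ?_⟩
    · rw [norm_smul, norm_norm, norm_neg]; nlinarith
    · rw [map_smul, smul_eq_mul, map_neg, ← hmul]
      rw [Real.norm_of_nonpos hs] at hx2
      gcongr

/-- The dual of a space with strongly midpoint convex squared norm is 2-uniformly smooth. -/
theorem SqMidpointConvex.dual_smooth {k : ℝ} (hk : 0 < k) (h : SqMidpointConvex E k)
    (a b : StrongDual ℝ E) :
    ‖a + b‖ ^ 2 + ‖a - b‖ ^ 2 ≤ 2 * (‖a‖ ^ 2 + ‖b‖ ^ 2 / k) := by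
  set N := ‖a + b‖ ^ 2 + ‖a - b‖ ^ 2 with hN
  set S := ‖a‖ ^ 2 + ‖b‖ ^ 2 / k with hS
  have hN0 : 0 ≤ N := by positivity
  have hS0 : 0 ≤ S := by positivity
  -- Let `x`, `y` almost norm `a + b` and `a - b`. Then `N` is nearly `a (x + y) + b (x - y)`.
  -- Cauchy–Schwarz with weights `1` and `k` produces the factor `S` and the quantity `‖x + y‖² +
  -- k‖x - y‖²`, which midpoint convexity bounds by `2 N`.
  have key : ∀ η : ℝ, 0 < η → N ≤ √(2 * S * N) + η := by
    intro η hη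
    obtain ⟨x, hx, hx'⟩ := exists_norm_le_sq_sub_le (a + b) (half_pos hη)
    obtain ⟨y, hy, hy'⟩ := exists_norm_le_sq_sub_le (a - b) (half_pos hη)
    have hm := h x y
    rw [norm_smul] at hm
    norm_num at hm
    have hx2 : ‖x‖ ^ 2 ≤ ‖a + b‖ ^ 2 := pow_le_pow_left₀ (norm_nonneg _) hx 2
    have hy2 : ‖y‖ ^ 2 ≤ ‖a - b‖ ^ 2 := pow_le_pow_left₀ (norm_nonneg _) hy 2
    have hm' : ‖x + y‖ ^ 2 + k * ‖x - y‖ ^ 2 ≤ 2 * N := by nlinarith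
    have e : (a + b) x + (a - b) y = a (x + y) + b (x - y) := by
      simp only [add_apply, sub_apply, map_add, map_sub]
      ring
    have h1 : a (x + y) ≤ ‖a‖ * ‖x + y‖ := (le_abs_self _).trans (a.le_opNorm _)
    have h2 : b (x - y) ≤ ‖b‖ * ‖x - y‖ := (le_abs_self _).trans (b.le_opNorm _)
    have h3 : ‖a‖ * ‖x + y‖ + ‖b‖ * ‖x - y‖ ≤ √(2 * S * N) := by
      apply Real.le_sqrt_of_sq_le
      have hcs : (‖a‖ * ‖x + y‖ + ‖b‖ * ‖x - y‖) ^ 2 ≤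
          S * (‖x + y‖ ^ 2 + k * ‖x - y‖ ^ 2) := by
        have hid : S * (‖x + y‖ ^ 2 + k * ‖x - y‖ ^ 2) -
            (‖a‖ * ‖x + y‖ + ‖b‖ * ‖x - y‖) ^ 2 =
            (k * ‖a‖ * ‖x - y‖ - ‖b‖ * ‖x + y‖) ^ 2 / k := by
          rw [hS]; field_simp; ring
        have : 0 ≤ (k * ‖a‖ * ‖x - y‖ - ‖b‖ * ‖x + y‖) ^ 2 / k := by positivity
        linarith
      nlinarith
    linarith
  have h4 : N ≤ √(2 * S * N) := le_of_forall_pos_le_add key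
  have h5 : N ^ 2 ≤ 2 * S * N := by
    have := pow_le_pow_left₀ hN0 h4 2
    rwa [Real.sq_sqrt (by positivity)] at this
  by_contra hcon
  push Not at hcon
  nlinarith

theorem LinearIsometry.exists_eq_of_forall_exists_norm_sub_lt {F : Type*} [NormedAddCommGroup F]
    [NormedSpace ℝ F] [CompleteSpace E] (L : E →ₗᵢ[ℝ] F) {y : F}
    (hy : ∀ ε : ℝ, 0 < ε → ∃ x, ‖y - L x‖ < ε) : ∃ x, L x = y := by
  have hclosed : IsClosed (Set.range L) := L.isometry.isClosedEmbedding.isClosed_range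
  refine hclosed.closure_subset (Metric.mem_closure_iff.2 fun ε hε => ?_)
  obtain ⟨x, hx⟩ := hy ε hε
  exact ⟨L x, ⟨x, rfl⟩, by rwa [dist_eq_norm]⟩

/-- Milman–Pettis: `E` is reflexive. If `Θ` almost norms `φ` and `x` almost norms `φ`, then `Θ` and
evaluation at `x` both almost support the dual norm at `φ`. Uniform smoothness of that norm forces
them to be close, and completeness makes the image of `E` closed in the bidual. -/
theorem SqMidpointConvex.exists_eq_eval [CompleteSpace E] {k : ℝ} (hk : 0 < k)
    (h : SqMidpointConvex E k) (Θ : StrongDual ℝ (StrongDual ℝ E)) (hΘ : ‖Θ‖ = 1) :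
    ∃ x : E, ‖x‖ = 1 ∧ ∀ φ : StrongDual ℝ E, Θ φ = φ x := by
  suffices hex : ∃ x : E, NormedSpace.inclusionInDoubleDualLi ℝ x = Θ by
    obtain ⟨x, rfl⟩ := hex
    exact ⟨x, by rw [← hΘ]; exact ((NormedSpace.inclusionInDoubleDualLi ℝ).norm_map x).symm,
      fun φ => rfl⟩
  refine LinearIsometry.exists_eq_of_forall_exists_norm_sub_lt
    (F := StrongDual ℝ (StrongDual ℝ E)) (NormedSpace.inclusionInDoubleDualLi ℝ (E := E)) (fun ε hε => ?_)
  set s : ℝ := min 1 (ε / (2 * (2 + 1 / k))) with hs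
  have hs0 : 0 < s := by rw [hs]; positivity
  have hs1 : s ≤ 1 := min_le_left _ _
  have hsε : s * (2 * (2 + 1 / k)) ≤ ε := by
    rw [← le_div_iff₀ (by positivity)]; exact min_le_right _ _
  -- Norming errors of order `s²` against perturbations `φ ± s • b` of size `s`: after division by
  -- `s` the error is still of order `s`.
  obtain ⟨φ, hφ1, hφ2⟩ := exists_norm_le_sq_sub_le Θ (η := s ^ 2) (by positivity)
  rw [hΘ] at hφ1 hφ2
  obtain ⟨x, hx1, hx2⟩ := exists_norm_le_sq_sub_le φ (η := s ^ 2) (by positivity)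
  have hφlow : 1 - s ^ 2 ≤ ‖φ‖ := by
    have h1 := (le_abs_self _).trans (Θ.le_opNorm φ)
    rw [hΘ] at h1
    linarith
  have hφsq : 1 - 2 * s ^ 2 ≤ ‖φ‖ ^ 2 := by
    have hs2 : s ^ 2 ≤ 1 := by nlinarith
    have := pow_le_pow_left₀ (by linarith) hφlow 2
    nlinarith [sq_nonneg (s ^ 2)]
  refine ⟨x, ?_⟩
  have key : ∀ b : StrongDual ℝ E, ‖b‖ = 1 →
      (Θ - NormedSpace.inclusionInDoubleDualLi ℝ x) b ≤ s * (4 + 1 / k) := by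
    intro b hb
    have hsm := h.dual_smooth hk φ (s • b)
    have hsb : ‖s • b‖ = s := by rw [norm_smul, hb, mul_one, Real.norm_of_nonneg hs0.le]
    rw [hsb] at hsm
    have hp : Θ (φ + s • b) ≤ ‖φ + s • b‖ := by
      have := (le_abs_self _).trans (Θ.le_opNorm (φ + s • b))
      rwa [hΘ, one_mul] at this
    have hq : (φ - s • b) x ≤ ‖φ - s • b‖ := by
      have h1 := (le_abs_self _).trans ((φ - s • b).le_opNorm x)
      have h2 : ‖x‖ ≤ 1 := hx1.trans hφ1
      exact h1.trans (mul_le_of_le_one_right (norm_nonneg _) h2)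
    have hφ2' : ‖φ‖ ^ 2 ≤ 1 := pow_le_one₀ (norm_nonneg _) hφ1
    have hsum : ‖φ + s • b‖ + ‖φ - s • b‖ ≤ 2 + s ^ 2 / k := by
      have h1 : (‖φ + s • b‖ + ‖φ - s • b‖) ^ 2 ≤ (2 + s ^ 2 / k) ^ 2 := by
        have h2 : (‖φ + s • b‖ + ‖φ - s • b‖) ^ 2 ≤
            2 * (‖φ + s • b‖ ^ 2 + ‖φ - s • b‖ ^ 2) := by
          nlinarith [sq_nonneg (‖φ + s • b‖ - ‖φ - s • b‖)]
        nlinarith [sq_nonneg (s ^ 2 / k)]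
      exact le_of_sq_le_sq h1 (by positivity)
    have e1 : (Θ - NormedSpace.inclusionInDoubleDualLi ℝ x) b = Θ b - b x := rfl
    rw [map_add, map_smul, smul_eq_mul] at hp
    rw [sub_apply, smul_apply, smul_eq_mul] at hq
    rw [e1]
    have h6 : s * (Θ b - b x) ≤ s * (s * (4 + 1 / k)) := by
      have : s * (s * (4 + 1 / k)) = 4 * s ^ 2 + s ^ 2 / k := by ring
      rw [this]; nlinarith
    exact le_of_mul_le_mul_left h6 hs0
  have hnorm : ‖Θ - NormedSpace.inclusionInDoubleDualLi ℝ x‖ ≤ s * (4 + 1 / k) := by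
    refine ContinuousLinearMap.opNorm_le_of_unit_norm (by positivity) fun b hb => ?_
    rw [Real.norm_eq_abs, abs_le]
    have h1 := key b hb
    have h2 := key (-b) (by rwa [norm_neg])
    rw [map_neg] at h2
    constructor <;> linarith
  refine hnorm.trans_lt (lt_of_lt_of_le ?_ hsε)
  have : 0 < 1 / k := by positivity
  nlinarith

theorem StrongDual.norm_pos_of_apply_pos {Θ : StrongDual ℝ E} {x : E} (hx : 0 < Θ x) : 0 < ‖Θ‖ := by
  refine norm_pos_iff.mpr ?_
  rintro rfl
  exact absurd hx (lt_irrefl _)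

theorem StrongDual.norm_inv_norm_smul {Θ : StrongDual ℝ E} (hΘ : 0 < ‖Θ‖) :
    ‖‖Θ‖⁻¹ • Θ‖ = 1 := by
  rw [norm_smul, norm_inv, norm_norm, inv_mul_cancel₀ hΘ.ne']

/-- Norming functionals of a dense sequence span a dense subspace. A functional on the dual that
vanishes on them is, up to scaling, evaluation at a unit vector `x`. A point of the sequence within
`1/2` of `x` would then have norm below `1/2`, which contradicts `‖x‖ = 1`. -/
theorem SqMidpointConvex.separableSpace_dual [CompleteSpace E]
    [TopologicalSpace.SeparableSpace E] {k : ℝ} (hk : 0 < k) (h : SqMidpointConvex E k) :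
    TopologicalSpace.SeparableSpace (StrongDual ℝ E) := by
  choose ψ hψ1 hψ2 using fun d : E => exists_dual_vector'' ℝ d
  set D := TopologicalSpace.denseSeq E
  set Y : Submodule ℝ (StrongDual ℝ E) :=
    (Submodule.span ℝ (Set.range fun j => ψ (D j))).topologicalClosure with hY
  have hsep : TopologicalSpace.IsSeparable (Y : Set (StrongDual ℝ E)) := by
    rw [hY, Submodule.topologicalClosure_coe]
    exact ((Set.countable_range _).isSeparable.span).closure
  suffices hYtop : ∀ φ : StrongDual ℝ E, φ ∈ Y by
    rw [← TopologicalSpace.isSeparable_univ_iff]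
    exact hsep.mono fun φ _ => hYtop φ
  by_contra hcon
  push Not at hcon
  obtain ⟨φ, hφ⟩ := hcon
  obtain ⟨Θ, u, hΘY, hΘφ⟩ := geometric_hahn_banach_closed_point (s := (Y : Set (StrongDual ℝ E)))
    Y.convex (by rw [hY]; exact Submodule.isClosed_topologicalClosure _) hφ
  have hu : 0 < u := by simpa using hΘY 0 Y.zero_mem
  have hzero : ∀ a ∈ Y, Θ a = 0 := by
    intro a ha
    by_contra hne
    have := hΘY ((u / Θ a) • a) (Y.smul_mem _ ha)
    rw [map_smul, smul_eq_mul, div_mul_cancel₀ _ hne] at this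
    exact lt_irrefl _ this
  have hΘ0 : 0 < ‖Θ‖ := StrongDual.norm_pos_of_apply_pos (E := StrongDual ℝ E) (hu.trans hΘφ)
  obtain ⟨x, hxn, hx⟩ := h.exists_eq_eval hk (‖Θ‖⁻¹ • Θ)
    (StrongDual.norm_inv_norm_smul (E := StrongDual ℝ E) hΘ0)
  obtain ⟨j, hj⟩ := (TopologicalSpace.denseRange_denseSeq E).exists_dist_lt x
    (ε := 1 / 2) (by norm_num)
  have hjx : ψ (D j) x = 0 := by
    rw [← hx, smul_apply, hzero _ (Submodule.le_topologicalClosure _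
      (Submodule.subset_span ⟨j, rfl⟩)), smul_zero]
  have h2 : ‖D j‖ ≤ ‖D j - x‖ := by
    have h3 : ψ (D j) (D j - x) = ‖D j‖ := by rw [map_sub, hjx, hψ2, sub_zero]; rfl
    have h4 := (le_abs_self _).trans ((ψ (D j)).le_opNorm (D j - x))
    rw [h3] at h4
    exact h4.trans (mul_le_of_le_one_left (norm_nonneg _) (hψ1 _))
  have h5 : ‖x‖ ≤ ‖x - D j‖ + ‖D j‖ := by
    have := norm_add_le (x - D j) (D j)
    rwa [sub_add_cancel] at this
  rw [dist_eq_norm] at hj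
  change ‖x - D j‖ < 1 / 2 at hj
  rw [norm_sub_rev] at h2
  linarith

end Geometry

/-! ### Suprema over finite index sets. -/

section FiniteSup

variable {ι : Type*} [Finite ι]

theorem le_iSup_of_finite (f : ι → ℝ) (v : ι) : f v ≤ ⨆ w, f w :=
  le_ciSup (Set.finite_range f).bddAbove v

theorem iSup_mono_of_finite {f g : ι → ℝ} (h : ∀ v, f v ≤ g v) : ⨆ v, f v ≤ ⨆ v, g v :=
  ciSup_mono (Set.finite_range g).bddAbove h

/-- At maximizers `v`, `w` of the two left suprema only the difference `a v - a w` enters. It is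
dominated by `|b v - b w|`, whose sign decides which of `v`, `w` is used in which supremum on the
right. This is the one-coordinate case of the Rademacher comparison. -/
theorem iSup_add_iSup_sub_le [Nonempty ι] {a b : ι → ℝ} (c : ι → ℝ)
    (h : ∀ v w, |a v - a w| ≤ |b v - b w|) :
    (⨆ v, (c v + a v)) + ⨆ v, (c v - a v) ≤ (⨆ v, (c v + b v)) + ⨆ v, (c v - b v) := by
  obtain ⟨v, hv⟩ := exists_eq_ciSup_of_finite (f := fun v => c v + a v)
  obtain ⟨w, hw⟩ := exists_eq_ciSup_of_finite (f := fun v => c v - a v)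
  rw [← hv, ← hw]
  have h1 := (le_abs_self _).trans (h v w)
  rcases le_total (b w) (b v) with hb | hb
  · rw [abs_of_nonneg (by linarith)] at h1
    have h2 := le_iSup_of_finite (fun v => c v + b v) v
    have h3 := le_iSup_of_finite (fun v => c v - b v) w
    linarith
  · rw [abs_of_nonpos (by linarith)] at h1
    have h2 := le_iSup_of_finite (fun v => c v + b v) w
    have h3 := le_iSup_of_finite (fun v => c v - b v) v
    linarith

end FiniteSup

/-! ### Rademacher averages: comparison, sub-Gaussian bounds, type 2, strategies. -/

/-- The sign encoded by a boolean. -/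
def sgn (b : Bool) : ℝ := if b then 1 else -1

theorem sgn_true : sgn true = 1 := rfl

theorem sgn_false : sgn false = -1 := rfl

theorem sgn_not (b : Bool) : sgn (!b) = -sgn b := by cases b <;> simp [sgn]

theorem abs_sgn (b : Bool) : |sgn b| = 1 := by cases b <;> simp [sgn]

/-- The average over independent random signs. -/
noncomputable def signAvg {n : ℕ} (F : (Fin n → Bool) → ℝ) : ℝ := (∑ ε, F ε) / 2 ^ n

section SignAvg

variable {n : ℕ}

theorem signAvg_zero (F : (Fin 0 → Bool) → ℝ) : signAvg F = F Fin.elim0 := by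
  simp only [signAvg, Fintype.sum_unique, pow_zero, div_one]
  exact congrArg F (Subsingleton.elim _ _)

theorem signAvg_succ (F : (Fin (n + 1) → Bool) → ℝ) :
    signAvg F = (signAvg (fun ε => F (Fin.cons true ε)) +
      signAvg (fun ε => F (Fin.cons false ε))) / 2 := by
  unfold signAvg
  rw [← (Fin.consEquiv fun _ : Fin (n + 1) => Bool).sum_comp, Fintype.sum_prod_type]
  simp only [Fintype.sum_bool]
  rw [pow_succ]
  change (∑ y, F (Fin.cons true y) + ∑ y, F (Fin.cons false y)) / (2 ^ n * 2) = _
  ring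

theorem signAvg_mono {F G : (Fin n → Bool) → ℝ} (h : ∀ ε, F ε ≤ G ε) : signAvg F ≤ signAvg G := by
  unfold signAvg
  gcongr
  exact h _

theorem signAvg_const (c : ℝ) : signAvg (fun _ : Fin n → Bool => c) = c := by
  simp [signAvg]

theorem signAvg_add (F G : (Fin n → Bool) → ℝ) :
    signAvg (fun ε => F ε + G ε) = signAvg F + signAvg G := by
  simp only [signAvg, Finset.sum_add_distrib, add_div]

theorem signAvg_const_mul (c : ℝ) (F : (Fin n → Bool) → ℝ) :
    signAvg (fun ε => c * F ε) = c * signAvg F := by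
  simp only [signAvg, ← Finset.mul_sum, mul_div_assoc]

theorem signAvg_sum {κ : Type*} (s : Finset κ) (F : κ → (Fin n → Bool) → ℝ) :
    signAvg (fun ε => ∑ i ∈ s, F i ε) = ∑ i ∈ s, signAvg (F i) := by
  simp only [signAvg]
  rw [Finset.sum_comm, Finset.sum_div]

theorem signAvg_pos {F : (Fin n → Bool) → ℝ} (h : ∀ ε, 0 < F ε) : 0 < signAvg F := by
  unfold signAvg
  have : 0 < ∑ ε, F ε := Finset.sum_pos (fun ε _ => h ε) Finset.univ_nonempty
  positivity

theorem signAvg_comp_equiv (e : (Fin n → Bool) ≃ (Fin n → Bool)) (F : (Fin n → Bool) → ℝ) :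
    signAvg (fun ε => F (e ε)) = signAvg F := by
  unfold signAvg
  rw [e.sum_comp]

theorem exp_signAvg_le (F : (Fin n → Bool) → ℝ) :
    Real.exp (signAvg F) ≤ signAvg (fun ε => Real.exp (F ε)) := by
  have h := convexOn_exp.map_sum_le (t := Finset.univ) (w := fun _ : Fin n → Bool => (1 / 2 ^ n : ℝ))
    (p := F) (fun _ _ => by positivity) (by simp) (fun _ _ => Set.mem_univ _)
  simp only [smul_eq_mul, ← Finset.mul_sum] at h
  unfold signAvg
  rwa [div_eq_inv_mul, div_eq_inv_mul, ← one_div]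

theorem signAvg_sq_le (F : (Fin n → Bool) → ℝ) :
    signAvg F ^ 2 ≤ signAvg (fun ε => F ε ^ 2) := by
  have h := (even_two.convexOn_pow (𝕜 := ℝ)).map_sum_le (t := Finset.univ)
    (w := fun _ : Fin n → Bool => (1 / 2 ^ n : ℝ))
    (p := F) (fun _ _ => by positivity) (by simp) (fun _ _ => Set.mem_univ _)
  simp only [smul_eq_mul, ← Finset.mul_sum] at h
  unfold signAvg
  rwa [div_eq_inv_mul, div_eq_inv_mul, ← one_div]

theorem abs_signAvg_le {F : (Fin n → Bool) → ℝ} {M : ℝ} (h : ∀ ε, |F ε| ≤ M) :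
    |signAvg F| ≤ M := by
  rw [abs_le]
  constructor
  · rw [← signAvg_const (n := n) (-M)]
    exact signAvg_mono fun ε => (abs_le.mp (h ε)).1
  · rw [← signAvg_const (n := n) M]
    exact signAvg_mono fun ε => (abs_le.mp (h ε)).2

/-- Comparison of Rademacher averages: smaller increments give a smaller expected supremum. -/
theorem signAvg_iSup_comparison {ι : Type*} [Finite ι] [Nonempty ι] (a b : Fin n → ι → ℝ)
    (h : ∀ i v w, |a i v - a i w| ≤ |b i v - b i w|) (c : ι → ℝ) :
    signAvg (fun ε => ⨆ v, (c v + ∑ i, sgn (ε i) * a i v)) ≤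
      signAvg (fun ε => ⨆ v, (c v + ∑ i, sgn (ε i) * b i v)) := by
  induction n generalizing c with
  | zero => simp
  | succ n ih =>
    rw [signAvg_succ, signAvg_succ, ← signAvg_add, ← signAvg_add]
    simp only [Fin.sum_univ_succ, Fin.cons_zero, Fin.cons_succ, sgn_true, sgn_false]
    -- The induction hypothesis replaces `a` by `b` in all later coordinates, with the first
    -- coordinate absorbed in the shift `c`; the two values of the first sign are then treated
    -- together.
    have h1 : ∀ s : ℝ, signAvg (fun ε => ⨆ v, (c v + (s * a 0 v +
          ∑ i : Fin n, sgn (ε i) * a i.succ v))) ≤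
        signAvg (fun ε => ⨆ v, (c v + (s * a 0 v + ∑ i : Fin n, sgn (ε i) * b i.succ v))) := by
      intro s
      have := ih (fun i => a i.succ) (fun i => b i.succ) (fun i => h i.succ)
        (fun v => c v + s * a 0 v)
      simpa only [add_assoc] using this
    have h2 := add_le_add (h1 1) (h1 (-1))
    rw [← signAvg_add, ← signAvg_add] at h2
    refine div_le_div_of_nonneg_right (h2.trans (signAvg_mono fun ε => ?_)) (by norm_num)
    have h3 := iSup_add_iSup_sub_le (a := a 0) (b := b 0)
      (fun v => c v + ∑ i : Fin n, sgn (ε i) * b i.succ v) (h 0)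
    convert h3 using 3 <;> · funext v; ring

/-- Contraction principle. -/
theorem signAvg_iSup_contraction {ι : Type*} [Finite ι] [Nonempty ι] {φ : ℝ → ℝ} {L : ℝ}
    (hL : 0 ≤ L) (hφ : ∀ x y, |φ x - φ y| ≤ L * |x - y|) (y : Fin n → ι → ℝ) :
    signAvg (fun ε => ⨆ v, ∑ i, sgn (ε i) * φ (y i v)) ≤
      L * signAvg (fun ε => ⨆ v, ∑ i, sgn (ε i) * y i v) := by
  have h := signAvg_iSup_comparison (fun i v => φ (y i v)) (fun i v => L * y i v)
    (fun i v w => by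
      rw [← mul_sub, abs_mul, abs_of_nonneg hL]
      exact hφ _ _) (fun _ => 0)
  simp only [zero_add] at h
  rw [← signAvg_const_mul]
  refine h.trans_eq ?_
  congr 1
  funext ε
  rw [Real.mul_iSup_of_nonneg hL]
  congr 1
  funext v
  rw [Finset.mul_sum]
  exact Finset.sum_congr rfl fun i _ => by ring

/-- Hölder's inequality for exponentials, by convexity of `exp` after normalizing both averages to
at most one. -/
theorem signAvg_exp_holder {U W : (Fin n → Bool) → ℝ} {x y θ : ℝ} (hθ0 : 0 ≤ θ) (hθ1 : θ ≤ 1)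
    (hU : signAvg (fun ε => Real.exp (U ε)) ≤ Real.exp x)
    (hW : signAvg (fun ε => Real.exp (W ε)) ≤ Real.exp y) :
    signAvg (fun ε => Real.exp ((1 - θ) * U ε + θ * W ε)) ≤ Real.exp ((1 - θ) * x + θ * y) := by
  have h1 : ∀ ε, Real.exp ((1 - θ) * U ε + θ * W ε) ≤ Real.exp ((1 - θ) * x + θ * y) *
      ((1 - θ) * Real.exp (-x) * Real.exp (U ε) + θ * Real.exp (-y) * Real.exp (W ε)) := by
    intro ε
    have h := convexOn_exp.2 (Set.mem_univ (U ε - x)) (Set.mem_univ (W ε - y))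
      (by linarith : 0 ≤ 1 - θ) hθ0 (by ring)
    simp only [smul_eq_mul] at h
    have e : Real.exp ((1 - θ) * U ε + θ * W ε) = Real.exp ((1 - θ) * x + θ * y) *
        Real.exp ((1 - θ) * (U ε - x) + θ * (W ε - y)) := by
      rw [← Real.exp_add]; congr 1; ring
    rw [e]
    refine mul_le_mul_of_nonneg_left (h.trans_eq ?_) (Real.exp_pos _).le
    rw [sub_eq_add_neg (U ε), sub_eq_add_neg (W ε), Real.exp_add, Real.exp_add]
    ring
  refine (signAvg_mono h1).trans ?_
  rw [signAvg_const_mul, signAvg_add, signAvg_const_mul, signAvg_const_mul]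
  have hx : Real.exp (-x) * Real.exp x = 1 := by rw [← Real.exp_add]; simp
  have hy : Real.exp (-y) * Real.exp y = 1 := by rw [← Real.exp_add]; simp
  have h2 : (1 - θ) * Real.exp (-x) * signAvg (fun ε => Real.exp (U ε)) ≤ 1 - θ := by
    calc _ ≤ (1 - θ) * Real.exp (-x) * Real.exp x := by
          refine mul_le_mul_of_nonneg_left hU (mul_nonneg (by linarith) (Real.exp_pos _).le)
      _ = _ := by rw [mul_assoc, hx, mul_one]
  have h3 : θ * Real.exp (-y) * signAvg (fun ε => Real.exp (W ε)) ≤ θ := by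
    calc _ ≤ θ * Real.exp (-y) * Real.exp y := by
          refine mul_le_mul_of_nonneg_left hW (mul_nonneg hθ0 (Real.exp_pos _).le)
      _ = _ := by rw [mul_assoc, hy, mul_one]
  exact mul_le_of_le_one_right (Real.exp_pos _).le (by linarith)

/-- The scalar optimization behind Talagrand's convex concentration. The witness is `θ = min (4 l)
1`, the minimizer of `θ²/8 + (1 - θ) l` on `[0, 1]`. -/
theorem exists_exp_sq_add_le {l : ℝ} (hl : 0 ≤ l) :
    ∃ θ : ℝ, 0 ≤ θ ∧ θ ≤ 1 ∧ Real.exp (θ ^ 2 / 8 + (1 - θ) * l) ≤ 2 - Real.exp (-l) := by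
  rcases le_total l (1 / 4) with h | h
  · refine ⟨4 * l, by linarith, by linarith, ?_⟩
    have e : (4 * l) ^ 2 / 8 + (1 - 4 * l) * l = l - 2 * l ^ 2 := by ring
    rw [e]
    have hb := abs_le.mp (Real.abs_exp_sub_one_sub_id_le (x := l - 2 * l ^ 2)
      (by rw [abs_le]; constructor <;> nlinarith))
    have hd : Real.exp (-l) ≤ 1 - l + l ^ 2 := by
      have := abs_le.mp (Real.abs_exp_sub_one_sub_id_le (x := -l)
        (by rw [abs_le]; constructor <;> linarith))
      nlinarith
    nlinarith [mul_nonneg (pow_nonneg hl 3) (by linarith : 0 ≤ 1 - l)]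
  · refine ⟨1, by norm_num, le_rfl, ?_⟩
    have h1 : Real.exp (-l) ≤ Real.exp (-(1 / 4)) := Real.exp_le_exp.mpr (by linarith)
    have hb := abs_le.mp (Real.abs_exp_sub_one_sub_id_le (x := -(1 / 4 : ℝ)) (by rw [abs_le]; norm_num))
    have hc := abs_le.mp (Real.abs_exp_sub_one_sub_id_le (x := (1 / 8 : ℝ)) (by rw [abs_le]; norm_num))
    norm_num at hb hc ⊢
    linarith [hb.2, hc.2]

/-- The two-point case of the inequality on the cube. If `x ≤ y`, take `θ = 0` for `P` and the
optimal `θ` for `N`. With `r = exp (-(y - x))` the product is at most `(3 - r)(1 + r)/4 = 1 - (1 -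
r)²/4`. -/
theorem avg_mul_avg_le_one {x y P N : ℝ}
    (hP : ∀ θ : ℝ, 0 ≤ θ → θ ≤ 1 → P ≤ Real.exp (θ ^ 2 / 8 + ((1 - θ) * x + θ * y)))
    (hN : ∀ θ : ℝ, 0 ≤ θ → θ ≤ 1 → N ≤ Real.exp (θ ^ 2 / 8 + ((1 - θ) * y + θ * x))) :
    (P + N) / 2 * ((Real.exp (-x) + Real.exp (-y)) / 2) ≤ 1 := by
  wlog hxy : x ≤ y generalizing x y P N
  · have := this (x := y) (y := x) hN hP (le_of_not_ge hxy)
    rw [add_comm P N, add_comm (Real.exp (-x))]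
    exact this
  obtain ⟨θ, h0, h1, hθ⟩ := exists_exp_sq_add_le (sub_nonneg.mpr hxy)
  have hP0 : P ≤ Real.exp x := by simpa using hP 0 le_rfl zero_le_one
  have hN1 : N ≤ Real.exp x * (2 - Real.exp (-(y - x))) := by
    refine (hN θ h0 h1).trans ?_
    have e : θ ^ 2 / 8 + ((1 - θ) * y + θ * x) = x + (θ ^ 2 / 8 + (1 - θ) * (y - x)) := by ring
    rw [e, Real.exp_add]
    exact mul_le_mul_of_nonneg_left hθ (Real.exp_pos _).le
  set r := Real.exp (-(y - x)) with hr
  have hyr : Real.exp (-y) = Real.exp (-x) * r := by rw [hr, ← Real.exp_add]; congr 1; ring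
  have hxx : Real.exp x * Real.exp (-x) = 1 := by rw [← Real.exp_add]; simp
  have hr0 : 0 < r := Real.exp_pos _
  rw [hyr]
  have hD : 0 ≤ (Real.exp (-x) + Real.exp (-x) * r) / 2 := by positivity
  calc (P + N) / 2 * ((Real.exp (-x) + Real.exp (-x) * r) / 2)
      ≤ (Real.exp x + Real.exp x * (2 - r)) / 2 * ((Real.exp (-x) + Real.exp (-x) * r) / 2) := by
        refine mul_le_mul_of_nonneg_right ?_ hD
        linarith
    _ = (Real.exp x * Real.exp (-x)) * ((3 - r) * (1 + r) / 4) := by ring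
    _ ≤ 1 := by rw [hxx]; nlinarith [sq_nonneg (1 - r)]

/-- An infimum-convolution inequality on the cube for suprema of affine functions: the penalty `8
t²` pays for partially flipping each sign. Conditioning on the first sign leaves two instances in
lower dimension, which are interpolated by Hölder and recombined by the two-point case. -/
theorem signAvg_exp_mul_signAvg_exp_neg_le_one {ι : Type*} [Finite ι] [Nonempty ι]
    (t : Fin n → ι → ℝ) (a : ι → ℝ) :
    signAvg (fun ε => Real.exp (⨆ v, (a v + ∑ i, (sgn (ε i) * t i v - 8 * t i v ^ 2)))) *
      signAvg (fun ε => Real.exp (-⨆ v, (a v + ∑ i, sgn (ε i) * t i v))) ≤ 1 := by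
  induction n generalizing a with
  | zero =>
    rw [signAvg_zero, signAvg_zero, ← Real.exp_add]
    simp
  | succ n ih =>
    rw [signAvg_succ, signAvg_succ (fun ε => Real.exp (-_))]
    simp only [Fin.sum_univ_succ, Fin.cons_zero, Fin.cons_succ, sgn_true, sgn_false]
    -- The negative exponential average with first sign `s`; its negative logarithms at `s = 1` and
    -- `s = -1` serve as `x` and `y` in the two-point inequality.
    set F : ℝ → ℝ := fun s => signAvg (fun ε : Fin n → Bool =>
      Real.exp (-⨆ v, (a v + (s * t 0 v + ∑ i : Fin n, sgn (ε i) * t i.succ v)))) with hF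
    have hFpos : ∀ s, 0 < F s := fun s => signAvg_pos fun ε => Real.exp_pos _
    have hFlog : ∀ s, F s = Real.exp (-(-Real.log (F s))) := fun s => by
      rw [neg_neg, Real.exp_log (hFpos s)]
    have hIH : ∀ s : ℝ, signAvg (fun ε : Fin n → Bool => Real.exp (⨆ v, (a v + (s * t 0 v +
        ∑ i : Fin n, (sgn (ε i) * t i.succ v - 8 * t i.succ v ^ 2))))) ≤
        Real.exp (-Real.log (F s)) := by
      intro s
      have h := ih (fun i => t i.succ) (fun v => a v + s * t 0 v)
      simp only [add_assoc] at h
      rw [Real.exp_neg, Real.exp_log (hFpos s), ← one_div, le_div_iff₀ (hFpos s)]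
      exact h
    have hstep : ∀ s : ℝ, |s| = 1 → ∀ θ : ℝ, 0 ≤ θ → θ ≤ 1 →
        signAvg (fun ε : Fin n → Bool => Real.exp (⨆ v, (a v + (s * t 0 v - 8 * t 0 v ^ 2 +
          ∑ i : Fin n, (sgn (ε i) * t i.succ v - 8 * t i.succ v ^ 2))))) ≤
        Real.exp (θ ^ 2 / 8 + ((1 - θ) * (-Real.log (F s)) + θ * (-Real.log (F (-s))))) := by
      intro s hs θ h0 h1
      have h2 := signAvg_exp_holder h0 h1 (hIH s) (hIH (-s))
      rw [Real.exp_add]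
      refine le_trans ?_ (mul_le_mul_of_nonneg_left h2 (Real.exp_pos _).le)
      rw [← signAvg_const_mul]
      refine signAvg_mono fun ε => ?_
      rw [← Real.exp_add, Real.exp_le_exp]
      refine ciSup_le fun v => ?_
      have h3 := le_iSup_of_finite (fun v => a v + (s * t 0 v +
        ∑ i : Fin n, (sgn (ε i) * t i.succ v - 8 * t i.succ v ^ 2))) v
      have h4 := le_iSup_of_finite (fun v => a v + (-s * t 0 v +
        ∑ i : Fin n, (sgn (ε i) * t i.succ v - 8 * t i.succ v ^ 2))) v
      have h5 := mul_le_mul_of_nonneg_left h3 (by linarith : 0 ≤ 1 - θ)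
      have h6 := mul_le_mul_of_nonneg_left h4 h0
      have hs2 : s ^ 2 = 1 := by rw [← sq_abs, hs]; norm_num
      -- Completing the square: `s t - 8 t² ≤ θ²/8 + (1 - θ) s t + θ (-s) t` when `s² = 1`. This
      -- fixes the constant `8` in the penalty.
      have h7 : 0 ≤ (θ - 8 * (s * t 0 v)) ^ 2 / 8 := by positivity
      have h8 : (θ - 8 * (s * t 0 v)) ^ 2 / 8 = θ ^ 2 / 8 - 2 * θ * (s * t 0 v) + 8 * t 0 v ^ 2 := by
        rw [sub_sq, mul_pow, mul_pow, hs2]; ring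
      linarith
    have hfin := avg_mul_avg_le_one (hstep 1 (by simp)) 
      (by simpa only [neg_neg] using hstep (-1) (by simp))
    rw [← hFlog, ← hFlog] at hfin
    exact hfin

/-- Sub-Gaussian bound for a supremum of Rademacher sums in terms of the weak variance. -/
theorem signAvg_exp_iSup_le {ι : Type*} [Finite ι] [Nonempty ι] (t : Fin n → ι → ℝ) :
    signAvg (fun ε => Real.exp (⨆ v, ∑ i, sgn (ε i) * t i v)) ≤
      Real.exp (8 * (⨆ v, ∑ i, t i v ^ 2) + signAvg (fun ε => ⨆ v, ∑ i, sgn (ε i) * t i v)) := by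
  set V := ⨆ v, ∑ i, t i v ^ 2 with hV
  have h := signAvg_exp_mul_signAvg_exp_neg_le_one t (fun _ => 0)
  simp only [zero_add] at h
  -- Jensen replaces the negative exponential average by the exponential of minus the mean. Next,
  -- the penalty inside the supremum is removed at the price `8 V`.
  have h1 : Real.exp (-signAvg (fun ε => ⨆ v, ∑ i, sgn (ε i) * t i v)) ≤
      signAvg (fun ε => Real.exp (-⨆ v, ∑ i, sgn (ε i) * t i v)) := by
    have := exp_signAvg_le (fun ε => -⨆ v, ∑ i, sgn (ε i) * t i v)
    refine le_trans (le_of_eq ?_) this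
    congr 1
    have h2 := signAvg_const_mul (-1) (fun ε => ⨆ v, ∑ i, sgn (ε i) * t i v)
    simp only [neg_mul, one_mul] at h2
    exact h2.symm
  have h2 : Real.exp (-(8 * V)) * signAvg (fun ε => Real.exp (⨆ v, ∑ i, sgn (ε i) * t i v)) ≤
      signAvg (fun ε => Real.exp (⨆ v, ∑ i, (sgn (ε i) * t i v - 8 * t i v ^ 2))) := by
    rw [← signAvg_const_mul]
    refine signAvg_mono fun ε => ?_
    rw [← Real.exp_add, Real.exp_le_exp]
    suffices h3 : (⨆ v, ∑ i, sgn (ε i) * t i v) ≤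
        (⨆ v, ∑ i, (sgn (ε i) * t i v - 8 * t i v ^ 2)) + 8 * V by linarith
    refine ciSup_le fun v => ?_
    have h4 := le_iSup_of_finite (fun v => ∑ i, (sgn (ε i) * t i v - 8 * t i v ^ 2)) v
    have h5 := le_iSup_of_finite (fun v => ∑ i, t i v ^ 2) v
    simp only [Finset.sum_sub_distrib, ← Finset.mul_sum] at h4 h5 ⊢
    linarith
  have h3 := mul_le_mul h2 h1 (Real.exp_pos _).le
    (signAvg_pos fun ε => Real.exp_pos _).le
  have h4 := h3.trans h
  have h5 : Real.exp (-(8 * V)) * signAvg (fun ε => Real.exp (⨆ v, ∑ i, sgn (ε i) * t i v)) *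
      Real.exp (-signAvg (fun ε => ⨆ v, ∑ i, sgn (ε i) * t i v)) =
      signAvg (fun ε => Real.exp (⨆ v, ∑ i, sgn (ε i) * t i v)) *
      Real.exp (-(8 * V + signAvg (fun ε => ⨆ v, ∑ i, sgn (ε i) * t i v))) := by
    rw [neg_add, Real.exp_add]; ring
  rw [h5, Real.exp_neg, mul_inv_le_iff₀ (Real.exp_pos _), one_mul] at h4
  exact h4

/-- Type two inequality in a 2-uniformly smooth space. -/
theorem signAvg_norm_sq_le {F : Type*} [NormedAddCommGroup F] [NormedSpace ℝ F] {K : ℝ}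
    (hF : ∀ a b : F, ‖a + b‖ ^ 2 + ‖a - b‖ ^ 2 ≤ 2 * (‖a‖ ^ 2 + K * ‖b‖ ^ 2))
    (g : Fin n → F) (a : F) :
    signAvg (fun ε => ‖a + ∑ i, sgn (ε i) • g i‖ ^ 2) ≤ ‖a‖ ^ 2 + K * ∑ i, ‖g i‖ ^ 2 := by
  induction n generalizing a with
  | zero => rw [signAvg_zero]; simp
  | succ n ih =>
    rw [signAvg_succ]
    simp only [Fin.sum_univ_succ, Fin.cons_zero, Fin.cons_succ, sgn_true, sgn_false, one_smul,
      neg_smul]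
    have h1 := ih (fun i => g i.succ) (a + g 0)
    have h2 := ih (fun i => g i.succ) (a - g 0)
    simp only [add_assoc] at h1
    simp only [sub_eq_add_neg, add_assoc] at h2
    have h3 := hF a (g 0)
    rw [sub_eq_add_neg] at h3
    linarith

/-- The partial sum is the mean of the full sum and the full sum with signs flipped off `I`;
flipping preserves the sign average. -/
theorem signAvg_iSup_sum_subset_le {ι : Type*} [Finite ι] [Nonempty ι] (y : Fin n → ι → ℝ)
    (I : Finset (Fin n)) :
    signAvg (fun ε => ⨆ v, ∑ i ∈ I, sgn (ε i) * y i v) ≤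
      signAvg (fun ε => ⨆ v, ∑ i, sgn (ε i) * y i v) := by
  classical
  let flip : (Fin n → Bool) → (Fin n → Bool) := fun ε i => if i ∈ I then ε i else !ε i
  have hflip : Function.Involutive flip := by
    intro ε; funext i
    by_cases hi : i ∈ I <;> simp [flip, hi]
  have h1 : ∀ ε, (⨆ v, ∑ i ∈ I, sgn (ε i) * y i v) ≤
      1 / 2 * (⨆ v, ∑ i, sgn (ε i) * y i v) + 1 / 2 * ⨆ v, ∑ i, sgn (flip ε i) * y i v := by
    intro ε
    refine ciSup_le fun v => ?_
    have h2 := le_iSup_of_finite (fun v => ∑ i, sgn (ε i) * y i v) v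
    have h3 := le_iSup_of_finite (fun v => ∑ i, sgn (flip ε i) * y i v) v
    have h4 : ∑ i ∈ I, sgn (ε i) * y i v =
        1 / 2 * ∑ i, sgn (ε i) * y i v + 1 / 2 * ∑ i, sgn (flip ε i) * y i v := by
      rw [Finset.mul_sum, Finset.mul_sum, ← Finset.sum_add_distrib, ← Finset.sum_filter_add_sum_filter_not
        Finset.univ (· ∈ I)]
      rw [Finset.sum_eq_zero (s := Finset.univ.filter (· ∉ I)), add_zero, Finset.filter_univ_mem]
      · refine Finset.sum_congr rfl fun i hi => ?_
        simp only [flip, hi, if_true]; ring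
      · intro i hi
        have hi' : i ∉ I := (Finset.mem_filter.mp hi).2
        simp only [flip, hi', if_false, sgn_not]; ring
    linarith
  refine (signAvg_mono h1).trans_eq ?_
  have h2 := signAvg_comp_equiv hflip.toPerm (fun ε => ⨆ v, ∑ i, sgn (ε i) * y i v)
  simp only [Function.Involutive.coe_toPerm] at h2
  rw [signAvg_add, signAvg_const_mul, signAvg_const_mul, h2]
  ring

/-- A Rademacher average is a supremum of sums of nonnegative terms over all strategies that
choose the index after seeing the signs. -/
theorem signAvg_iSup_eq_iSup_strategy {ι : Type*} [Finite ι] [Nonempty ι] (y : Fin n → ι → ℝ) :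
    signAvg (fun ε => ⨆ v, ∑ i, sgn (ε i) * y i v) =
      ⨆ σ : (Fin n → Bool) → ι, ∑ i, max (signAvg (fun ε => sgn (ε i) * y i (σ ε))) 0 := by
  classical
  apply le_antisymm
  · choose σ hσ using fun ε : Fin n → Bool =>
      exists_eq_ciSup_of_finite (f := fun v => ∑ i, sgn (ε i) * y i v)
    simp only [← hσ]
    rw [signAvg_sum]
    refine le_trans (Finset.sum_le_sum fun i _ => le_max_left _ 0)
      (le_iSup_of_finite (fun σ : (Fin n → Bool) → ι =>
        ∑ i, max (signAvg (fun ε => sgn (ε i) * y i (σ ε))) 0) σ)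
  · refine ciSup_le fun σ => ?_
    -- Keeping only the coordinates with nonnegative contribution turns the positive parts into
    -- plain terms; dropping the other coordinates does not raise a Rademacher average above the
    -- full one.
    set I := Finset.univ.filter fun i => 0 ≤ signAvg (fun ε => sgn (ε i) * y i (σ ε)) with hI
    have h1 : ∑ i, max (signAvg (fun ε => sgn (ε i) * y i (σ ε))) 0 =
        ∑ i ∈ I, signAvg (fun ε => sgn (ε i) * y i (σ ε)) := by
      rw [hI, Finset.sum_filter]
      refine Finset.sum_congr rfl fun i _ => ?_
      split_ifs with h
      · exact max_eq_left h
      · exact max_eq_right (le_of_not_ge h)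
    rw [h1, ← signAvg_sum]
    refine le_trans (signAvg_mono fun ε => ?_) (signAvg_iSup_sum_subset_le y I)
    exact le_iSup_of_finite (fun v => ∑ i ∈ I, sgn (ε i) * y i v) (σ ε)

end SignAvg

/-! ### Product measures and control by `q` points. -/

/-- The law of `n` independent draws from `Q`. -/
noncomputable abbrev iidMeasure {S : Type*} [MeasurableSpace S] (Q : Measure S) (n : ℕ) :
    Measure (Fin n → S) := Measure.pi fun _ : Fin n => Q

section Product

variable {S : Type*} [MeasurableSpace S] {Q : Measure S} [IsProbabilityMeasure Q] {n : ℕ}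

theorem integrable_of_measurable_of_abs_le {T : Type*} [MeasurableSpace T] {R : Measure T}
    [IsFiniteMeasure R] {f : T → ℝ} (hf : Measurable f) {B : ℝ} (hB : ∀ x, |f x| ≤ B) :
    Integrable f R :=
  Integrable.of_bound hf.aestronglyMeasurable B (Filter.Eventually.of_forall hB)

theorem piFinSuccAbove_zero_symm_eq (p : S × (Fin n → S)) :
    (MeasurableEquiv.piFinSuccAbove (fun _ : Fin (n + 1) => S) 0).symm p = Fin.cons p.1 p.2 := by
  simp only [MeasurableEquiv.piFinSuccAbove_symm_apply, Fin.insertNthEquiv, Equiv.coe_fn_mk,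
    Fin.insertNth_zero]
  rfl

theorem integrable_iid_succ_prod {F : (Fin (n + 1) → S) → ℝ} (hF : Integrable F (iidMeasure Q (n + 1))) :
    Integrable (fun p : S × (Fin n → S) => F (Fin.cons p.1 p.2)) (Q.prod (iidMeasure Q n)) := by
  have h := (measurePreserving_piFinSuccAbove (fun _ : Fin (n + 1) => Q) 0).symm
  have h2 := (h.integrable_comp_emb (MeasurableEquiv.measurableEmbedding _) (g := F)).mpr hF
  refine h2.congr (Filter.Eventually.of_forall fun p => ?_)
  exact congrArg F (piFinSuccAbove_zero_symm_eq p)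

theorem integral_iid_succ {F : (Fin (n + 1) → S) → ℝ} (hF : Integrable F (iidMeasure Q (n + 1))) :
    ∫ x, F x ∂(iidMeasure Q (n + 1)) = ∫ w, ∫ x, F (Fin.cons w x) ∂(iidMeasure Q n) ∂Q := by
  have h := (measurePreserving_piFinSuccAbove (fun _ : Fin (n + 1) => Q) 0).symm
  rw [← h.integral_comp' F]
  simp only [piFinSuccAbove_zero_symm_eq]
  exact integral_prod _ (integrable_iid_succ_prod hF)

theorem integrable_iid_succ {F : (Fin (n + 1) → S) → ℝ} (hF : Integrable F (iidMeasure Q (n + 1))) :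
    Integrable (fun w => ∫ x, F (Fin.cons w x) ∂(iidMeasure Q n)) Q :=
  (integrable_iid_succ_prod hF).integral_prod_left

theorem integral_iid_eval {f : S → ℝ} (hf : Measurable f) (i : Fin n) :
    ∫ x, f (x i) ∂(iidMeasure Q n) = ∫ w, f w ∂Q := by
  have h := measurePreserving_eval (fun _ : Fin n => Q) i
  have h2 := integral_map (μ := iidMeasure Q n) (φ := Function.eval i) h.measurable.aemeasurable
    (f := f) hf.aestronglyMeasurable
  rw [h.map_eq] at h2
  exact h2.symm

theorem integrable_iid_eval {f : S → ℝ} (hf : Integrable f Q) (i : Fin n) :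
    Integrable (fun x : Fin n → S => f (x i)) (iidMeasure Q n) :=
  (measurePreserving_eval (fun _ : Fin n => Q) i).integrable_comp_of_integrable hf

variable {ι : Type*} [Finite ι]

theorem integrable_exp_iSup_nonneg [Nonempty ι] {h : Fin n → ι → S → ℝ} (hm : ∀ i v, Measurable (h i v)) {β : ℝ}
    (h1 : ∀ i v x, h i v x ≤ β) (a : ι → ℝ) :
    Integrable (fun x : Fin n → S => Real.exp (⨆ v, (a v + ∑ i, h i v (x i)))) (iidMeasure Q n) := by
  refine integrable_of_measurable_of_abs_le (by fun_prop) (B := Real.exp ((⨆ v, a v) + n * β)) fun x => ?_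
  rw [Real.abs_exp, Real.exp_le_exp]
  refine ciSup_le fun v => add_le_add (le_iSup_of_finite a v) ?_
  refine (Finset.sum_le_sum fun i _ => h1 i v (x i)).trans_eq ?_
  simp

theorem integrable_exp_neg_iSup {h : Fin n → ι → S → ℝ} (hm : ∀ i v, Measurable (h i v))
    (h0 : ∀ i v x, 0 ≤ h i v x) (a : ι → ℝ) :
    Integrable (fun x : Fin n → S => Real.exp (-⨆ v, (a v + ∑ i, h i v (x i)))) (iidMeasure Q n) := by
  refine integrable_of_measurable_of_abs_le (by fun_prop) (B := Real.exp (-⨆ v, a v)) fun x => ?_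
  rw [Real.abs_exp, Real.exp_le_exp, neg_le_neg_iff]
  refine iSup_mono_of_finite fun v => ?_
  have := Finset.sum_nonneg fun i (_ : i ∈ Finset.univ) => h0 i v (x i)
  linarith

/-- Apply `1 + z ≤ exp z` to `q - ∑ s j` and to each `s j - 1`; the exponents cancel. -/
theorem sub_sum_mul_prod_le_one {q : ℕ} {s : Fin q → ℝ} (hs : ∀ j, 0 ≤ s j) :
    ((q : ℝ) + 1 - ∑ j, s j) * ∏ j, s j ≤ 1 := by
  have h1 : (q : ℝ) + 1 - ∑ j, s j ≤ Real.exp (q - ∑ j, s j) := by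
    have := Real.add_one_le_exp ((q : ℝ) - ∑ j, s j)
    linarith
  have h2 : ∏ j, s j ≤ ∏ j, Real.exp (s j - 1) :=
    Finset.prod_le_prod (fun j _ => hs j) fun j _ => by
      have := Real.add_one_le_exp (s j - 1)
      linarith
  calc _ ≤ Real.exp (q - ∑ j, s j) * ∏ j, Real.exp (s j - 1) :=
        mul_le_mul h1 h2 (Finset.prod_nonneg fun j _ => hs j) (Real.exp_pos _).le
    _ = 1 := by
        rw [← Real.exp_sum, ← Real.exp_add, Finset.sum_sub_distrib]
        simp

/-- For the largest `u m`, which lies in `[1/q, 1]`, one has `A ≤ 1 / u m ≤ q + 1 - q * u m`, the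
second inequality being `(1 - u m)(q * u m - 1) ≥ 0`. -/
theorem le_sub_sum_of_mul_le_one {q : ℕ} (hq : 0 < q) {A : ℝ} {u : Fin q → ℝ}
    (h1 : ∀ j, u j ≤ 1) (h0 : ∀ j, 1 ≤ q * u j) (hA : ∀ j, A * u j ≤ 1) :
    A ≤ (q : ℝ) + 1 - ∑ j, u j := by
  have : Nonempty (Fin q) := ⟨⟨0, hq⟩⟩
  obtain ⟨m, hm⟩ := Finite.exists_max u
  have hsum : ∑ j, u j ≤ q * u m := by
    refine (Finset.sum_le_sum fun j _ => hm j).trans_eq ?_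
    simp
  have hq' : (0 : ℝ) < q := by exact_mod_cast hq
  have hum : 0 < u m := by
    by_contra hc
    have := h0 m
    nlinarith
  have h2 : A * u m ≤ ((q : ℝ) + 1 - q * u m) * u m := by
    nlinarith [mul_nonneg (sub_nonneg.mpr (h1 m)) (sub_nonneg.mpr (h0 m)), hA m]
  have h3 := le_of_mul_le_mul_right h2 hum
  linarith

/-- A functional form of control by `q` points for suprema of sums of nonnegative functions. -/
theorem integral_exp_mul_prod_le_one [Nonempty ι] {q : ℕ} (hq : 0 < q) {β : ℝ} (hβ : Real.exp β ≤ q)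
    (h : Fin n → ι → S → ℝ) (hm : ∀ i v, Measurable (h i v)) (h0 : ∀ i v x, 0 ≤ h i v x)
    (h1 : ∀ i v x, h i v x ≤ β) (a : Fin q → ι → ℝ) :
    (∫ x, Real.exp (⨆ v, (∑ j, a j v + ∑ i, h i v (x i))) ∂(iidMeasure Q n)) *
      ∏ j, ∫ x, Real.exp (-⨆ v, (a j v + ∑ i, h i v (x i))) ∂(iidMeasure Q n) ≤ 1 := by
  induction n generalizing a with
  | zero =>
    simp only [Finset.univ_eq_empty, Finset.sum_empty, add_zero, integral_const, probReal_univ,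
      one_smul]
    rw [← Real.exp_sum, ← Real.exp_add, ← Real.exp_zero, Real.exp_le_exp]
    rw [Finset.sum_neg_distrib, ← sub_eq_add_neg, sub_nonpos]
    exact ciSup_le fun v => Finset.sum_le_sum fun j _ => le_iSup_of_finite (a j) v
  | succ n ih =>
    have hintA := integrable_exp_iSup_nonneg (Q := Q) hm h1 (fun v => ∑ j, a j v)
    have hintF := fun j => integrable_exp_neg_iSup (Q := Q) hm h0 (a j)
    rw [integral_iid_succ hintA]
    simp only [fun j => integral_iid_succ (hintF j)]
    have hintA' := integrable_iid_succ hintA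
    have hintF' := fun j => integrable_iid_succ (hintF j)
    simp only [Fin.sum_univ_succ, Fin.cons_zero, Fin.cons_succ] at hintA' hintF' ⊢
    set A : S → ℝ := fun w => ∫ x, Real.exp (⨆ v, (∑ j, a j v + (h 0 v w +
      ∑ i : Fin n, h i.succ v (x i)))) ∂(iidMeasure Q n) with hA
    set F : Fin q → S → ℝ := fun j w => ∫ x, Real.exp (-⨆ v, (a j v + (h 0 v w +
      ∑ i : Fin n, h i.succ v (x i)))) ∂(iidMeasure Q n) with hF
    -- `F0` omits the first coordinate. Since `0 ≤ h ≤ β` and `exp β ≤ q`, adding the point `w`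
    -- changes each factor only by a ratio `F j w / F0 j` in `[1/q, 1]`.
    set F0 : Fin q → ℝ := fun j => ∫ x, Real.exp (-⨆ v, (a j v +
      ∑ i : Fin n, h i.succ v (x i))) ∂(iidMeasure Q n) with hF0
    have hi0 : ∀ b : ι → ℝ, Integrable (fun x : Fin n → S => Real.exp (-⨆ v, (b v +
        ∑ i : Fin n, h i.succ v (x i)))) (iidMeasure Q n) := fun b =>
      integrable_exp_neg_iSup (fun i v => hm i.succ v) (fun i v => h0 i.succ v) b
    have hF0pos : ∀ j, 0 < F0 j := fun j => integral_exp_pos (hi0 (a j))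
    have hiF : ∀ j w, Integrable (fun x : Fin n → S => Real.exp (-⨆ v, (a j v + (h 0 v w +
        ∑ i : Fin n, h i.succ v (x i))))) (iidMeasure Q n) := fun j w => by
      simpa only [add_assoc] using hi0 (fun v => a j v + h 0 v w)
    have hFle : ∀ j w, F j w ≤ F0 j := fun j w => by
      refine integral_mono (hiF j w) (hi0 (a j)) fun x => ?_
      dsimp only
      rw [Real.exp_le_exp, neg_le_neg_iff]
      exact iSup_mono_of_finite fun v => by linarith [h0 0 v w]
    have hFge : ∀ j w, F0 j ≤ q * F j w := fun j w => by
      rw [← integral_const_mul]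
      refine integral_mono (hi0 (a j)) ((hiF j w).const_mul _) fun x => ?_
      dsimp only
      refine le_trans ?_ (mul_le_mul_of_nonneg_right hβ (Real.exp_pos _).le)
      rw [← Real.exp_add, Real.exp_le_exp]
      have : (⨆ v, (a j v + (h 0 v w + ∑ i : Fin n, h i.succ v (x i)))) ≤
          β + ⨆ v, (a j v + ∑ i : Fin n, h i.succ v (x i)) := by
        refine ciSup_le fun v => ?_
        have := le_iSup_of_finite (fun v => a j v + ∑ i : Fin n, h i.succ v (x i)) v
        linarith [h1 0 v w]
      linarith
    -- The contribution of the new point `w` may be charged to any single shift `a j`. The induction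
    -- hypothesis for each such choice gives one of the `q` bounds.
    have hAF : ∀ w j, (A w * ∏ k, F0 k) * (F j w / F0 j) ≤ 1 := by
      intro w j
      have hih := ih (fun i => h i.succ) (fun i => hm i.succ) (fun i => h0 i.succ)
        (fun i => h1 i.succ) (fun k v => a k v + if k = j then h 0 v w else 0)
      have e1 : ∀ v, ∑ k, (a k v + if k = j then h 0 v w else 0) = ∑ k, a k v + h 0 v w := by
        intro v; rw [Finset.sum_add_distrib]; simp
      simp only [e1, add_assoc] at hih
      refine le_trans (le_of_eq ?_) hih
      rw [mul_assoc]
      congr 1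
      rw [← Finset.mul_prod_erase Finset.univ F0 (Finset.mem_univ j),
        ← Finset.mul_prod_erase Finset.univ (fun k => ∫ x, Real.exp (-⨆ v, (a k v +
          ((if k = j then h 0 v w else 0) + ∑ i : Fin n, h i.succ v (x i)))) ∂(iidMeasure Q n))
          (Finset.mem_univ j)]
      have e2 : ∏ k ∈ Finset.univ.erase j, (∫ x, Real.exp (-⨆ v, (a k v +
          ((if k = j then h 0 v w else 0) + ∑ i : Fin n, h i.succ v (x i)))) ∂(iidMeasure Q n)) =
          ∏ k ∈ Finset.univ.erase j, F0 k := by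
        refine Finset.prod_congr rfl fun k hk => ?_
        simp only [if_neg (Finset.ne_of_mem_erase hk), zero_add, hF0]
      rw [e2]
      simp only [if_true]
      have := (hF0pos j).ne'
      simp only [hF]
      field_simp
    have hAle : ∀ w, A w * ∏ k, F0 k ≤ (q : ℝ) + 1 - ∑ j, F j w / F0 j := by
      intro w
      refine le_sub_sum_of_mul_le_one hq (fun j => ?_) (fun j => ?_) (hAF w)
      · exact (div_le_one (hF0pos j)).mpr (hFle j w)
      · rw [← mul_div_assoc, one_le_div (hF0pos j)]
        exact hFge j w
    have hInt : (∫ w, A w ∂Q) * ∏ k, F0 k ≤ (q : ℝ) + 1 - ∑ j, (∫ w, F j w ∂Q) / F0 j := by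
      rw [← integral_mul_const]
      have hs : Integrable (fun w => ∑ j, F j w / F0 j) Q :=
        integrable_finsetSum _ fun j _ => (hintF' j).div_const _
      refine (integral_mono (hintA'.mul_const _) ((integrable_const _).sub hs) hAle).trans_eq ?_
      simp only [Pi.sub_apply]
      rw [integral_sub (integrable_const _) hs, integral_finsetSum _ fun j _ => (hintF' j).div_const _]
      simp only [integral_const, probReal_univ, one_smul, integral_div]
      rfl
    have hFint0 : ∀ j, 0 ≤ ∫ w, F j w ∂Q := fun j =>
      integral_nonneg fun w => integral_nonneg fun x => (Real.exp_pos _).le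
    have hprod : ∏ j, ∫ w, F j w ∂Q = (∏ k, F0 k) * ∏ j, (∫ w, F j w ∂Q) / F0 j := by
      rw [← Finset.prod_mul_distrib]
      exact Finset.prod_congr rfl fun j _ => (mul_div_cancel₀ _ (hF0pos j).ne').symm
    rw [hprod, ← mul_assoc]
    have hs0 : ∀ j, 0 ≤ (∫ w, F j w ∂Q) / F0 j := fun j => div_nonneg (hFint0 j) (hF0pos j).le
    exact (mul_le_mul_of_nonneg_right hInt (Finset.prod_nonneg fun j _ => hs0 j)).trans
      (sub_sum_mul_prod_le_one hs0)

/-- Exponential moments of a supremum of sums of nonnegative bounded functions. -/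
theorem integral_exp_iSup_sum_le [Nonempty ι] {q : ℕ} (hq : 0 < q) {β : ℝ} (hβ : Real.exp β ≤ q)
    (h : Fin n → ι → S → ℝ) (hm : ∀ i v, Measurable (h i v)) (h0 : ∀ i v x, 0 ≤ h i v x)
    (h1 : ∀ i v x, h i v x ≤ β) :
    ∫ x, Real.exp (⨆ v, ∑ i, h i v (x i)) ∂(iidMeasure Q n) ≤
      Real.exp (q * ∫ x, ⨆ v, ∑ i, h i v (x i) ∂(iidMeasure Q n)) := by
  have hmain := integral_exp_mul_prod_le_one (Q := Q) hq hβ h hm h0 h1 (fun _ _ => 0)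
  simp only [Finset.sum_const_zero, zero_add, Finset.prod_const, Finset.card_univ,
    Fintype.card_fin] at hmain
  have hVm : Measurable fun x : Fin n → S => ⨆ v, ∑ i, h i v (x i) := by fun_prop
  have hVint : Integrable (fun x : Fin n → S => ⨆ v, ∑ i, h i v (x i)) (iidMeasure Q n) := by
    refine integrable_of_measurable_of_abs_le hVm (B := n * β) fun x => ?_
    have hle : (⨆ v, ∑ i, h i v (x i)) ≤ n * β := ciSup_le fun v =>
      (Finset.sum_le_sum fun i _ => h1 i v (x i)).trans_eq (by simp)
    have hge : 0 ≤ ⨆ v, ∑ i, h i v (x i) :=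
      Real.iSup_nonneg fun v => Finset.sum_nonneg fun i _ => h0 i v (x i)
    rwa [abs_of_nonneg hge]
  have hexp : Integrable (fun x : Fin n → S => Real.exp (-⨆ v, ∑ i, h i v (x i)))
      (iidMeasure Q n) := by
    have := integrable_exp_neg_iSup (Q := Q) hm h0 (fun _ => 0)
    simpa only [zero_add] using this
  -- With zero shifts the preceding result reads `𝔼 exp V * (𝔼 exp (-V)) ^ q ≤ 1`; Jensen bounds the
  -- second factor from below.
  have hJ : Real.exp (-∫ x, ⨆ v, ∑ i, h i v (x i) ∂(iidMeasure Q n)) ≤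
      ∫ x, Real.exp (-⨆ v, ∑ i, h i v (x i)) ∂(iidMeasure Q n) := by
    rw [← integral_neg]
    exact convexOn_exp.map_integral_le Real.continuous_exp.continuousOn isClosed_univ
      (Filter.Eventually.of_forall fun _ => Set.mem_univ _) hVint.neg hexp
  have hJ2 := pow_le_pow_left₀ (Real.exp_pos _).le hJ q
  rw [← Real.exp_nat_mul] at hJ2
  have hI0 : 0 ≤ ∫ x, Real.exp (⨆ v, ∑ i, h i v (x i)) ∂(iidMeasure Q n) :=
    integral_nonneg fun x => (Real.exp_pos _).le
  generalize (∫ x, Real.exp (⨆ v, ∑ i, h i v (x i)) ∂(iidMeasure Q n)) = I at *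
  have h3 := (mul_le_mul_of_nonneg_left hJ2 hI0).trans hmain
  rwa [mul_neg, Real.exp_neg, mul_inv_le_iff₀ (Real.exp_pos _), one_mul] at h3

end Product

/-! ### Symmetrization by an independent copy. -/

section Symmetrization

variable {S : Type*} [MeasurableSpace S] {Q : Measure S} [IsProbabilityMeasure Q] {n : ℕ}

theorem integral_signAvg {T : Type*} [MeasurableSpace T] {ν : Measure T}
    {F : T → (Fin n → Bool) → ℝ} (hF : ∀ ε, Integrable (fun x => F x ε) ν) :
    ∫ x, signAvg (F x) ∂ν = signAvg (fun ε => ∫ x, F x ε ∂ν) := by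
  unfold signAvg
  rw [integral_div, integral_finsetSum _ fun ε _ => hF ε]

theorem integrable_signAvg {T : Type*} [MeasurableSpace T] {ν : Measure T}
    {F : T → (Fin n → Bool) → ℝ} (hF : ∀ ε, Integrable (fun x => F x ε) ν) :
    Integrable (fun x => signAvg (F x)) ν := by
  unfold signAvg
  exact (integrable_finsetSum _ fun ε _ => hF ε).div_const _

variable {ι : Type*} [Finite ι] [Nonempty ι]

theorem abs_iSup_le_of_finite {f : ι → ℝ} {B : ℝ} (h : ∀ v, |f v| ≤ B) : |⨆ v, f v| ≤ B := by
  rw [abs_le]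
  obtain ⟨v⟩ := ‹Nonempty ι›
  exact ⟨(abs_le.mp (h v)).1.trans (le_iSup_of_finite f v),
    ciSup_le fun w => (abs_le.mp (h w)).2⟩

theorem abs_sum_fin_le {f : Fin n → ℝ} {B : ℝ} (h : ∀ i, |f i| ≤ B) : |∑ i, f i| ≤ n * B :=
  (Finset.abs_sum_le_sum_abs _ _).trans ((Finset.sum_le_sum fun i _ => h i).trans_eq (by simp))

theorem integrable_monotone_comp {T : Type*} [MeasurableSpace T] {ν : Measure T}
    [IsFiniteMeasure ν] {G : ℝ → ℝ} (hG : Monotone G) {f : T → ℝ} (hf : Measurable f) {B : ℝ}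
    (hB : ∀ x, |f x| ≤ B) : Integrable (fun x => G (f x)) ν := by
  refine integrable_of_measurable_of_abs_le (hG.measurable.comp hf) (B := max |G B| |G (-B)|)
    fun x => ?_
  have h1 := hG (abs_le.mp (hB x)).2
  have h2 := hG (abs_le.mp (hB x)).1
  rw [abs_le]
  constructor
  · exact le_trans (neg_le_neg (le_max_right _ _)) ((neg_abs_le _).trans h2)
  · exact (h1.trans (le_abs_self _)).trans (le_max_left _ _)

/-- Integration over pairs of samples is invariant under exchanging coordinates of the samples. -/
theorem integral_iid_prod_swap (σ : Fin n → Bool) {F : (Fin n → S × S) → ℝ}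
    (hF : Measurable F) :
    ∫ z, F z ∂(iidMeasure (Q.prod Q) n) =
      ∫ z, F (fun i => if σ i then z i else (z i).swap) ∂(iidMeasure (Q.prod Q) n) := by
  have hmp : MeasurePreserving (fun (z : Fin n → S × S) i => if σ i then z i else (z i).swap)
      (iidMeasure (Q.prod Q) n) (iidMeasure (Q.prod Q) n) := by
    refine measurePreserving_pi (fun _ : Fin n => Q.prod Q) (fun _ : Fin n => Q.prod Q)
      (f := fun i p => if σ i then p else p.swap) fun i => ?_
    by_cases h : σ i
    · simp only [h, if_true]; exact MeasurePreserving.id _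
    · simp only [h]; exact Measure.measurePreserving_swap
  have h2 := integral_map (μ := iidMeasure (Q.prod Q) n) hmp.measurable.aemeasurable
    (f := F) hF.aestronglyMeasurable
  rw [hmp.map_eq] at h2
  exact h2

theorem integral_iid_prod_fst {F : (Fin n → S) → ℝ} (hF : Measurable F) :
    ∫ z, F (fun i => (z i).1) ∂(iidMeasure (Q.prod Q) n) = ∫ x, F x ∂(iidMeasure Q n) := by
  have hmp : MeasurePreserving (fun (z : Fin n → S × S) i => (z i).1)
      (iidMeasure (Q.prod Q) n) (iidMeasure Q n) :=
    measurePreserving_pi (fun _ : Fin n => Q.prod Q) (fun _ : Fin n => Q)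
      (f := fun _ p => p.1) fun i => measurePreserving_fst
  have h2 := integral_map (μ := iidMeasure (Q.prod Q) n) hmp.measurable.aemeasurable
    (f := F) hF.aestronglyMeasurable
  rw [hmp.map_eq] at h2
  exact h2.symm

theorem integral_iid_prod_snd {F : (Fin n → S) → ℝ} (hF : Measurable F) :
    ∫ z, F (fun i => (z i).2) ∂(iidMeasure (Q.prod Q) n) = ∫ x, F x ∂(iidMeasure Q n) := by
  have hmp : MeasurePreserving (fun (z : Fin n → S × S) i => (z i).2)
      (iidMeasure (Q.prod Q) n) (iidMeasure Q n) :=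
    measurePreserving_pi (fun _ : Fin n => Q.prod Q) (fun _ : Fin n => Q)
      (f := fun _ p => p.2) fun i => measurePreserving_snd
  have h2 := integral_map (μ := iidMeasure (Q.prod Q) n) hmp.measurable.aemeasurable
    (f := F) hF.aestronglyMeasurable
  rw [hmp.map_eq] at h2
  exact h2.symm

theorem integral_integral_iid {F : (Fin n → S × S) → ℝ}
    (hF : Integrable F (iidMeasure (Q.prod Q) n)) :
    Integrable (fun x => ∫ y, F (fun i => (x i, y i)) ∂(iidMeasure Q n)) (iidMeasure Q n) ∧
    ∫ x, ∫ y, F (fun i => (x i, y i)) ∂(iidMeasure Q n) ∂(iidMeasure Q n) =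
      ∫ z, F z ∂(iidMeasure (Q.prod Q) n) := by
  have hmp := (measurePreserving_arrowProdEquivProdArrow S S (Fin n) (fun _ => Q)
    (fun _ => Q)).symm
  have h2 := (hmp.integrable_comp_emb (MeasurableEquiv.measurableEmbedding _) (g := F)).mpr hF
  refine ⟨h2.integral_prod_left, ?_⟩
  rw [← hmp.integral_comp' F]
  exact (integral_prod _ h2).symm

/-- Jensen in an independent copy replaces centring by differences. Exchanging the members of any
pair preserves the product law and inserts arbitrary signs, and convexity of `G` splits the two
halves, which costs the factor `2`. -/
theorem symmetrization {φ : ι → S → ℝ} (hm : ∀ v, Measurable (φ v)) {B : ℝ}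
    (hB : ∀ v x, |φ v x| ≤ B) {G : ℝ → ℝ} (hGc : ConvexOn ℝ Set.univ G) (hGm : Monotone G)
    (hGcont : Continuous G) :
    ∫ x, G (⨆ v, ∑ i, (φ v (x i) - ∫ w, φ v w ∂Q)) ∂(iidMeasure Q n) ≤
      ∫ x, signAvg (fun ε => G (2 * ⨆ v, ∑ i, sgn (ε i) * φ v (x i))) ∂(iidMeasure Q n) := by
  have hsgnB : ∀ (b : Bool) (r : ℝ), |sgn b * r| = |r| := fun b r => by
    rw [abs_mul, abs_sgn, one_mul]
  have hφint : ∀ v, Integrable (φ v) Q := fun v => integrable_of_measurable_of_abs_le (hm v) (hB v)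
  have hEB : ∀ v, |∫ w, φ v w ∂Q| ≤ B := fun v => by
    have := norm_integral_le_of_norm_le_const (μ := Q) (f := φ v) (C := B)
      (Filter.Eventually.of_forall (hB v))
    simpa using this
  have hdB : ∀ v a b, |φ v a - φ v b| ≤ 2 * B := fun v a b => by
    have h1 := abs_le.mp (hB v a); have h2 := abs_le.mp (hB v b)
    rw [abs_le]; constructor <;> linarith
  set D : (Fin n → Bool) → (Fin n → S × S) → ℝ := fun ε z =>
    G (⨆ v, ∑ i, sgn (ε i) * (φ v (z i).1 - φ v (z i).2)) with hD
  have hDm : ∀ ε, Measurable (D ε) := fun ε => hGm.measurable.comp (by fun_prop)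
  have hDint : ∀ ε, Integrable (D ε) (iidMeasure (Q.prod Q) n) := fun ε => by
    refine integrable_monotone_comp hGm (by fun_prop) (B := n * (2 * B)) fun z => ?_
    exact abs_iSup_le_of_finite fun v => abs_sum_fin_le fun i => by rw [hsgnB]; exact hdB _ _ _
  have hDone : ∀ z, D (fun _ => true) z = G (⨆ v, ∑ i, (φ v (z i).1 - φ v (z i).2)) := fun z => by
    simp only [hD, sgn_true, one_mul]
  have hJm : ∀ ε : Fin n → Bool, Measurable fun x : Fin n → S =>
      G (2 * ⨆ v, ∑ i, sgn (ε i) * φ v (x i)) := fun ε => hGm.measurable.comp (by fun_prop)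
  have hJB : ∀ (ε : Fin n → Bool) (x : Fin n → S),
      |2 * ⨆ v, ∑ i, sgn (ε i) * φ v (x i)| ≤ 2 * (n * B) := fun ε x => by
    rw [abs_mul, abs_two]
    refine mul_le_mul_of_nonneg_left ?_ (by norm_num)
    exact abs_iSup_le_of_finite fun v => abs_sum_fin_le fun i => by rw [hsgnB]; exact hB _ _
  have hJint : ∀ ε : Fin n → Bool, Integrable (fun x : Fin n → S =>
      G (2 * ⨆ v, ∑ i, sgn (ε i) * φ v (x i))) (iidMeasure Q n) := fun ε =>
    integrable_monotone_comp hGm (by fun_prop) (hJB ε)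
  set J : (Fin n → Bool) → ℝ := fun ε =>
    ∫ x, G (2 * ⨆ v, ∑ i, sgn (ε i) * φ v (x i)) ∂(iidMeasure Q n) with hJ
  -- decoupling by an independent copy
  have h1 : ∫ x, G (⨆ v, ∑ i, (φ v (x i) - ∫ w, φ v w ∂Q)) ∂(iidMeasure Q n) ≤
      ∫ z, D (fun _ => true) z ∂(iidMeasure (Q.prod Q) n) := by
    obtain ⟨hi, he⟩ := integral_integral_iid (hDint fun _ => true)
    rw [← he]
    refine integral_mono ?_ hi fun x => ?_
    · refine integrable_monotone_comp hGm (by fun_prop) (B := n * (2 * B)) fun x => ?_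
      refine abs_iSup_le_of_finite fun v => abs_sum_fin_le fun i => ?_
      have h1 := abs_le.mp (hB v (x i)); have h2 := abs_le.mp (hEB v)
      rw [abs_le]; constructor <;> linarith
    · simp only [hDone]
      have hSint : Integrable (fun y : Fin n → S => ⨆ v, ∑ i, (φ v (x i) - φ v (y i)))
          (iidMeasure Q n) := by
        refine integrable_of_measurable_of_abs_le (by fun_prop) (B := n * (2 * B)) fun y => ?_
        exact abs_iSup_le_of_finite fun v => abs_sum_fin_le fun i => hdB _ _ _
      have hJen : G (∫ y, ⨆ v, ∑ i, (φ v (x i) - φ v (y i)) ∂(iidMeasure Q n)) ≤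
          ∫ y, G (⨆ v, ∑ i, (φ v (x i) - φ v (y i))) ∂(iidMeasure Q n) := by
        refine hGc.map_integral_le hGcont.continuousOn isClosed_univ
          (Filter.Eventually.of_forall fun _ => Set.mem_univ _) hSint ?_
        refine integrable_monotone_comp hGm (by fun_prop) (B := n * (2 * B)) fun y => ?_
        exact abs_iSup_le_of_finite fun v => abs_sum_fin_le fun i => hdB _ _ _
      refine le_trans (hGm (ciSup_le fun v => ?_)) hJen
      have hvint : ∀ i : Fin n, Integrable (fun y : Fin n → S => φ v (x i) - φ v (y i))
          (iidMeasure Q n) := fun i =>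
        (integrable_const _).sub (integrable_iid_eval (hφint v) i)
      have e : ∑ i, (φ v (x i) - ∫ w, φ v w ∂Q) =
          ∫ y, ∑ i, (φ v (x i) - φ v (y i)) ∂(iidMeasure Q n) := by
        rw [integral_finsetSum _ fun i _ => hvint i]
        refine Finset.sum_congr rfl fun i _ => ?_
        rw [integral_sub (integrable_const _) (integrable_iid_eval (hφint v) i),
          integral_iid_eval (hm v) i]
        simp
      rw [e]
      exact integral_mono (integrable_finsetSum _ fun i _ => hvint i) hSint fun y =>
        le_iSup_of_finite (fun v => ∑ i, (φ v (x i) - φ v (y i))) v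
  have h2 : ∀ ε : Fin n → Bool, ∫ z, D (fun _ => true) z ∂(iidMeasure (Q.prod Q) n) =
      ∫ z, D ε z ∂(iidMeasure (Q.prod Q) n) := by
    intro ε
    rw [integral_iid_prod_swap ε (hDm _)]
    congr 1
    funext z
    simp only [hD, sgn_true, one_mul]
    congr 2
    funext v
    refine Finset.sum_congr rfl fun i _ => ?_
    cases ε i <;> simp [sgn]
  have h3 : ∀ ε : Fin n → Bool, ∫ z, D ε z ∂(iidMeasure (Q.prod Q) n) ≤
      1 / 2 * J ε + 1 / 2 * J (fun i => !ε i) := by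
    intro ε
    rw [hJ]
    dsimp only
    rw [← integral_iid_prod_fst (hJm ε), ← integral_iid_prod_snd (hJm fun i => !ε i),
      ← integral_const_mul, ← integral_const_mul]
    have hi1 : Integrable (fun z : Fin n → S × S =>
        G (2 * ⨆ v, ∑ i, sgn (ε i) * φ v (z i).1)) (iidMeasure (Q.prod Q) n) :=
      integrable_monotone_comp hGm (by fun_prop) fun z => hJB ε fun i => (z i).1
    have hi2 : Integrable (fun z : Fin n → S × S =>
        G (2 * ⨆ v, ∑ i, sgn (!ε i) * φ v (z i).2)) (iidMeasure (Q.prod Q) n) :=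
      integrable_monotone_comp hGm (by fun_prop) fun z => hJB (fun i => !ε i) fun i => (z i).2
    rw [← integral_add (hi1.const_mul _) (hi2.const_mul _)]
    refine integral_mono (hDint ε) ((hi1.const_mul _).add (hi2.const_mul _)) fun z => ?_
    have hc := hGc.2 (Set.mem_univ (2 * ⨆ v, ∑ i, sgn (ε i) * φ v (z i).1))
      (Set.mem_univ (2 * ⨆ v, ∑ i, sgn (!ε i) * φ v (z i).2))
      (by norm_num : (0 : ℝ) ≤ 1 / 2) (by norm_num : (0 : ℝ) ≤ 1 / 2) (by norm_num)
    simp only [smul_eq_mul] at hc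
    refine le_trans (hGm ?_) hc
    refine ciSup_le fun v => ?_
    have h4 := le_iSup_of_finite (fun v => ∑ i, sgn (ε i) * φ v (z i).1) v
    have h5 := le_iSup_of_finite (fun v => ∑ i, sgn (!ε i) * φ v (z i).2) v
    have h6 : ∑ i, sgn (ε i) * (φ v (z i).1 - φ v (z i).2) =
        ∑ i, sgn (ε i) * φ v (z i).1 + ∑ i, sgn (!ε i) * φ v (z i).2 := by
      rw [← Finset.sum_add_distrib]
      refine Finset.sum_congr rfl fun i _ => ?_
      rw [sgn_not]; ring
    linarith
  have h4 : ∫ z, D (fun _ => true) z ∂(iidMeasure (Q.prod Q) n) ≤ signAvg J := by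
    rw [← signAvg_const (n := n) (∫ z, D (fun _ => true) z ∂(iidMeasure (Q.prod Q) n))]
    refine (signAvg_mono fun ε => (h2 ε).trans_le (h3 ε)).trans_eq ?_
    have hinv : Function.Involutive fun (ε : Fin n → Bool) (i : Fin n) => !ε i := fun ε => by
      funext i; simp
    have h5 := signAvg_comp_equiv hinv.toPerm J
    simp only [Function.Involutive.coe_toPerm] at h5
    rw [signAvg_add, signAvg_const_mul, signAvg_const_mul, h5]
    ring
  rw [integral_signAvg hJint]
  exact h1.trans h4

end Symmetrization

/-! ### Truncated empirical processes. -/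

section Concentration

variable {S : Type*} [MeasurableSpace S] {Q : Measure S} [IsProbabilityMeasure Q] {n : ℕ}
variable {ι : Type*} [Finite ι] [Nonempty ι]

/-- Admits `q = 8` control points for functions with values in `[0, 2]`. -/
theorem exp_two_le_eight : Real.exp 2 ≤ (8 : ℕ) := by
  have h := Real.exp_one_lt_d9
  have h2 : Real.exp 2 = Real.exp 1 ^ 2 := by rw [← Real.exp_nat_mul]; norm_num
  rw [h2]
  have h0 := Real.exp_pos 1
  push_cast
  nlinarith

theorem integrable_signAvg_iSup_bounded {φ : ι → S → ℝ} (hm : ∀ v, Measurable (φ v)) {B : ℝ}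
    (hB : ∀ v x, |φ v x| ≤ B) :
    Integrable (fun x : Fin n → S => signAvg fun ε => ⨆ v, ∑ i, sgn (ε i) * φ v (x i))
      (iidMeasure Q n) := by
  refine integrable_signAvg fun ε => ?_
  refine integrable_of_measurable_of_abs_le (by fun_prop) (B := n * B) fun x => ?_
  refine abs_iSup_le_of_finite fun v => abs_sum_fin_le fun i => ?_
  rw [abs_mul, abs_sgn, one_mul]
  exact hB _ _

theorem integral_signAvg_iSup_contraction {f : ι → S → ℝ} (hf : ∀ v, Measurable (f v)) {ρ : ℝ}
    (hρi : Integrable (fun x : Fin n → S => signAvg fun ε => ⨆ v, ∑ i, sgn (ε i) * f v (x i))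
      (iidMeasure Q n))
    (hρ : ∫ x, (signAvg fun ε => ⨆ v, ∑ i, sgn (ε i) * f v (x i)) ∂(iidMeasure Q n) ≤ ρ)
    {ψ : ℝ → ℝ} (hψm : Measurable ψ) {L B : ℝ} (hL : 0 ≤ L)
    (hψL : ∀ x y, |ψ x - ψ y| ≤ L * |x - y|) (hψB : ∀ x, |ψ x| ≤ B) :
    ∫ x, (signAvg fun ε => ⨆ v, ∑ i, sgn (ε i) * ψ (f v (x i))) ∂(iidMeasure Q n) ≤ L * ρ := by
  refine le_trans ?_ (mul_le_mul_of_nonneg_left hρ hL)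
  rw [← integral_const_mul]
  refine integral_mono (integrable_signAvg_iSup_bounded (φ := fun v x => ψ (f v x)) (by fun_prop)
    fun v x => hψB _) (hρi.const_mul L) fun x => ?_
  exact signAvg_iSup_contraction hL hψL fun i v => f v (x i)

/-- Centre each summand at cost `n * a`, symmetrize, and remove the Lipschitz function `ψ` by
contraction. -/
theorem integral_iSup_sum_le {f : ι → S → ℝ} (hf : ∀ v, Measurable (f v)) {ρ : ℝ}
    (hρi : Integrable (fun x : Fin n → S => signAvg fun ε => ⨆ v, ∑ i, sgn (ε i) * f v (x i))
      (iidMeasure Q n))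
    (hρ : ∫ x, (signAvg fun ε => ⨆ v, ∑ i, sgn (ε i) * f v (x i)) ∂(iidMeasure Q n) ≤ ρ)
    {ψ : ℝ → ℝ} (hψm : Measurable ψ) {L B a : ℝ} (hL : 0 ≤ L)
    (hψL : ∀ x y, |ψ x - ψ y| ≤ L * |x - y|) (hψB : ∀ x, |ψ x| ≤ B)
    (ha : ∀ v, ∫ w, ψ (f v w) ∂Q ≤ a) :
    ∫ x, ⨆ v, ∑ i, ψ (f v (x i)) ∂(iidMeasure Q n) ≤ n * a + 2 * (L * ρ) := by
  have hm : ∀ v, Measurable fun w => ψ (f v w) := by fun_prop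
  have hEB : ∀ v, |∫ w, ψ (f v w) ∂Q| ≤ B := fun v => by
    have := norm_integral_le_of_norm_le_const (μ := Q) (f := fun w => ψ (f v w)) (C := B)
      (Filter.Eventually.of_forall fun w => hψB _)
    simpa using this
  have hsym := symmetrization (Q := Q) (n := n) hm (fun v x => hψB (f v x)) (G := fun r => r)
    (convexOn_id convex_univ) monotone_id continuous_id
  simp only [signAvg_const_mul] at hsym
  rw [integral_const_mul] at hsym
  have hcon := integral_signAvg_iSup_contraction hf hρi hρ hψm hL hψL hψB
  have hcent : Integrable (fun x : Fin n → S => ⨆ v, ∑ i, (ψ (f v (x i)) - ∫ w, ψ (f v w) ∂Q))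
      (iidMeasure Q n) := by
    refine integrable_of_measurable_of_abs_le (by fun_prop) (B := n * (2 * B)) fun x => ?_
    refine abs_iSup_le_of_finite fun v => abs_sum_fin_le fun i => ?_
    have h1 := abs_le.mp (hψB (f v (x i))); have h2 := abs_le.mp (hEB v)
    rw [abs_le]; constructor <;> linarith
  have h3 : ∫ x, ⨆ v, ∑ i, ψ (f v (x i)) ∂(iidMeasure Q n) ≤
      ∫ x, (n * a + ⨆ v, ∑ i, (ψ (f v (x i)) - ∫ w, ψ (f v w) ∂Q)) ∂(iidMeasure Q n) := by
    refine integral_mono ?_ ((integrable_const _).add hcent) fun x => ?_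
    · refine integrable_of_measurable_of_abs_le (by fun_prop) (B := n * B) fun x => ?_
      exact abs_iSup_le_of_finite fun v => abs_sum_fin_le fun i => hψB _
    · refine ciSup_le fun v => ?_
      have h4 := le_iSup_of_finite (fun v => ∑ i, (ψ (f v (x i)) - ∫ w, ψ (f v w) ∂Q)) v
      rw [Finset.sum_sub_distrib] at h4
      simp only [Finset.sum_const, Finset.card_univ, Fintype.card_fin, nsmul_eq_mul] at h4
      have h5 := mul_le_mul_of_nonneg_left (ha v) (Nat.cast_nonneg (α := ℝ) n)
      linarith
  rw [integral_add (integrable_const _) hcent] at h3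
  simp only [integral_const, probReal_univ, one_smul] at h3
  linarith

/-- Truncation at level `M`. -/
noncomputable def clip (M y : ℝ) : ℝ := max (-M) (min y M)

theorem measurable_clip (M : ℝ) : Measurable (clip M) := by unfold clip; fun_prop

theorem continuous_clip (M : ℝ) : Continuous (clip M) := by unfold clip; fun_prop

theorem abs_clip_le {M : ℝ} (hM : 0 ≤ M) (y : ℝ) : |clip M y| ≤ M := by
  unfold clip
  rw [abs_le]
  exact ⟨le_max_left _ _, max_le (by linarith) (min_le_right _ _)⟩

theorem abs_clip_le_abs {M : ℝ} (hM : 0 ≤ M) (y : ℝ) : |clip M y| ≤ |y| := by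
  unfold clip
  rcases le_total y M with h | h <;> rcases le_total (-M) y with h' | h' <;>
    simp only [min_eq_left, min_eq_right, h]
  · rw [max_eq_right h']
  · rw [max_eq_left h', abs_neg, abs_of_nonneg hM, abs_of_nonpos (by linarith)]; linarith
  · rw [max_eq_right (by linarith), abs_of_nonneg hM]; exact h.trans (le_abs_self _)
  · rw [max_eq_right (by linarith), abs_of_nonneg hM]; exact h.trans (le_abs_self _)

theorem clip_eq_self {M y : ℝ} (hy : |y| ≤ M) : clip M y = y := by
  unfold clip
  rw [min_eq_left (abs_le.mp hy).2, max_eq_right (abs_le.mp hy).1]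

theorem abs_clip_sub_clip_le (M x y : ℝ) : |clip M x - clip M y| ≤ |x - y| := by
  unfold clip
  exact (abs_max_sub_max_le_max (-M) (min x M) (-M) (min y M)).trans
    (max_le (by simp) ((abs_min_sub_min_le_max x M y M).trans (max_le le_rfl (by simp))))

/-- A ramp from the indicator of `[M / 2, ∞)` to that of `[M, ∞)`, at the absolute value. -/
noncomputable def ramp (M y : ℝ) : ℝ := max 0 (min 1 (2 / M * |y| - 1))

theorem abs_ramp_sub_ramp_le {M : ℝ} (hM : 0 < M) (x y : ℝ) :
    |ramp M x - ramp M y| ≤ 2 / M * |x - y| := by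
  unfold ramp
  have h0 : 0 ≤ 2 / M * |x - y| := by positivity
  refine (abs_max_sub_max_le_max _ _ _ _).trans (max_le (by simpa using h0)
    ((abs_min_sub_min_le_max _ _ _ _).trans (max_le (by simpa using h0) ?_)))
  rw [show 2 / M * |x| - 1 - (2 / M * |y| - 1) = 2 / M * (|x| - |y|) by ring, abs_mul,
    abs_of_pos (by positivity)]
  exact mul_le_mul_of_nonneg_left (abs_abs_sub_abs_le_abs_sub x y) (by positivity)

theorem ramp_nonneg (M y : ℝ) : 0 ≤ ramp M y := le_max_left _ _

theorem ramp_le_one (M y : ℝ) : ramp M y ≤ 1 := max_le zero_le_one (min_le_left _ _)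

theorem ramp_eq_one {M y : ℝ} (hM : 0 < M) (hy : M < |y|) : ramp M y = 1 := by
  unfold ramp
  have : 1 ≤ 2 / M * |y| - 1 := by
    have h1 : 2 / M * M ≤ 2 / M * |y| := mul_le_mul_of_nonneg_left hy.le (by positivity)
    rw [div_mul_cancel₀ _ hM.ne'] at h1
    linarith
  rw [min_eq_left this]
  simp

theorem ramp_le_indicator {M : ℝ} (hM : 0 < M) (y : ℝ) :
    ramp M y ≤ if M / 2 ≤ |y| then 1 else 0 := by
  split_ifs with h
  · exact ramp_le_one M y
  · unfold ramp
    have : 2 / M * |y| - 1 ≤ 0 := by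
      push Not at h
      have h1 : 2 / M * |y| ≤ 2 / M * (M / 2) := mul_le_mul_of_nonneg_left h.le (by positivity)
      have h2 : 2 / M * (M / 2) = 1 := by field_simp
      linarith
    exact max_le le_rfl ((min_le_right _ _).trans this)

theorem measurable_ramp (M : ℝ) : Measurable (ramp M) := by unfold ramp; fun_prop

/-- Uniformly over the index set, few sample points exceed the truncation level. -/
theorem measureReal_exists_card_ge_le {f : ι → S → ℝ} (hf : ∀ v, Measurable (f v)) {ρ s M : ℝ}
    (hρi : Integrable (fun x : Fin n → S => signAvg fun ε => ⨆ v, ∑ i, sgn (ε i) * f v (x i))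
      (iidMeasure Q n))
    (hρ : ∫ x, (signAvg fun ε => ⨆ v, ∑ i, sgn (ε i) * f v (x i)) ∂(iidMeasure Q n) ≤ ρ)
    (hM : 0 < M) (hρM : 80 * ρ ≤ s * M)
    (htail : ∀ v, 80 * (n * Q.real {w | M / 2 ≤ |f v w|}) ≤ s) :
    (iidMeasure Q n).real {x | ∃ v, s ≤ ((Finset.univ.filter fun i => M < |f v (x i)|).card : ℝ)} ≤
      Real.exp (-s) := by
  rcases Nat.eq_zero_or_pos n with hn | hn
  · subst hn
    by_cases hs : 0 < s
    · have : {x : Fin 0 → S | ∃ v, s ≤ ((Finset.univ.filter fun i => M < |f v (x i)|).card : ℝ)} = ∅ := by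
        ext x; simp [hs]
      rw [this]
      simp [(Real.exp_pos _).le]
    · refine measureReal_le_one.trans ?_
      rw [← Real.exp_zero, Real.exp_le_exp]; linarith
  have hn' : (0 : ℝ) < n := by exact_mod_cast hn
  -- The factor `2` uses the full range `[0, 2]` that eight control points allow. With it `𝔼 exp V ≤
  -- exp s`, and Markov's inequality at `2 s` yields `exp (-s)`.
  set V : (Fin n → S) → ℝ := fun x => ⨆ v, ∑ i, 2 * ramp M (f v (x i)) with hV
  have hmr : ∀ (i : Fin n) (v : ι), Measurable fun w => 2 * ramp M (f v w) := fun i v =>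
    ((measurable_ramp M).comp (hf v)).const_mul 2
  have hmgf := integral_exp_iSup_sum_le (Q := Q) (n := n) (q := 8) (by norm_num) exp_two_le_eight
    (fun _ v w => 2 * ramp M (f v w)) hmr
    (fun i v x => mul_nonneg zero_le_two (ramp_nonneg _ _))
    (fun i v x => by linarith [ramp_le_one M (f v x)])
  -- The tail term contributes `s/40` and the symmetrized process `s/10`.
  have hEV : ∫ x, V x ∂(iidMeasure Q n) ≤ s / 8 := by
    have hE := integral_iSup_sum_le hf hρi hρ (ψ := fun y => 2 * ramp M y)
      ((measurable_ramp M).const_mul 2) (L := 4 / M) (B := 2) (a := s / (40 * n)) (by positivity)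
      (fun x y => by
        rw [← mul_sub, abs_mul, abs_two]
        have := abs_ramp_sub_ramp_le hM x y
        calc 2 * |ramp M x - ramp M y| ≤ 2 * (2 / M * |x - y|) := by linarith
          _ = _ := by ring)
      (fun x => by
        rw [abs_of_nonneg (mul_nonneg zero_le_two (ramp_nonneg _ _))]
        linarith [ramp_le_one M x])
      (fun v => by
        have hset : MeasurableSet {w | M / 2 ≤ |f v w|} := by
          have := hf v
          measurability
        have h1 : ∫ w, 2 * ramp M (f v w) ∂Q ≤ 2 * Q.real {w | M / 2 ≤ |f v w|} := by
          rw [integral_const_mul]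
          refine mul_le_mul_of_nonneg_left ?_ zero_le_two
          rw [← integral_indicator_one hset]
          refine integral_mono (integrable_of_measurable_of_abs_le
            ((measurable_ramp M).comp (hf v)) (B := 1) fun x => ?_) ?_ fun w => ?_
          · rw [abs_of_nonneg (ramp_nonneg _ _)]; exact ramp_le_one _ _
          · exact (integrable_const 1).indicator hset
          · refine (ramp_le_indicator hM (f v w)).trans_eq ?_
            simp [Set.indicator_apply]
        refine h1.trans ?_
        rw [le_div_iff₀ (by positivity)]
        linarith [htail v])
    refine hE.trans ?_
    have e1 : (n : ℝ) * (s / (40 * n)) = s / 40 := by field_simp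
    have e2 : 4 / M * ρ ≤ s / 20 := by
      rw [div_mul_eq_mul_div, div_le_iff₀ hM]; linarith
    rw [e1]; linarith
  have hVint : Integrable (fun x => Real.exp (1 * V x)) (iidMeasure Q n) := by
    have := integrable_exp_iSup_nonneg (Q := Q) (n := n) (h := fun _ v w => 2 * ramp M (f v w)) hmr
      (β := 2) (fun i v x => by linarith [ramp_le_one M (f v x)]) (fun _ : ι => 0)
    simpa only [zero_add, one_mul] using this
  have hch := measure_ge_le_exp_mul_mgf (μ := iidMeasure Q n) (X := V) (t := 1) (2 * s)
    zero_le_one hVint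
  have hmgf' : mgf V (iidMeasure Q n) 1 ≤ Real.exp s := by
    unfold mgf
    simp only [one_mul]
    refine hmgf.trans (Real.exp_le_exp.mpr ?_)
    push_cast
    linarith
  refine le_trans (measureReal_mono ?_) (hch.trans ?_)
  · rintro x ⟨v, hv⟩
    have h1 : 2 * ((Finset.univ.filter fun i => M < |f v (x i)|).card : ℝ) ≤
        ∑ i, 2 * ramp M (f v (x i)) := by
      rw [← Finset.mul_sum]
      refine mul_le_mul_of_nonneg_left ?_ zero_le_two
      rw [Finset.card_eq_sum_ones, Nat.cast_sum, Finset.sum_filter]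
      refine Finset.sum_le_sum fun i _ => ?_
      split_ifs with h
      · rw [ramp_eq_one hM h]; simp
      · exact ramp_nonneg _ _
    have h2 := le_iSup_of_finite (fun v => ∑ i, 2 * ramp M (f v (x i))) v
    change 2 * s ≤ V x
    exact (by linarith : 2 * s ≤ _).trans h2
  · calc _ ≤ Real.exp (-1 * (2 * s)) * Real.exp s :=
          mul_le_mul_of_nonneg_left hmgf' (Real.exp_pos _).le
      _ = Real.exp (-s) := by rw [← Real.exp_add]; congr 1; ring

/-- Bernstein type bound for the Laplace transform of a supremum of an empirical process. -/
theorem integral_exp_iSup_centered_le {φ : ι → S → ℝ} (hm : ∀ v, Measurable (φ v))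
    (hB : ∀ v x, |φ v x| ≤ 1) {l : ℝ} (hl0 : 0 ≤ l) (hl : l ≤ 1 / 6) :
    ∫ x, Real.exp (l * ⨆ v, ∑ i, (φ v (x i) - ∫ w, φ v w ∂Q)) ∂(iidMeasure Q n) ≤
      Real.exp (512 * l ^ 2 * (∫ x, ⨆ v, ∑ i, φ v (x i) ^ 2 ∂(iidMeasure Q n)) +
        32 * l * ∫ x, (signAvg fun ε => ⨆ v, ∑ i, sgn (ε i) * φ v (x i)) ∂(iidMeasure Q n)) := by
  have hsq : ∀ v x, φ v x ^ 2 ≤ 1 := fun v x => by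
    rw [← sq_abs]; exact pow_le_one₀ (abs_nonneg _) (hB v x)
  set U : (Fin n → S) → ℝ := fun x => signAvg fun ε => ⨆ v, ∑ i, sgn (ε i) * φ v (x i) with hU
  set V : (Fin n → S) → ℝ := fun x => ⨆ v, ∑ i, φ v (x i) ^ 2 with hV
  have hUB : ∀ x, |U x| ≤ n * 1 := fun x => abs_signAvg_le fun ε =>
    abs_iSup_le_of_finite fun v => abs_sum_fin_le fun i => by
      rw [abs_mul, abs_sgn, one_mul]; exact hB _ _
  have hVB : ∀ x, |V x| ≤ n * 1 := fun x =>
    abs_iSup_le_of_finite fun v => abs_sum_fin_le fun i => by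
      rw [abs_of_nonneg (sq_nonneg _)]; exact hsq _ _
  have hUm : Measurable U := by
    simp only [hU]; unfold signAvg; fun_prop
  have hVm : Measurable V := by fun_prop
  have hsym := symmetrization (Q := Q) (n := n) hm hB (G := fun r => Real.exp (l * r))
    ⟨convex_univ, fun a _ b _ α β hα hβ hαβ => by
      have := convexOn_exp.2 (Set.mem_univ (l * a)) (Set.mem_univ (l * b)) hα hβ hαβ
      refine le_trans (le_of_eq ?_) this
      simp only [smul_eq_mul]
      congr 1; ring⟩
    (fun a b hab => Real.exp_le_exp.mpr (mul_le_mul_of_nonneg_left hab hl0)) (by fun_prop)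
  -- Conditionally on the sample, the sub-Gaussian bound has exponent `32 l² V + 2 l U`. Convexity
  -- of `exp` separates the two random quantities at the price of doubling each.
  have hpt : ∀ x : Fin n → S,
      signAvg (fun ε => Real.exp (l * (2 * ⨆ v, ∑ i, sgn (ε i) * φ v (x i)))) ≤
      1 / 2 * Real.exp (64 * l ^ 2 * V x) + 1 / 2 * Real.exp (4 * l * U x) := by
    intro x
    have h1 := signAvg_exp_iSup_le fun (i : Fin n) (v : ι) => 2 * l * φ v (x i)
    have e1 : ∀ ε : Fin n → Bool, (⨆ v, ∑ i, sgn (ε i) * (2 * l * φ v (x i))) =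
        l * (2 * ⨆ v, ∑ i, sgn (ε i) * φ v (x i)) := by
      intro ε
      rw [← mul_assoc, Real.mul_iSup_of_nonneg (by positivity)]
      congr 1; funext v
      rw [Finset.mul_sum]
      exact Finset.sum_congr rfl fun i _ => by ring
    have e2 : (⨆ v, ∑ i, (2 * l * φ v (x i)) ^ 2) = 4 * l ^ 2 * V x := by
      rw [hV, Real.mul_iSup_of_nonneg (by positivity)]
      congr 1; funext v
      rw [Finset.mul_sum]
      exact Finset.sum_congr rfl fun i _ => by ring
    simp only [e1, e2, signAvg_const_mul] at h1
    refine h1.trans ?_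
    have hc := convexOn_exp.2 (Set.mem_univ (64 * l ^ 2 * V x)) (Set.mem_univ (4 * l * U x))
      (by norm_num : (0 : ℝ) ≤ 1 / 2) (by norm_num : (0 : ℝ) ≤ 1 / 2) (by norm_num)
    simp only [smul_eq_mul] at hc
    refine le_trans (Real.exp_le_exp.mpr (le_of_eq ?_)) hc
    simp only [hU]; ring
  -- The restriction `l ≤ 1/6` keeps `64 l² φ²` within `[0, 2]`; the factor `q = 8` produces `512
  -- l²`.
  have hVe := integral_exp_iSup_sum_le (Q := Q) (n := n) (q := 8) (by norm_num) exp_two_le_eight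
    (fun _ v w => 64 * l ^ 2 * φ v w ^ 2) (by fun_prop) (fun i v x => by positivity)
    (fun i v x => by
      have h1 : l ^ 2 ≤ 1 / 36 := by nlinarith
      have h2 := mul_le_mul h1 (hsq v x) (sq_nonneg _) (by norm_num)
      linarith)
  have eV : ∀ x : Fin n → S, (⨆ v, ∑ i, 64 * l ^ 2 * φ v (x i) ^ 2) = 64 * l ^ 2 * V x := by
    intro x
    rw [hV, Real.mul_iSup_of_nonneg (by positivity)]
    simp only [Finset.mul_sum]
  simp only [eV] at hVe
  rw [integral_const_mul] at hVe
  -- The Rademacher average becomes a supremum of sums of nonnegative functions when indexed by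
  -- strategies, so the same bound applies to it.
  have hUe := integral_exp_iSup_sum_le (Q := Q) (n := n) (ι := (Fin n → Bool) → ι) (q := 8)
    (by norm_num) exp_two_le_eight
    (fun i σ w => max (signAvg fun ε => sgn (ε i) * (4 * l * φ (σ ε) w)) 0)
    (fun i σ => by unfold signAvg; fun_prop) (fun i σ x => le_max_right _ _)
    (fun i σ x => by
      refine max_le ((le_abs_self _).trans (abs_signAvg_le fun ε => ?_)) zero_le_two
      rw [abs_mul, abs_sgn, one_mul, abs_mul, abs_of_nonneg (by positivity)]
      have := mul_le_mul_of_nonneg_left (hB (σ ε) x) (by positivity : 0 ≤ 4 * l)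
      linarith)
  have eU : ∀ x : Fin n → S, (⨆ σ : (Fin n → Bool) → ι, ∑ i,
      max (signAvg fun ε => sgn (ε i) * (4 * l * φ (σ ε) (x i))) 0) = 4 * l * U x := by
    intro x
    rw [← signAvg_iSup_eq_iSup_strategy fun (i : Fin n) (v : ι) => 4 * l * φ v (x i), hU,
      ← signAvg_const_mul]
    congr 1; funext ε
    rw [Real.mul_iSup_of_nonneg (by positivity)]
    congr 1; funext v
    rw [Finset.mul_sum]
    exact Finset.sum_congr rfl fun i _ => by ring
  simp only [eU] at hUe
  rw [integral_const_mul] at hUe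
  have hV0 : 0 ≤ ∫ x, V x ∂(iidMeasure Q n) := integral_nonneg fun x =>
    Real.iSup_nonneg fun v => Finset.sum_nonneg fun i _ => sq_nonneg _
  have hU0 : 0 ≤ ∫ x, U x ∂(iidMeasure Q n) := integral_nonneg fun x => by
    change 0 ≤ U x
    simp only [hU]
    rw [signAvg_iSup_eq_iSup_strategy fun (i : Fin n) (v : ι) => φ v (x i)]
    exact Real.iSup_nonneg fun σ => Finset.sum_nonneg fun i _ => le_max_right _ _
  refine hsym.trans ?_
  have hi1 : Integrable (fun x => Real.exp (64 * l ^ 2 * V x)) (iidMeasure Q n) :=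
    integrable_monotone_comp (G := fun r => Real.exp (64 * l ^ 2 * r))
      (fun a b hab => Real.exp_le_exp.mpr (mul_le_mul_of_nonneg_left hab (by positivity))) hVm hVB
  have hi2 : Integrable (fun x => Real.exp (4 * l * U x)) (iidMeasure Q n) :=
    integrable_monotone_comp (G := fun r => Real.exp (4 * l * r))
      (fun a b hab => Real.exp_le_exp.mpr (mul_le_mul_of_nonneg_left hab (by positivity))) hUm hUB
  have hi0 : Integrable (fun x : Fin n → S => signAvg fun ε =>
      Real.exp (l * (2 * ⨆ v, ∑ i, sgn (ε i) * φ v (x i)))) (iidMeasure Q n) := by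
    refine integrable_signAvg fun ε => integrable_monotone_comp (G := fun r => Real.exp (l * (2 * r)))
      (fun a b hab => Real.exp_le_exp.mpr (mul_le_mul_of_nonneg_left (by linarith) hl0))
      (by fun_prop) (B := n * 1) fun x => ?_
    exact abs_iSup_le_of_finite fun v => abs_sum_fin_le fun i => by
      rw [abs_mul, abs_sgn, one_mul]; exact hB _ _
  refine (integral_mono hi0 ((hi1.const_mul _).add (hi2.const_mul _)) hpt).trans ?_
  simp only [Pi.add_apply]
  rw [integral_add (hi1.const_mul _) (hi2.const_mul _), integral_const_mul, integral_const_mul]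
  have h5 : Real.exp ((8 : ℕ) * (64 * l ^ 2 * ∫ x, V x ∂(iidMeasure Q n))) ≤
      Real.exp (512 * l ^ 2 * (∫ x, V x ∂(iidMeasure Q n)) +
        32 * l * ∫ x, U x ∂(iidMeasure Q n)) := by
    refine Real.exp_le_exp.mpr ?_
    push_cast
    have : 0 ≤ 32 * l * ∫ x, U x ∂(iidMeasure Q n) := by positivity
    linarith
  have h6 : Real.exp ((8 : ℕ) * (4 * l * ∫ x, U x ∂(iidMeasure Q n))) ≤
      Real.exp (512 * l ^ 2 * (∫ x, V x ∂(iidMeasure Q n)) +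
        32 * l * ∫ x, U x ∂(iidMeasure Q n)) := by
    refine Real.exp_le_exp.mpr ?_
    push_cast
    have : 0 ≤ 512 * l ^ 2 * ∫ x, V x ∂(iidMeasure Q n) := by positivity
    linarith
  linarith

/-- Uniformly over the index set, the sums of truncated values are small. -/
theorem measureReal_exists_sum_clip_ge_le {f : ι → S → ℝ} (hf : ∀ v, Measurable (f v))
    {ρ s M u σ2 : ℝ}
    (hρi : Integrable (fun x : Fin n → S => signAvg fun ε => ⨆ v, ∑ i, sgn (ε i) * f v (x i))
      (iidMeasure Q n))
    (hρ : ∫ x, (signAvg fun ε => ⨆ v, ∑ i, sgn (ε i) * f v (x i)) ∂(iidMeasure Q n) ≤ ρ)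
    (hM : 0 < M) (hρM : 80 * ρ ≤ s * M) (hu : 0 < u) (hus : u ≤ s) (hσ0 : 0 ≤ σ2)
    (hσi : ∀ v, Integrable (fun w => f v w ^ 2) Q) (hσ : ∀ v, ∫ w, f v w ^ 2 ∂Q ≤ σ2)
    (hbias : ∀ v, n * |∫ w, clip M (f v w) ∂Q| ≤ s * M) :
    (iidMeasure Q n).real {x | ∃ v, 18 * (s * M) + 48 * √(n * σ2 * u) ≤ ∑ i, clip M (f v (x i))} ≤
      Real.exp (-u) := by
  set φ : ι → S → ℝ := fun v w => clip M (f v w) / M with hφ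
  have hφm : ∀ v, Measurable (φ v) := fun v => ((measurable_clip M).comp (hf v)).div_const M
  have hcB : ∀ y, |clip M y / M| ≤ 1 := fun y => by
    rw [abs_div, abs_of_pos hM, div_le_one hM]
    exact abs_clip_le hM.le y
  have hcL : ∀ x y, |clip M x / M - clip M y / M| ≤ 1 / M * |x - y| := fun x y => by
    rw [← sub_div, abs_div, abs_of_pos hM, one_div_mul_eq_div]
    exact div_le_div_of_nonneg_right (abs_clip_sub_clip_le M x y) hM.le
  set A : ℝ := n * (σ2 / M ^ 2) with hA
  have hA0 : 0 ≤ A := by positivity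
  set EV := ∫ x, ⨆ v, ∑ i, φ v (x i) ^ 2 ∂(iidMeasure Q n) with hEVdef
  set EU := ∫ x, (signAvg fun ε => ⨆ v, ∑ i, sgn (ε i) * φ v (x i)) ∂(iidMeasure Q n) with hEUdef
  have hρs : ρ / M ≤ s / 80 := by rw [div_le_iff₀ hM]; linarith
  -- On values bounded by one, squaring has Lipschitz constant `2`, hence `L = 2 / M` for the
  -- squared normalized clip.
  have hEV : EV ≤ A + s / 20 := by
    have hE := integral_iSup_sum_le hf hρi hρ (ψ := fun y => (clip M y / M) ^ 2)
      (((measurable_clip M).div_const M).pow_const 2) (L := 2 / M) (B := 1) (a := σ2 / M ^ 2)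
      (by positivity)
      (fun x y => by
        have h1 := hcL x y
        have h2 : |clip M x / M + clip M y / M| ≤ 2 := by
          refine (abs_add_le _ _).trans ?_
          linarith [hcB x, hcB y]
        rw [sq_sub_sq, abs_mul]
        calc _ ≤ 2 * (1 / M * |x - y|) := mul_le_mul h2 h1 (abs_nonneg _) zero_le_two
          _ = _ := by ring)
      (fun x => by
        rw [abs_of_nonneg (sq_nonneg _), ← sq_abs]
        exact pow_le_one₀ (abs_nonneg _) (hcB x))
      (fun v => by
        have h1 : ∫ w, (clip M (f v w) / M) ^ 2 ∂Q ≤ ∫ w, f v w ^ 2 / M ^ 2 ∂Q := by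
          refine integral_mono (integrable_of_measurable_of_abs_le ((hφm v).pow_const 2) (B := 1)
            fun x => ?_) ((hσi v).div_const _) fun w => ?_
          · rw [abs_of_nonneg (sq_nonneg _), ← sq_abs]
            exact pow_le_one₀ (abs_nonneg _) (hcB _)
          · dsimp only
            rw [div_pow]
            gcongr ?_ / _
            exact sq_le_sq.mpr (abs_clip_le_abs hM.le _)
        refine h1.trans ?_
        rw [integral_div]
        gcongr
        exact hσ v)
    refine hE.trans ?_
    have : 2 / M * ρ = 2 * (ρ / M) := by ring
    rw [this]; linarith
  have hEU : EU ≤ s / 80 := by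
    have hE := integral_signAvg_iSup_contraction hf hρi hρ (ψ := fun y => clip M y / M)
      ((measurable_clip M).div_const M) (L := 1 / M) (B := 1) (by positivity) hcL hcB
    refine hE.trans ?_
    rw [one_div_mul_eq_div]; exact hρs
  set l : ℝ := √u / (6 * √u + 24 * √A) with hl
  have hsu : 0 < √u := Real.sqrt_pos.mpr hu
  have hden : 0 < 6 * √u + 24 * √A := by positivity
  have hl0 : 0 < l := by positivity
  have hl6 : l ≤ 1 / 6 := by
    rw [hl, div_le_div_iff₀ hden (by norm_num)]
    nlinarith [Real.sqrt_nonneg A]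
  have hlu : l * (6 * u + 24 * √(A * u)) = u := by
    rw [Real.sqrt_mul hA0]
    have h1 : 6 * u + 24 * (√A * √u) = (6 * √u + 24 * √A) * √u := by
      have := Real.mul_self_sqrt hu.le
      linear_combination (-6) * this
    rw [h1, ← mul_assoc, hl, div_mul_cancel₀ _ hden.ne', Real.mul_self_sqrt hu.le]
  have hlA : 512 * l ^ 2 * A ≤ u := by
    have h1 : 24 * (l * √A) ≤ √u := by
      have h2 : l * (6 * √u + 24 * √A) = √u := by rw [hl, div_mul_cancel₀ _ hden.ne']
      have h3 : 0 ≤ l * √u := by positivity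
      nlinarith
    have h4 := pow_le_pow_left₀ (by positivity) h1 2
    rw [Real.sq_sqrt hu.le, mul_pow, mul_pow, Real.sq_sqrt hA0] at h4
    have : 0 ≤ l ^ 2 * A := by positivity
    nlinarith
  have hs0 : 0 < s := hu.trans_le hus
  set Z : (Fin n → S) → ℝ := fun x => ⨆ v, ∑ i, (φ v (x i) - ∫ w, φ v w ∂Q) with hZ
  have hlap := integral_exp_iSup_centered_le (Q := Q) (n := n) hφm (fun v x => hcB _) hl0.le hl6
  rw [← hEVdef, ← hEUdef] at hlap
  have hEB : ∀ v, |∫ w, φ v w ∂Q| ≤ 1 := fun v => by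
    have := norm_integral_le_of_norm_le_const (μ := Q) (f := φ v) (C := 1)
      (Filter.Eventually.of_forall fun w => hcB _)
    simpa using this
  have hZint : Integrable (fun x => Real.exp (l * Z x)) (iidMeasure Q n) := by
    refine integrable_monotone_comp (G := fun r => Real.exp (l * r))
      (fun a b hab => Real.exp_le_exp.mpr (mul_le_mul_of_nonneg_left hab hl0.le)) (by fun_prop)
      (B := n * 2) fun x => ?_
    refine abs_iSup_le_of_finite fun v => abs_sum_fin_le fun i => ?_
    have h1 := abs_le.mp (hcB (f v (x i))); have h2 := abs_le.mp (hEB v)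
    rw [abs_le]; constructor <;> linarith
  -- In the exponent, `48 l √(A u) = 2u - 12 l u` and `u ≤ s`. So `17 l s` covers `12 l u` and the
  -- terms of order `l s` from `EV` and `EU`, leaving `-u`. The threshold `18 s M` of the statement
  -- has one further `s M` for the clipping bias.
  have hch := measure_ge_le_exp_mul_mgf (μ := iidMeasure Q n) (X := Z) (t := l)
    (17 * s + 48 * √(A * u)) hl0.le hZint
  have hsqrt : √(n * σ2 * u) = M * √(A * u) := by
    have : n * σ2 * u = M ^ 2 * (A * u) := by rw [hA]; field_simp
    rw [this, Real.sqrt_mul (sq_nonneg M), Real.sqrt_sq hM.le]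
  refine le_trans (measureReal_mono ?_) (hch.trans ?_)
  · rintro x ⟨v, hv⟩
    change 17 * s + 48 * √(A * u) ≤ Z x
    have h1 := le_iSup_of_finite (fun v => ∑ i, (φ v (x i) - ∫ w, φ v w ∂Q)) v
    refine le_trans ?_ h1
    rw [Finset.sum_sub_distrib]
    simp only [Finset.sum_const, Finset.card_univ, Fintype.card_fin, nsmul_eq_mul, hφ]
    rw [← Finset.sum_div, integral_div, ← mul_div_assoc, ← sub_div, le_div_iff₀ hM]
    have h2 := (mul_le_mul_of_nonneg_left (le_abs_self (∫ w, clip M (f v w) ∂Q))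
      (Nat.cast_nonneg (α := ℝ) n)).trans (hbias v)
    rw [hsqrt] at hv
    nlinarith
  · calc _ ≤ Real.exp (-l * (17 * s + 48 * √(A * u))) *
            Real.exp (512 * l ^ 2 * EV + 32 * l * EU) :=
          mul_le_mul_of_nonneg_left hlap (Real.exp_pos _).le
      _ ≤ Real.exp (-u) := by
          rw [← Real.exp_add, Real.exp_le_exp]
          have h1 : 512 * l ^ 2 * EV ≤ 512 * l ^ 2 * (A + s / 20) :=
            mul_le_mul_of_nonneg_left hEV (by positivity)
          have h2 : 32 * l * EU ≤ 32 * l * (s / 80) :=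
            mul_le_mul_of_nonneg_left hEU (by positivity)
          have h3 : 512 * l ^ 2 * (s / 20) ≤ 512 * (l / 6) * (s / 20) := by
            gcongr
            nlinarith
          have h4 : l * u ≤ l * s := mul_le_mul_of_nonneg_left hus hl0.le
          have h5 : 0 ≤ l * s := by positivity
          nlinarith

/-- With high probability the truncation level is exceeded rarely and the truncated sums are
small, uniformly over the index set. -/
theorem measureReal_bad_le {f : ι → S → ℝ} (hf : ∀ v, Measurable (f v))
    {ρ s M u σ2 : ℝ}
    (hρi : Integrable (fun x : Fin n → S => signAvg fun ε => ⨆ v, ∑ i, sgn (ε i) * f v (x i))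
      (iidMeasure Q n))
    (hρ : ∫ x, (signAvg fun ε => ⨆ v, ∑ i, sgn (ε i) * f v (x i)) ∂(iidMeasure Q n) ≤ ρ)
    (hM : 0 < M) (hρM : 80 * ρ ≤ s * M) (hu : 0 < u) (hus : u ≤ s) (hσ0 : 0 ≤ σ2)
    (htail : ∀ v, 80 * (n * Q.real {w | M / 2 ≤ |f v w|}) ≤ s)
    (hσi : ∀ v, Integrable (fun w => f v w ^ 2) Q) (hσ : ∀ v, ∫ w, f v w ^ 2 ∂Q ≤ σ2)
    (hbias : ∀ v, n * |∫ w, clip M (f v w) ∂Q| ≤ s * M) :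
    (iidMeasure Q n).real {x | ∃ v, s < ((Finset.univ.filter fun i => M < |f v (x i)|).card : ℝ) ∨
      18 * (s * M) + 48 * √(n * σ2 * u) < ∑ i, clip M (f v (x i))} ≤ 2 * Real.exp (-u) := by
  have h1 := measureReal_exists_card_ge_le hf hρi hρ hM hρM htail
  have h2 := measureReal_exists_sum_clip_ge_le hf hρi hρ hM hρM hu hus hσ0 hσi hσ hbias
  have h3 : Real.exp (-s) ≤ Real.exp (-u) := Real.exp_le_exp.mpr (by linarith)
  have h4 := (measureReal_union_le (μ := iidMeasure Q n) _ _).trans (add_le_add h1 h2)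
  refine (measureReal_mono ?_).trans (h4.trans (by linarith))
  rintro x ⟨v, hv | hv⟩
  · exact Or.inl ⟨v, hv.le⟩
  · exact Or.inr ⟨v, hv.le⟩

end Concentration

/-! ### Order statistics and trimmed means. -/

section Trimmed

variable {n : ℕ}

/-- The `t`-trimmed mean of a tuple of reals. -/
noncomputable def trimmedAvg (t : ℕ) (a : Fin n → ℝ) : ℝ :=
  (1 / ((n : ℝ) - 2 * (t : ℝ))) *
    ∑ j ∈ Finset.univ.filter (fun j : Fin n => t ≤ j.val ∧ j.val + t < n), a (Tuple.sort a j)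

theorem trimmedMean_eq_trimmedAvg {E : Type*} (t : ℕ) (f : E → ℝ) (x : Fin n → E) :
    trimmedMean t f x = trimmedAvg t fun i => f (x i) := rfl

/-- Order statistics are handled by counting. Indices start at `0`, hence the strict inequality. -/
theorem apply_sort_le_iff (a : Fin n → ℝ) (j : Fin n) (c : ℝ) :
    a (Tuple.sort a j) ≤ c ↔ (j : ℕ) < (Finset.univ.filter fun i => a i ≤ c).card := by
  have h := Tuple.lt_card_le_iff_apply_le_of_monotone (j := j) (a := c) (Tuple.monotone_sort a)
  have hc : (Finset.univ.filter fun i => (a ∘ Tuple.sort a) i ≤ c).card =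
      (Finset.univ.filter fun i => a i ≤ c).card :=
    Finset.card_equiv (Tuple.sort a) fun i => by simp
  rw [← hc, h]
  rfl

theorem apply_sort_lt_iff (a : Fin n → ℝ) (j : Fin n) (c : ℝ) :
    a (Tuple.sort a j) < c ↔ (j : ℕ) < (Finset.univ.filter fun i => a i < c).card := by
  have h := Tuple.lt_card_lt_iff_apply_lt_of_monotone (j := j) (a := c) (Tuple.monotone_sort a)
  have hc : (Finset.univ.filter fun i => (a ∘ Tuple.sort a) i < c).card =
      (Finset.univ.filter fun i => a i < c).card :=
    Finset.card_equiv (Tuple.sort a) fun i => by simp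
  rw [← hc, h]
  rfl

theorem apply_sort_mono {a b : Fin n → ℝ} (h : ∀ i, a i ≤ b i) (j : Fin n) :
    a (Tuple.sort a j) ≤ b (Tuple.sort b j) := by
  rw [apply_sort_le_iff]
  refine lt_of_lt_of_le ((apply_sort_le_iff b j _).mp le_rfl) (Finset.card_le_card ?_)
  intro i hi
  simp only [Finset.mem_filter, Finset.mem_univ, true_and] at hi ⊢
  exact (h i).trans hi

theorem apply_sort_add_const (a : Fin n → ℝ) (d : ℝ) (j : Fin n) :
    a (Tuple.sort (fun i => a i + d) j) = a (Tuple.sort a j) := by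
  have h := (Tuple.comp_sort_eq_comp_iff_monotone (f := fun i => a i + d) (σ := Tuple.sort a)).mpr
    (fun i k hik => by
      have := Tuple.monotone_sort a hik
      simp only [Function.comp_apply] at this ⊢
      linarith)
  have := congrFun h j
  simp only [Function.comp_apply] at this
  linarith

theorem apply_sort_neg (a : Fin n → ℝ) (j : Fin n) :
    a (Tuple.sort (fun i => -a i) j) = a (Tuple.sort a j.rev) := by
  have h := (Tuple.comp_sort_eq_comp_iff_monotone (f := fun i => -a i)
    (σ := Fin.revPerm.trans (Tuple.sort a))).mpr
    (fun i k hik => by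
      have := Tuple.monotone_sort a (Fin.rev_le_rev.mpr hik)
      simp only [Function.comp_apply, Equiv.trans_apply, Fin.revPerm_apply] at this ⊢
      linarith)
  have := congrFun h j
  simp only [Function.comp_apply, Equiv.trans_apply, Fin.revPerm_apply] at this
  linarith

theorem card_middle (t : ℕ) :
    (Finset.univ.filter (fun j : Fin n => t ≤ j.val ∧ j.val + t < n)).card = n - 2 * t := by
  have h : (Finset.univ.filter (fun j : Fin n => t ≤ j.val ∧ j.val + t < n)).map
      Fin.valEmbedding = Finset.Ico t (n - t) := by
    ext j
    simp only [Finset.mem_map, Finset.mem_filter, Finset.mem_univ, true_and,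
      Fin.valEmbedding_apply, Finset.mem_Ico]
    constructor
    · rintro ⟨i, hi, rfl⟩; omega
    · intro hj; exact ⟨⟨j, by omega⟩, by simp only; omega, rfl⟩
  rw [← Finset.card_map Fin.valEmbedding, h, Nat.card_Ico]
  omega

theorem trimmedAvg_mono {t : ℕ} (ht : 2 * t < n) {a b : Fin n → ℝ} (h : ∀ i, a i ≤ b i) :
    trimmedAvg t a ≤ trimmedAvg t b := by
  have hpos : (0 : ℝ) < (n : ℝ) - 2 * t := by
    have : ((2 * t : ℕ) : ℝ) < n := by exact_mod_cast ht
    push_cast at this; linarith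
  unfold trimmedAvg
  exact mul_le_mul_of_nonneg_left (Finset.sum_le_sum fun j _ => apply_sort_mono h j) (by positivity)

theorem trimmedAvg_add_const {t : ℕ} (ht : 2 * t < n) (a : Fin n → ℝ) (d : ℝ) :
    trimmedAvg t (fun i => a i + d) = trimmedAvg t a + d := by
  have hpos : (0 : ℝ) < (n : ℝ) - 2 * t := by
    have : ((2 * t : ℕ) : ℝ) < n := by exact_mod_cast ht
    push_cast at this; linarith
  unfold trimmedAvg
  simp only [apply_sort_add_const, Finset.sum_add_distrib, Finset.sum_const, card_middle,
    nsmul_eq_mul]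
  rw [Nat.cast_sub ht.le]
  push_cast
  field_simp

theorem trimmedAvg_neg (t : ℕ) (a : Fin n → ℝ) :
    trimmedAvg t (fun i => -a i) = -trimmedAvg t a := by
  unfold trimmedAvg
  rw [← mul_neg, ← Finset.sum_neg_distrib]
  congr 1
  simp only [apply_sort_neg]
  refine Finset.sum_nbij' Fin.rev Fin.rev ?_ ?_ ?_ ?_ ?_
  · intro j hj
    simp only [Finset.mem_filter, Finset.mem_univ, true_and, Fin.val_rev] at hj ⊢
    omega
  · intro j hj
    simp only [Finset.mem_filter, Finset.mem_univ, true_and, Fin.val_rev] at hj ⊢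
    omega
  · intro j _; exact Fin.rev_rev j
  · intro j _; exact Fin.rev_rev j
  · intro j _; rfl

/-- Bound for the trimmed mean of a contaminated tuple. -/
theorem mul_trimmedAvg_le {k s t : ℕ} (hkst : k + s ≤ t) (ht : 2 * t < n) {M B : ℝ} (hM : 0 ≤ M)
    (hB : 0 ≤ B) {z y : Fin n → ℝ} (hzy : (Finset.univ.filter fun i => z i ≠ y i).card ≤ k)
    (hz : (Finset.univ.filter fun i => M < |z i|).card ≤ s) (hsum : ∑ i, clip M (z i) ≤ B) :
    n * trimmedAvg t y ≤ 2 * B + 8 * (t * M) := by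
  classical
  have hpos : (0 : ℝ) < (n : ℝ) - 2 * t := by
    have : ((2 * t : ℕ) : ℝ) < n := by exact_mod_cast ht
    push_cast at this; linarith
  have hycard : (Finset.univ.filter fun i => M < |y i|).card ≤ t := by
    refine le_trans (Finset.card_le_card (t := (Finset.univ.filter fun i => z i ≠ y i) ∪
      Finset.univ.filter fun i => M < |z i|) ?_) ((Finset.card_union_le _ _).trans (by omega))
    intro i hi
    simp only [Finset.mem_filter, Finset.mem_univ, true_and, Finset.mem_union] at hi ⊢
    by_cases h : z i = y i
    · right; rwa [h]
    · left; exact h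
  -- Retained indices. Since at most `t` entries of `y` exceed `M` in absolute value, the retained
  -- order statistics are not changed by clipping.
  set F := Finset.univ.filter (fun j : Fin n => t ≤ j.val ∧ j.val + t < n) with hF
  have hmid : ∀ j ∈ F, |y (Tuple.sort y j)| ≤ M := by
    intro j hj
    simp only [hF, Finset.mem_filter, Finset.mem_univ, true_and] at hj
    rw [abs_le]
    constructor
    · by_contra hcon
      push Not at hcon
      rw [apply_sort_lt_iff] at hcon
      have : (Finset.univ.filter fun i => y i < -M).card ≤
          (Finset.univ.filter fun i => M < |y i|).card := by
        refine Finset.card_le_card fun i hi => ?_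
        simp only [Finset.mem_filter, Finset.mem_univ, true_and] at hi ⊢
        rw [lt_abs]; right; linarith
      omega
    · rw [apply_sort_le_iff]
      have h1 := Finset.card_filter_add_card_filter_not (s := (Finset.univ : Finset (Fin n)))
        (fun i => y i ≤ M)
      have h2 : (Finset.univ.filter fun i => ¬ y i ≤ M).card ≤
          (Finset.univ.filter fun i => M < |y i|).card := by
        refine Finset.card_le_card fun i hi => ?_
        simp only [Finset.mem_filter, Finset.mem_univ, true_and, not_le] at hi ⊢
        exact hi.trans_le (le_abs_self _)
      rw [Finset.card_univ, Fintype.card_fin] at h1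
      omega
  have hTdef : ((n : ℝ) - 2 * t) * trimmedAvg t y = ∑ j ∈ F, y (Tuple.sort y j) := by
    unfold trimmedAvg
    rw [← mul_assoc, mul_one_div_cancel hpos.ne', one_mul]
  have hFcard : (F.card : ℝ) = n - 2 * t := by
    rw [hF, card_middle, Nat.cast_sub ht.le]; push_cast; ring
  have hTM : trimmedAvg t y ≤ M := by
    have h1 : ∑ j ∈ F, y (Tuple.sort y j) ≤ F.card * M := by
      refine (Finset.sum_le_sum fun j hj => (abs_le.mp (hmid j hj)).2).trans_eq ?_
      simp
    rw [← hTdef, hFcard] at h1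
    exact le_of_mul_le_mul_left h1 hpos
  have hclipy : ∑ i, clip M (y i) ≤ B + 2 * (k * M) := by
    have h1 : ∑ i, (clip M (y i) - clip M (z i)) ≤
        ∑ i, if z i ≠ y i then 2 * M else 0 := by
      refine Finset.sum_le_sum fun i _ => ?_
      split_ifs with h
      · have h1 := abs_le.mp (abs_clip_le hM (y i)); have h2 := abs_le.mp (abs_clip_le hM (z i))
        linarith
      · push Not at h
        rw [h, sub_self]
    rw [← Finset.sum_filter, Finset.sum_const, nsmul_eq_mul, Finset.sum_sub_distrib] at h1
    have h2 : ((Finset.univ.filter fun i => z i ≠ y i).card : ℝ) * (2 * M) ≤ k * (2 * M) := by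
      gcongr
    linarith
  -- Contamination moves the clipped sum by at most `2 k M`, and dropping `2 t` clipped values by at
  -- most `2 t M`; moreover `k ≤ t`.
  have hsumF : ∑ j ∈ F, y (Tuple.sort y j) ≤ B + 4 * (t * M) := by
    have h1 : ∑ j ∈ F, y (Tuple.sort y j) = ∑ j ∈ F, clip M (y (Tuple.sort y j)) :=
      Finset.sum_congr rfl fun j hj => (clip_eq_self (hmid j hj)).symm
    have h2 : ∑ j, clip M (y (Tuple.sort y j)) = ∑ i, clip M (y i) :=
      Equiv.sum_comp (Tuple.sort y) fun i => clip M (y i)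
    have h3 := Finset.sum_add_sum_compl F fun j => clip M (y (Tuple.sort y j))
    have h4 : -((Fᶜ.card : ℝ) * M) ≤ ∑ j ∈ Fᶜ, clip M (y (Tuple.sort y j)) := by
      have : ∑ j ∈ Fᶜ, -M ≤ ∑ j ∈ Fᶜ, clip M (y (Tuple.sort y j)) :=
        Finset.sum_le_sum fun j _ => (abs_le.mp (abs_clip_le hM _)).1
      simpa using this
    have h5 : (Fᶜ.card : ℝ) = 2 * t := by
      rw [Finset.card_compl, Fintype.card_fin, hF, card_middle]
      have : n - (n - 2 * t) = 2 * t := by omega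
      rw [this]; push_cast; ring
    have h6 : (k : ℝ) * M ≤ t * M := by
      have : (k : ℝ) ≤ t := by exact_mod_cast (by omega : k ≤ t)
      gcongr
    rw [h5] at h4
    linarith
  rw [← hTdef] at hsumF
  have htM : 0 ≤ (t : ℝ) * M := by positivity
  rcases le_total (trimmedAvg t y) 0 with h0 | h0
  · have : n * trimmedAvg t y ≤ 0 := mul_nonpos_of_nonneg_of_nonpos (Nat.cast_nonneg _) h0
    linarith
  -- If `n ≤ 4 t`, the bound of the trimmed mean by `M` is enough; otherwise `n - 2 t ≥ n / 2`,
  -- which is the source of the factor `2`.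
  · rcases le_total (n : ℝ) (4 * t) with h4 | h4
    · calc n * trimmedAvg t y ≤ (4 * t) * M := mul_le_mul h4 hTM h0 (by positivity)
        _ ≤ _ := by linarith
    · nlinarith

end Trimmed

/-! ### From trimmed linear terms to the min-max estimator. -/

section Estimator

variable {E : Type*} [NormedAddCommGroup E] [NormedSpace ℝ E] {n : ℕ}

/-- A uniform bound for trimmed means of subgradients controls the estimator. -/
theorem IsTrimmedFrechetMean.norm_sub_le {t : ℕ} (ht : 2 * t < n) {κ W : ℝ} (hκ : 0 < κ)
    (hW : 0 ≤ W) {g : E → StrongDual ℝ E}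
    (hg : ∀ u w : E, ‖u‖ ^ 2 + g u w + κ * ‖w‖ ^ 2 ≤ ‖u + w‖ ^ 2) {x : Fin n → E} {μ m : E}
    (hT : ∀ v : E, trimmedAvg t (fun i => g (x i - μ) v) ≤ W * ‖v‖)
    (hm : IsTrimmedFrechetMean t x m) : ‖m - μ‖ ≤ 2 * W / κ := by
  have hdiff : ∀ (a : E) (z : E),
      dist μ z ^ 2 - dist a z ^ 2 ≤ g (z - μ) (a - μ) + -(κ * ‖a - μ‖ ^ 2) := by
    intro a z
    have h := hg (z - μ) (μ - a)
    rw [sub_add_sub_cancel, norm_sub_rev μ a] at h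
    rw [dist_eq_norm, dist_eq_norm, norm_sub_rev μ z, norm_sub_rev a z]
    have e : g (z - μ) (μ - a) = -g (z - μ) (a - μ) := by rw [← map_neg, neg_sub]
    rw [e] at h
    linarith
  -- Without boundedness the real supremum would take its default value and give no lower bound on
  -- the objective.
  have hbdd : BddAbove (Set.range fun a : E =>
      trimmedMean t (fun z => dist m z ^ 2 - dist a z ^ 2) x) := by
    refine ⟨trimmedAvg t fun i => dist m (x i) ^ 2, ?_⟩
    rintro _ ⟨a, rfl⟩
    dsimp only
    rw [trimmedMean_eq_trimmedAvg]
    exact trimmedAvg_mono ht fun i => by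
      have := sq_nonneg (dist a (x i)); linarith
  have h1 : trimmedMean t (fun z => dist m z ^ 2 - dist μ z ^ 2) x ≤ trimmedObjective t x m :=
    le_ciSup hbdd μ
  -- `W² / (4 κ)` is the maximum over `r` of `W r - κ r²`.
  have h2 : trimmedObjective t x μ ≤ W ^ 2 / (4 * κ) := by
    refine ciSup_le fun a => ?_
    rw [trimmedMean_eq_trimmedAvg]
    refine (trimmedAvg_mono ht fun i => hdiff a (x i)).trans ?_
    rw [trimmedAvg_add_const ht]
    have h3 := hT (a - μ)
    have h4 : W * ‖a - μ‖ + -(κ * ‖a - μ‖ ^ 2) ≤ W ^ 2 / (4 * κ) := by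
      rw [le_div_iff₀ (by positivity)]
      nlinarith [sq_nonneg (W - 2 * κ * ‖a - μ‖)]
    linarith
  have h3 : -(W * ‖m - μ‖) + κ * ‖m - μ‖ ^ 2 ≤
      trimmedMean t (fun z => dist m z ^ 2 - dist μ z ^ 2) x := by
    rw [trimmedMean_eq_trimmedAvg]
    have h4 : trimmedAvg t (fun i => -g (x i - μ) (m - μ) + κ * ‖m - μ‖ ^ 2) ≤
        trimmedAvg t fun i => dist m (x i) ^ 2 - dist μ (x i) ^ 2 :=
      trimmedAvg_mono ht fun i => by linarith [hdiff m (x i)]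
    rw [trimmedAvg_add_const ht (fun i => -g (x i - μ) (m - μ)), trimmedAvg_neg] at h4
    linarith [hT (m - μ)]
  -- Minimality of `m` gives `κ r² - W r ≤ W² / (4 κ)`, which is impossible for `r > 2 W / κ`.
  have h5 := h3.trans (h1.trans ((hm μ).trans h2))
  set r := ‖m - μ‖ with hr
  have hr0 : 0 ≤ r := norm_nonneg _
  rw [le_div_iff₀ hκ]
  by_contra hcon
  push Not at hcon
  rw [le_div_iff₀ (by positivity)] at h5
  nlinarith [mul_pos (lt_of_le_of_lt (by positivity : 0 ≤ 2 * W) hcon)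
    (lt_of_le_of_lt (by positivity : 0 ≤ 2 * W) hcon)]

end Estimator

/-! ### Existence and uniqueness of the Fréchet mean. -/

section FrechetMean

variable {E : Type*} [NormedAddCommGroup E] [NormedSpace ℝ E] [MeasurableSpace E] [BorelSpace E]
  {Ω : Type*} [MeasurableSpace Ω] {P : Measure Ω} [IsProbabilityMeasure P] {X : Ω → E}

omit [NormedSpace ℝ E] in
theorem integrable_norm_sub_sq (hX : Measurable X) (hX2 : Integrable (fun ω => ‖X ω‖ ^ 2) P)
    (b : E) : Integrable (fun ω => ‖X ω - b‖ ^ 2) P := by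
  refine ((hX2.const_mul 2).add (integrable_const (2 * ‖b‖ ^ 2))).mono'
    (by
      have := hX.sub_const b
      exact (this.norm.pow_const 2).aestronglyMeasurable)
    (Filter.Eventually.of_forall fun ω => ?_)
  rw [Real.norm_of_nonneg (sq_nonneg _)]
  have h1 := norm_sub_le (X ω) b
  have h2 := pow_le_pow_left₀ (norm_nonneg _) h1 2
  simp only [Pi.add_apply]
  nlinarith [sq_nonneg (‖X ω‖ - ‖b‖)]

theorem integral_norm_sub_sq_midpoint {k : ℝ} (h : SqMidpointConvex E k) (hX : Measurable X)
    (hX2 : Integrable (fun ω => ‖X ω‖ ^ 2) P) (a b : E) :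
    ∫ ω, ‖X ω - (1 / 2 : ℝ) • (a + b)‖ ^ 2 ∂P + k / 4 * ‖a - b‖ ^ 2 ≤
      (∫ ω, ‖X ω - a‖ ^ 2 ∂P + ∫ ω, ‖X ω - b‖ ^ 2 ∂P) / 2 := by
  have hi := integrable_norm_sub_sq (P := P) hX hX2
  have hpt : ∀ ω, ‖X ω - (1 / 2 : ℝ) • (a + b)‖ ^ 2 + k / 4 * ‖a - b‖ ^ 2 ≤
      (‖X ω - a‖ ^ 2 + ‖X ω - b‖ ^ 2) / 2 := by
    intro ω
    have h1 := h (X ω - a) (X ω - b)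
    have e1 : (1 / 2 : ℝ) • (X ω - a + (X ω - b)) = X ω - (1 / 2 : ℝ) • (a + b) := by module
    have e2 : X ω - a - (X ω - b) = b - a := by module
    rw [e1, e2, norm_sub_rev b a] at h1
    exact h1
  have h2 := integral_mono ((hi _).add (integrable_const (k / 4 * ‖a - b‖ ^ 2)))
    (((hi a).add (hi b)).div_const 2) hpt
  simp only [Pi.add_apply] at h2
  rw [integral_add (hi _) (integrable_const _), integral_div, integral_add (hi a) (hi b)] at h2
  simpa using h2

theorem existsUnique_isFrechetMean [CompleteSpace E] {k : ℝ} (hk : 0 < k)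
    (h : SqMidpointConvex E k) (hX : Measurable X) (hX2 : Integrable (fun ω => ‖X ω‖ ^ 2) P) :
    ∃! μ : E, IsFrechetMean P X μ := by
  set F : E → ℝ := fun b => ∫ ω, ‖X ω - b‖ ^ 2 ∂P with hF
  have hi := integrable_norm_sub_sq (P := P) hX hX2
  have hmid := integral_norm_sub_sq_midpoint (P := P) h hX hX2
  have hmean : ∀ μ, IsFrechetMean P X μ ↔ ∀ b, F μ ≤ F b := fun μ => by
    simp only [IsFrechetMean, dist_eq_norm, hF]
  have hF0 : ∀ b, 0 ≤ F b := fun b => integral_nonneg fun ω => sq_nonneg _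
  have hbdd : BddBelow (Set.range F) := ⟨0, by rintro _ ⟨b, rfl⟩; exact hF0 b⟩
  set I := ⨅ b, F b with hI
  have hIle : ∀ b, I ≤ F b := fun b => ciInf_le hbdd b
  -- Near-minimizers are close, because their midpoint cannot go below the infimum. This gives the
  -- Cauchy property and, later, uniqueness.
  have hclose : ∀ a b : E, k / 4 * ‖a - b‖ ^ 2 ≤ (F a + F b) / 2 - I := fun a b => by
    have := hmid a b
    have h2 := hIle ((1 / 2 : ℝ) • (a + b))
    simp only [hF] at h2 ⊢
    linarith
  have hex : ∀ j : ℕ, ∃ b, F b < I + 1 / ((j : ℝ) + 1) := fun j =>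
    exists_lt_of_ciInf_lt (by have : (0 : ℝ) < 1 / ((j : ℝ) + 1) := by positivity
                              linarith)
  choose B hB using hex
  have hcauchy : CauchySeq B := by
    refine Metric.cauchySeq_iff'.mpr fun η hη => ?_
    obtain ⟨N, hN⟩ := exists_nat_one_div_lt (by positivity : (0 : ℝ) < k / 4 * η ^ 2)
    refine ⟨N, fun j hj => ?_⟩
    have h1 := hclose (B j) (B N)
    have h2 := hB j
    have h3 := hB N
    have h4 : 1 / ((j : ℝ) + 1) ≤ 1 / ((N : ℝ) + 1) := by
      have : (N : ℝ) ≤ j := by exact_mod_cast hj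
      gcongr
    have h5 : k / 4 * ‖B j - B N‖ ^ 2 < k / 4 * η ^ 2 := by linarith
    rw [dist_eq_norm]
    exact lt_of_pow_lt_pow_left₀ 2 hη.le (lt_of_mul_lt_mul_left h5 (by positivity))
  obtain ⟨μ, hμ⟩ := cauchySeq_tendsto_of_complete hcauchy
  have hμI : F μ ≤ I := by
    -- Lower semicontinuity by hand: `(x + y)² ≤ (1 + s) x² + (1 + 1/s) y²`, then the limit along
    -- the minimizing sequence, then `s → 0`.
    have key : ∀ s : ℝ, 0 < s → F μ ≤ (1 + s) * I := by
      intro s hs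
      have h1 : ∀ j, F μ ≤ (1 + s) * F (B j) + (1 + 1 / s) * ‖B j - μ‖ ^ 2 := by
        intro j
        have hpt : ∀ ω, ‖X ω - μ‖ ^ 2 ≤
            (1 + s) * ‖X ω - B j‖ ^ 2 + (1 + 1 / s) * ‖B j - μ‖ ^ 2 := by
          intro ω
          have h2 := norm_sub_le_norm_sub_add_norm_sub (X ω) (B j) μ
          have h3 := pow_le_pow_left₀ (norm_nonneg _) h2 2
          have h4 : 0 ≤ (s * ‖X ω - B j‖ - ‖B j - μ‖) ^ 2 / s := by positivity
          have h5 : (s * ‖X ω - B j‖ - ‖B j - μ‖) ^ 2 / s =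
              s * ‖X ω - B j‖ ^ 2 - 2 * ‖X ω - B j‖ * ‖B j - μ‖ + 1 / s * ‖B j - μ‖ ^ 2 := by
            field_simp
            ring
          nlinarith
        have h2 := integral_mono (hi μ) (((hi (B j)).const_mul (1 + s)).add
          (integrable_const ((1 + 1 / s) * ‖B j - μ‖ ^ 2))) hpt
        simp only [Pi.add_apply] at h2
        rw [integral_add ((hi (B j)).const_mul _) (integrable_const _), integral_const_mul] at h2
        simpa using h2
      have h2 : Filter.Tendsto (fun j : ℕ => (1 + s) * (I + 1 / ((j : ℝ) + 1)) +
          (1 + 1 / s) * ‖B j - μ‖ ^ 2) Filter.atTop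
          (nhds ((1 + s) * (I + 0) + (1 + 1 / s) * 0 ^ 2)) := by
        refine Filter.Tendsto.add (Filter.Tendsto.const_mul _ (Filter.Tendsto.const_add _ ?_))
          (Filter.Tendsto.const_mul _ (Filter.Tendsto.pow ?_ 2))
        · exact tendsto_one_div_add_atTop_nhds_zero_nat
        · have := (tendsto_iff_norm_sub_tendsto_zero.mp hμ)
          exact this
      have h3 := ge_of_tendsto' h2 fun j => (h1 j).trans (by
        have := mul_le_mul_of_nonneg_left (hB j).le (by linarith : 0 ≤ 1 + s)
        linarith)
      simpa using h3
    have hI0 : 0 ≤ I := le_ciInf hF0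
    refine le_of_forall_pos_le_add fun η hη => ?_
    refine (key (η / (I + 1)) (by positivity)).trans ?_
    have : η / (I + 1) * I ≤ η := by
      rw [div_mul_eq_mul_div, div_le_iff₀ (by positivity)]
      nlinarith
    linarith
  refine ⟨μ, (hmean μ).mpr fun b => hμI.trans (hIle b), fun ν hν => ?_⟩
  have hν' := (hmean ν).mp hν
  have h1 := hclose ν μ
  have h2 : F ν ≤ I := le_ciInf hν'
  have h3 : k / 4 * ‖ν - μ‖ ^ 2 ≤ 0 := by linarith
  have h4 : ‖ν - μ‖ ^ 2 ≤ 0 := by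
    by_contra hc
    push Not at hc
    have : 0 < k / 4 * ‖ν - μ‖ ^ 2 := by positivity
    linarith
  have h5 : ‖ν - μ‖ = 0 := by nlinarith [norm_nonneg (ν - μ)]
  exact sub_eq_zero.mp (norm_eq_zero.mp h5)

end FrechetMean

/-! ### One-sided directional derivatives of convex functions. -/

section DirectionalDerivative

variable {E : Type*} [NormedAddCommGroup E] [NormedSpace ℝ E]

/-- A sublinear function. -/
def IsSublinear (p : E → ℝ) : Prop :=
  (∀ x y, p (x + y) ≤ p x + p y) ∧ ∀ c : ℝ, 0 < c → ∀ x, p (c • x) = c * p x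

theorem IsSublinear.map_zero {p : E → ℝ} (hp : IsSublinear p) : p 0 = 0 := by
  have h := hp.2 2 (by norm_num) 0
  rw [smul_zero] at h
  linarith

theorem IsSublinear.neg_le {p : E → ℝ} (hp : IsSublinear p) (x : E) : -p (-x) ≤ p x := by
  have h := hp.1 x (-x)
  rw [add_neg_cancel, hp.map_zero] at h
  linarith

theorem IsSublinear.convexOn {p : E → ℝ} (hp : IsSublinear p) : ConvexOn ℝ Set.univ p := by
  refine convexOn_iff_forall_pos.mpr ⟨convex_univ, fun x _ y _ a b ha hb _ => ?_⟩
  refine (hp.1 _ _).trans_eq ?_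
  rw [hp.2 a ha, hp.2 b hb]
  rfl

/-- The one-sided directional derivative of a convex function. -/
noncomputable def dirDeriv (f : E → ℝ) (d h : E) : ℝ :=
  ⨅ t : Set.Ioi (0 : ℝ), (f (d + (t : ℝ) • h) - f d) / t

/-- `d` is a convex combination of `d - h` and `d + t • h`. The resulting bound does not depend on
`t`, so the infimum defining `dirDeriv` is a genuine one. -/
theorem sub_le_quotient {f : E → ℝ} (hf : ConvexOn ℝ Set.univ f) (d h : E) {t : ℝ} (ht : 0 < t) :
    f d - f (d - h) ≤ (f (d + t • h) - f d) / t := by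
  have hc := hf.2 (Set.mem_univ (d - h)) (Set.mem_univ (d + t • h))
    (by positivity : 0 ≤ t / (1 + t)) (by positivity : 0 ≤ 1 / (1 + t)) (by field_simp; ring)
  have e : (t / (1 + t)) • (d - h) + (1 / (1 + t)) • (d + t • h) = d := by
    have h1 : t / (1 + t) + 1 / (1 + t) = 1 := by field_simp; ring
    calc _ = (t / (1 + t) + 1 / (1 + t)) • d + ((1 / (1 + t)) * t - t / (1 + t)) • h := by module
      _ = d := by
        rw [h1, show (1 / (1 + t)) * t - t / (1 + t) = 0 by ring]
        simp
  rw [e] at hc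
  simp only [smul_eq_mul] at hc
  have h2 : (1 + t) * f d ≤ t * f (d - h) + f (d + t • h) := by
    have := mul_le_mul_of_nonneg_left hc (by positivity : 0 ≤ 1 + t)
    refine this.trans_eq ?_
    field_simp
  rw [le_div_iff₀ ht]
  linarith

theorem bddBelow_quotient {f : E → ℝ} (hf : ConvexOn ℝ Set.univ f) (d h : E) :
    BddBelow (Set.range fun t : Set.Ioi (0 : ℝ) => (f (d + (t : ℝ) • h) - f d) / t) := by
  refine ⟨f d - f (d - h), ?_⟩
  rintro _ ⟨t, rfl⟩
  exact sub_le_quotient hf d h t.2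

theorem quotient_mono {f : E → ℝ} (hf : ConvexOn ℝ Set.univ f) (d h : E) {s t : ℝ} (hs : 0 < s)
    (hst : s ≤ t) : (f (d + s • h) - f d) / s ≤ (f (d + t • h) - f d) / t := by
  have ht : 0 < t := hs.trans_le hst
  have hc := hf.2 (Set.mem_univ d) (Set.mem_univ (d + t • h))
    (sub_nonneg.mpr ((div_le_one ht).mpr hst)) (by positivity : 0 ≤ s / t) (by ring)
  have e : (1 - s / t) • d + (s / t) • (d + t • h) = d + s • h := by
    calc _ = d + (s / t * t) • h := by module
      _ = _ := by rw [div_mul_cancel₀ _ ht.ne']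
  rw [e] at hc
  simp only [smul_eq_mul] at hc
  rw [div_le_div_iff₀ hs ht]
  have h2 := mul_le_mul_of_nonneg_left hc ht.le
  have h3 : t * ((1 - s / t) * f d + s / t * f (d + t • h)) =
      t * f d - s * f d + s * f (d + t • h) := by field_simp
  rw [h3] at h2
  linarith

theorem dirDeriv_le {f : E → ℝ} (hf : ConvexOn ℝ Set.univ f) (d h : E) {t : ℝ} (ht : 0 < t) :
    dirDeriv f d h ≤ (f (d + t • h) - f d) / t :=
  ciInf_le (bddBelow_quotient hf d h) ⟨t, ht⟩

theorem le_dirDeriv {f : E → ℝ} {d h : E} {c : ℝ}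
    (hc : ∀ t : ℝ, 0 < t → c ≤ (f (d + t • h) - f d) / t) : c ≤ dirDeriv f d h := by
  have : Nonempty (Set.Ioi (0 : ℝ)) := ⟨⟨1, Set.mem_Ioi.mpr one_pos⟩⟩
  exact le_ciInf fun t => hc t t.2

/-- Monotone quotients reduce the infimum to a countable one, which is used for measurability and
for dominated convergence. -/
theorem dirDeriv_eq_iInf_nat {f : E → ℝ} (hf : ConvexOn ℝ Set.univ f) (d h : E) :
    dirDeriv f d h =
      ⨅ m : ℕ, (f (d + (1 / ((m : ℝ) + 1)) • h) - f d) / (1 / ((m : ℝ) + 1)) := by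
  apply le_antisymm
  · exact le_ciInf fun m => dirDeriv_le hf d h (by positivity)
  · refine le_dirDeriv fun t ht => ?_
    obtain ⟨m, hm⟩ := exists_nat_one_div_lt ht
    have hb : BddBelow (Set.range fun m : ℕ =>
        (f (d + (1 / ((m : ℝ) + 1)) • h) - f d) / (1 / ((m : ℝ) + 1))) := by
      refine ⟨f d - f (d - h), ?_⟩
      rintro _ ⟨m, rfl⟩
      exact sub_le_quotient hf d h (by positivity)
    exact (ciInf_le hb m).trans (quotient_mono hf d h (by positivity) hm.le)

theorem tendsto_dirDeriv {f : E → ℝ} (hf : ConvexOn ℝ Set.univ f) (d h : E) :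
    Filter.Tendsto (fun m : ℕ => (f (d + (1 / ((m : ℝ) + 1)) • h) - f d) / (1 / ((m : ℝ) + 1)))
      Filter.atTop (nhds (dirDeriv f d h)) := by
  rw [dirDeriv_eq_iInf_nat hf]
  refine tendsto_atTop_ciInf (fun a b hab => quotient_mono hf d h (by positivity) ?_) ?_
  · have : (a : ℝ) ≤ b := by exact_mod_cast hab
    gcongr
  · refine ⟨f d - f (d - h), ?_⟩
    rintro _ ⟨m, rfl⟩
    exact sub_le_quotient hf d h (by positivity)

theorem isSublinear_dirDeriv {f : E → ℝ} (hf : ConvexOn ℝ Set.univ f) (d : E) :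
    IsSublinear (dirDeriv f d) := by
  have hhom : ∀ c : ℝ, 0 < c → ∀ h, c * dirDeriv f d h ≤ dirDeriv f d (c • h) := by
    intro c hc h
    refine le_dirDeriv fun t ht => ?_
    have h1 := dirDeriv_le hf d h (mul_pos ht hc)
    rw [smul_smul]
    rw [le_div_iff₀ (mul_pos ht hc)] at h1
    rw [le_div_iff₀ ht]
    linarith
  refine ⟨fun x y => ?_, fun c hc h => le_antisymm ?_ (hhom c hc h)⟩
  · rw [← sub_le_iff_le_add]
    refine le_dirDeriv fun t₁ ht₁ => ?_
    rw [sub_le_comm]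
    refine le_dirDeriv fun t₂ ht₂ => ?_
    -- Independent step sizes are compared at their minimum; convexity at the midpoint then uses
    -- step `s / 2` in direction `x + y`.
    set s := min t₁ t₂ with hs
    have hs0 : 0 < s := lt_min ht₁ ht₂
    have h1 := dirDeriv_le hf d (x + y) (half_pos hs0)
    have h2 := quotient_mono hf d x hs0 (min_le_left t₁ t₂)
    have h3 := quotient_mono hf d y hs0 (min_le_right t₁ t₂)
    have hc := hf.2 (Set.mem_univ (d + s • x)) (Set.mem_univ (d + s • y))
      (by norm_num : (0 : ℝ) ≤ 1 / 2) (by norm_num : (0 : ℝ) ≤ 1 / 2) (by norm_num)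
    have e : (1 / 2 : ℝ) • (d + s • x) + (1 / 2 : ℝ) • (d + s • y) = d + (s / 2) • (x + y) := by
      module
    rw [e] at hc
    simp only [smul_eq_mul] at hc
    have h4 : (f (d + (s / 2) • (x + y)) - f d) / (s / 2) ≤
        (f (d + s • x) - f d) / s + (f (d + s • y) - f d) / s := by
      rw [← add_div, div_le_div_iff₀ (by positivity) hs0]
      nlinarith
    linarith
  · have h1 := hhom c⁻¹ (by positivity) (c • h)
    rw [smul_smul, inv_mul_cancel₀ hc.ne', one_smul, inv_mul_le_iff₀ hc] at h1
    exact h1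

theorem dirDeriv_le_self {p : E → ℝ} (hp : IsSublinear p) (d h : E) : dirDeriv p d h ≤ p h := by
  have h1 := dirDeriv_le hp.convexOn d h one_pos
  rw [one_smul, div_one] at h1
  linarith [hp.1 d h]

/-- A sublinear function is linear along the ray through `d`, so differentiating at `d` makes it
linear on the line through `d`. -/
theorem dirDeriv_add_dirDeriv_neg_le {p : E → ℝ} (hp : IsSublinear p) (d : E) :
    dirDeriv p d d + dirDeriv p d (-d) ≤ 0 := by
  have h1 := dirDeriv_le_self hp d d
  have h2 := dirDeriv_le hp.convexOn d (-d) (by norm_num : (0 : ℝ) < 1 / 2)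
  have e : d + (1 / 2 : ℝ) • -d = (1 / 2 : ℝ) • d := by module
  rw [e, hp.2 _ (by norm_num)] at h2
  linarith

theorem convexOn_norm_sq : ConvexOn ℝ Set.univ fun z : E => ‖z‖ ^ 2 :=
  (convexOn_norm convex_univ).pow (fun _ _ => norm_nonneg _) 2

theorem dirDeriv_norm_sq_le (x h : E) : dirDeriv (fun z : E => ‖z‖ ^ 2) x h ≤ 2 * ‖x‖ * ‖h‖ := by
  refine le_of_forall_pos_le_add fun η hη => ?_
  set t := η / (‖h‖ ^ 2 + 1) with ht
  have ht0 : 0 < t := by positivity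
  refine (dirDeriv_le convexOn_norm_sq x h ht0).trans ?_
  rw [div_le_iff₀ ht0]
  have h2 : ‖x + t • h‖ ≤ ‖x‖ + t * ‖h‖ := by
    refine (norm_add_le _ _).trans ?_
    rw [norm_smul, Real.norm_of_nonneg ht0.le]
  have h3 : ‖x + t • h‖ ^ 2 ≤ (‖x‖ + t * ‖h‖) ^ 2 := pow_le_pow_left₀ (norm_nonneg _) h2 2
  have h4 : t * ‖h‖ ^ 2 ≤ η := by
    rw [ht, div_mul_eq_mul_div, div_le_iff₀ (by positivity)]
    nlinarith
  nlinarith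

theorem dirDeriv_norm_sq_le_sub (x h : E) :
    dirDeriv (fun z : E => ‖z‖ ^ 2) x h ≤ ‖x + h‖ ^ 2 - ‖x‖ ^ 2 := by
  simpa using dirDeriv_le convexOn_norm_sq x h one_pos

theorem abs_dirDeriv_norm_sq_le (x h : E) :
    |dirDeriv (fun z : E => ‖z‖ ^ 2) x h| ≤ 2 * ‖x‖ * ‖h‖ := by
  have h1 := dirDeriv_norm_sq_le x h
  have h2 := dirDeriv_norm_sq_le x (-h)
  have h3 := (isSublinear_dirDeriv convexOn_norm_sq x).neg_le h
  rw [norm_neg] at h2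
  rw [abs_le]
  constructor <;> linarith

end DirectionalDerivative

/-! ### Measurable subgradient selections. -/

section Selection

variable {E : Type*} [NormedAddCommGroup E] [NormedSpace ℝ E]

theorem exists_strongDual_eq {f : E → ℝ} {L : ℝ} (hadd : ∀ x y, f (x + y) = f x + f y)
    (hL : ∀ x, |f x| ≤ L * ‖x‖) : ∃ φ : StrongDual ℝ E, ∀ x, φ x = f x := by
  let F : E →+ ℝ := AddMonoidHom.mk' f hadd
  have hc : Continuous F := AddMonoidHomClass.continuous_of_bound F L fun x => hL x
  exact ⟨F.toRealLinearMap hc, fun x => rfl⟩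

theorem mem_subdifferential_iff {f : E → ℝ} {x : E} {φ : StrongDual ℝ E} :
    φ ∈ subdifferential f x ↔ ∀ h, φ h ≤ f (x + h) - f x := by
  constructor
  · intro hφ h
    simpa using hφ (x + h)
  · intro hφ y
    simpa using hφ (y - x)

/-- Successive directional derivatives of a sublinear function along a sequence of directions. -/
noncomputable def iterDirDeriv (d : ℕ → E) (p : E → ℝ) : ℕ → E → ℝ
  | 0 => p
  | k + 1 => dirDeriv (iterDirDeriv d p k) (d k)

variable {d : ℕ → E} {p : E → ℝ}

theorem IsSublinear.iterDirDeriv (hp : IsSublinear p) (k : ℕ) :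
    IsSublinear (iterDirDeriv d p k) := by
  induction k with
  | zero => exact hp
  | succ k ih => exact isSublinear_dirDeriv ih.convexOn _

theorem antitone_iterDirDeriv (hp : IsSublinear p) (h : E) :
    Antitone fun k => iterDirDeriv d p k h :=
  antitone_nat_of_succ_le fun k => dirDeriv_le_self (hp.iterDirDeriv k) _ _

theorem bddBelow_iterDirDeriv (hp : IsSublinear p) (h : E) :
    BddBelow (Set.range fun k => iterDirDeriv d p k h) := by
  refine ⟨-p (-h), ?_⟩
  rintro _ ⟨k, rfl⟩
  have h1 := (hp.iterDirDeriv (d := d) k).neg_le h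
  have h2 : TrimmedFrechet.iterDirDeriv d p k (-h) ≤ p (-h) :=
    antitone_iterDirDeriv (d := d) hp (-h) (Nat.zero_le k)
  dsimp only
  linarith

theorem tendsto_iterDirDeriv (hp : IsSublinear p) (h : E) :
    Filter.Tendsto (fun k => iterDirDeriv d p k h) Filter.atTop
      (nhds (⨅ k, iterDirDeriv d p k h)) :=
  tendsto_atTop_ciInf (antitone_iterDirDeriv hp h) (bddBelow_iterDirDeriv hp h)

/-- A Hahn–Banach construction without choice of values: each differentiation makes the sublinear
function linear along one more dense direction. The decreasing limit is linear along all of them,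
hence everywhere by continuity. Since it is a countable limit, it depends measurably on parameters.
-/
theorem exists_strongDual_eq_iInf (hp : IsSublinear p) {L : ℝ} (hL : ∀ h, p h ≤ L * ‖h‖)
    (hd : DenseRange d) :
    ∃ φ : StrongDual ℝ E, (∀ h, φ h = ⨅ k, iterDirDeriv d p k h) ∧ ∀ h, φ h ≤ p h := by
  set q : E → ℝ := fun h => ⨅ k, iterDirDeriv d p k h with hq
  have hqp : ∀ h, q h ≤ p h := fun h => ciInf_le (bddBelow_iterDirDeriv hp h) 0
  have hqs : ∀ x y, q (x + y) ≤ q x + q y := fun x y =>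
    le_of_tendsto_of_tendsto' (tendsto_iterDirDeriv hp _)
      ((tendsto_iterDirDeriv hp x).add (tendsto_iterDirDeriv hp y))
      fun k => (hp.iterDirDeriv k).1 x y
  have hqd : ∀ j, q (d j) + q (-d j) ≤ 0 := fun j =>
    (add_le_add (ciInf_le (bddBelow_iterDirDeriv hp _) (j + 1))
      (ciInf_le (bddBelow_iterDirDeriv hp _) (j + 1))).trans
        (dirDeriv_add_dirDeriv_neg_le (hp.iterDirDeriv j) (d j))
  have hq0 : q 0 = 0 := by
    have : ∀ k, iterDirDeriv d p k 0 = 0 := fun k => (hp.iterDirDeriv k).map_zero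
    simp [hq, this]
  have hqL : ∀ h, |q h| ≤ L * ‖h‖ := fun h => by
    have h1 := hqs h (-h)
    rw [add_neg_cancel, hq0] at h1
    have h2 := (hqp (-h)).trans (hL (-h))
    rw [norm_neg] at h2
    rw [abs_le]
    constructor <;> linarith [(hqp h).trans (hL h)]
  have hqlip : ∀ x y, q x ≤ q y + L * ‖x - y‖ := fun x y => by
    have h1 := hqs y (x - y)
    rw [add_sub_cancel] at h1
    linarith [(le_abs_self _).trans (hqL (x - y))]
  have hqc : Continuous q := by
    refine LipschitzWith.continuous (K := L.toNNReal) (LipschitzWith.of_le_add_mul _ fun x y => ?_)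
    refine (hqlip x y).trans ?_
    rw [dist_eq_norm, Real.coe_toNNReal']
    gcongr
    exact le_max_left _ _
  have hneg : ∀ h, q h + q (-h) ≤ 0 := fun h =>
    hd.induction_on (p := fun h => q h + q (-h) ≤ 0) h
      (isClosed_le (by fun_prop) continuous_const) hqd
  have hadd : ∀ x y, q (x + y) = q x + q y := fun x y => by
    refine le_antisymm (hqs x y) ?_
    have h1 := hqs (x + y) (-y)
    rw [add_neg_cancel_right] at h1
    linarith [hneg y]
  obtain ⟨φ, hφ⟩ := exists_strongDual_eq hadd hqL
  exact ⟨φ, hφ, fun h => (hφ h).trans_le (hqp h)⟩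

/-- A functional prescribed on a dense sequence, dominated on integer combinations. -/
theorem exists_strongDual_extension (hp : IsSublinear p) {L : ℝ} (hL : ∀ h, p h ≤ L * ‖h‖)
    (hd : DenseRange d) {k : ℕ → ℝ}
    (hk : ∀ q : ℕ →₀ ℤ, (q.sum fun j c => (c : ℝ) * k j) ≤ p (q.sum fun j c => (c : ℝ) • d j)) :
    ∃ φ : StrongDual ℝ E, (∀ j, φ (d j) = k j) ∧ ∀ h, φ h ≤ p h := by
  let κ : (ℕ →₀ ℤ) →+ ℝ := Finsupp.liftAddHom fun j =>
    (AddMonoidHom.mulRight (k j)).comp (Int.castAddHom ℝ)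
  let T : (ℕ →₀ ℤ) →+ E := Finsupp.liftAddHom fun j =>
    (AddMonoidHom.flip (smulAddHom ℝ E) (d j)).comp (Int.castAddHom ℝ)
  have hκT : ∀ q, κ q ≤ p (T q) := hk
  have hL0 : ∀ h, |p h| ≤ L.toNNReal * ‖h‖ := fun h => by
    have hle : L * ‖h‖ ≤ L.toNNReal * ‖h‖ := by
      rw [Real.coe_toNNReal']
      gcongr
      exact le_max_left _ _
    have h2 := hL (-h)
    rw [norm_neg] at h2
    rw [abs_le]
    constructor <;> linarith [hL h, hp.neg_le h]
  -- Domination on integer combinations makes the values Lipschitz in the represented vector, so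
  -- they do not depend on the representation and extend to all of `E`. Additivity passes to the
  -- extension by density. Integer combinations are countable, hence compatible with null sets.
  have hlip : ∀ q q', κ q ≤ κ q' + L.toNNReal * dist (T q) (T q') := fun q q' => by
    have h1 := (hκT (q - q')).trans ((le_abs_self _).trans (hL0 _))
    rw [map_sub, map_sub] at h1
    rw [dist_eq_norm]
    linarith
  have hf : LipschitzOnWith L.toNNReal (fun x => κ (Function.invFun T x)) (Set.range T) := by
    refine LipschitzOnWith.of_le_add_mul _ fun x hx y hy => ?_
    have := hlip (Function.invFun T x) (Function.invFun T y)
    rwa [Function.invFun_eq hx, Function.invFun_eq hy] at this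
  obtain ⟨G, hG, hGf⟩ := hf.extend_real
  have hGT : ∀ q, G (T q) = κ q := fun q => by
    rw [← hGf ⟨q, rfl⟩]
    have hq : T (Function.invFun T (T q)) = T q := Function.invFun_eq ⟨q, rfl⟩
    have h1 := hlip (Function.invFun T (T q)) q
    have h2 := hlip q (Function.invFun T (T q))
    rw [hq, dist_self, mul_zero] at h1 h2
    exact le_antisymm (by linarith) (by linarith)
  have hTd : ∀ j, T (Finsupp.single j 1) = d j := fun j => by simp [T]
  have hκd : ∀ j, κ (Finsupp.single j 1) = k j := fun j => by simp [κ]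
  have hT : DenseRange T := hd.mono (by
    rintro _ ⟨j, rfl⟩
    exact ⟨_, hTd j⟩)
  have hGc := hG.continuous
  have hadd : ∀ x y, G (x + y) = G x + G y := fun x y =>
    hT.induction_on₂ (p := fun x y => G (x + y) = G x + G y)
      (isClosed_eq (by fun_prop) (by fun_prop))
      (fun q q' => by rw [← map_add, hGT, hGT, hGT, map_add]) x y
  have hG0 : G 0 = 0 := by
    have := hadd 0 0
    rw [add_zero] at this
    linarith
  obtain ⟨φ, hφ⟩ := exists_strongDual_eq (L := L.toNNReal) hadd fun x => by
    have := hG.dist_le_mul x 0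
    rwa [hG0, Real.dist_eq, dist_zero_right, sub_zero] at this
  have hpc : Continuous p := by
    refine LipschitzWith.continuous (K := L.toNNReal) (LipschitzWith.of_le_add_mul _ fun x y => ?_)
    have h1 := hp.1 y (x - y)
    rw [add_sub_cancel] at h1
    rw [dist_eq_norm]
    linarith [(le_abs_self _).trans (hL0 (x - y))]
  refine ⟨φ, fun j => ?_, fun h => ?_⟩
  · rw [hφ, ← hTd, hGT, hκd]
  · exact hT.induction_on (p := fun h => φ h ≤ p h) h
      (isClosed_le φ.continuous hpc) fun q => by rw [hφ, hGT]; exact hκT q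

theorem measurable_dirDeriv_param {S : Type*} [MeasurableSpace S] {p : S → E → ℝ} {d : S → E}
    {h : S → E} (hp : ∀ s, ConvexOn ℝ Set.univ (p s))
    (hm : ∀ c : ℝ, Measurable fun s => p s (d s + c • h s)) :
    Measurable fun s => dirDeriv (p s) (d s) (h s) := by
  have h0 : Measurable fun s => p s (d s) := by simpa using hm 0
  simp_rw [fun s => dirDeriv_eq_iInf_nat (hp s) (d s) (h s)]
  exact Measurable.iInf fun m => ((hm _).sub h0).div_const _

theorem measurable_iterDirDeriv_param {S : Type*} [MeasurableSpace S] {p : S → E → ℝ} {d : ℕ → E}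
    (hp : ∀ s, IsSublinear (p s)) (hm : ∀ h, Measurable fun s => p s h) (k : ℕ) (h : E) :
    Measurable fun s => iterDirDeriv d (p s) k h := by
  induction k generalizing h with
  | zero => exact hm h
  | succ k ih =>
    exact measurable_dirDeriv_param (fun s => ((hp s).iterDirDeriv k).convexOn) fun c => ih _

/-- Evaluation of functionals along a dense sequence. -/
noncomputable def evalDense (E : Type*) [NormedAddCommGroup E] [NormedSpace ℝ E]
    [TopologicalSpace.SeparableSpace E] (φ : StrongDual ℝ E) (j : ℕ) : ℝ :=
  φ (TopologicalSpace.denseSeq E j)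

variable [TopologicalSpace.SeparableSpace E]

/-- Lusin–Souslin: a continuous injection of the dual, Polish by separability, into a sequence
space. Norm-Borel measurability thereby reduces to measurability of evaluations. -/
theorem measurableEmbedding_evalDense [TopologicalSpace.SeparableSpace (StrongDual ℝ E)] :
    MeasurableEmbedding (evalDense E) := by
  have := UniformSpace.secondCountable_of_separable (StrongDual ℝ E)
  have hc : Continuous (evalDense E) := continuous_pi fun j =>
    (ContinuousLinearMap.apply ℝ ℝ (TopologicalSpace.denseSeq E j)).continuous
  refine hc.measurableEmbedding fun φ ψ h => ?_
  exact DFunLike.coe_injective ((TopologicalSpace.denseRange_denseSeq E).equalizer φ.continuous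
    ψ.continuous (funext fun j => congrFun h j))

theorem measurable_of_measurable_apply [TopologicalSpace.SeparableSpace (StrongDual ℝ E)]
    {S : Type*} [MeasurableSpace S] {g : S → StrongDual ℝ E}
    (hg : ∀ h, Measurable fun s => g s h) : Measurable g := by
  rw [← measurableEmbedding_evalDense.measurable_comp_iff]
  exact measurable_pi_iff.mpr fun j => hg _

variable [MeasurableSpace E] [BorelSpace E]

theorem measurable_dirDeriv_norm_sq {S : Type*} [MeasurableSpace S] {d h : S → E}
    (hd : Measurable d) (hh : Measurable h) :
    Measurable fun s => dirDeriv (fun z : E => ‖z‖ ^ 2) (d s) (h s) := by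
  have := UniformSpace.secondCountable_of_separable E
  exact measurable_dirDeriv_param (p := fun _ z => ‖z‖ ^ 2) (fun _ => convexOn_norm_sq) fun c =>
    (hd.add (hh.const_smul c)).norm.pow_const 2

theorem exists_isSubgradientSelection [TopologicalSpace.SeparableSpace (StrongDual ℝ E)] :
    ∃ g : E → StrongDual ℝ E, IsSubgradientSelection g := by
  have hs : ∀ x : E, IsSublinear (dirDeriv (fun z : E => ‖z‖ ^ 2) x) := fun x =>
    isSublinear_dirDeriv convexOn_norm_sq x
  choose g hg hgle using fun x : E => exists_strongDual_eq_iInf (hs x)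
    (dirDeriv_norm_sq_le x) (TopologicalSpace.denseRange_denseSeq E)
  refine ⟨g, measurable_of_measurable_apply fun h => ?_, fun x => ?_⟩
  · simp_rw [hg]
    exact Measurable.iInf fun k => measurable_iterDirDeriv_param hs
      (fun h => measurable_dirDeriv_norm_sq measurable_id measurable_const) k h
  · exact mem_subdifferential_iff.mpr fun h => (hgle x h).trans (dirDeriv_norm_sq_le_sub x h)

end Selection

/-! ### A selection satisfying the first-order condition. -/

section OptimalSelection

variable {E : Type*} [NormedAddCommGroup E] [NormedSpace ℝ E]

theorem quotient_norm_sq_le (z y : E) {t : ℝ} (ht : 0 < t) (ht1 : t ≤ 1) :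
    |(‖z + t • y‖ ^ 2 - ‖z‖ ^ 2) / t| ≤ 2 * ‖z‖ * ‖y‖ + ‖y‖ ^ 2 := by
  have h1 : ‖z + t • y‖ ≤ ‖z‖ + t * ‖y‖ := by
    refine (norm_add_le _ _).trans ?_
    rw [norm_smul, Real.norm_of_nonneg ht.le]
  have h2 : ‖z + t • y‖ ^ 2 ≤ (‖z‖ + t * ‖y‖) ^ 2 := pow_le_pow_left₀ (norm_nonneg _) h1 2
  have h3 : t * ‖y‖ ^ 2 ≤ 1 * ‖y‖ ^ 2 := by gcongr
  have h4 := dirDeriv_le (convexOn_norm_sq (E := E)) z y ht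
  have h5 := (abs_le.mp (abs_dirDeriv_norm_sq_le z y)).1
  rw [abs_le]
  constructor
  · nlinarith [sq_nonneg ‖y‖]
  · rw [div_le_iff₀ ht]
    nlinarith

variable [MeasurableSpace E] [BorelSpace E] [TopologicalSpace.SeparableSpace E]
  {Q : Measure E} [IsProbabilityMeasure Q]

omit [TopologicalSpace.SeparableSpace E] in
-- Minimality makes every integrated difference quotient nonnegative; dominated convergence passes
-- to the derivative.
theorem integral_dirDeriv_norm_sq_nonneg (hQ : Integrable (fun z => ‖z‖ ^ 2) Q)
    (hmin : ∀ y, ∫ z, ‖z‖ ^ 2 ∂Q ≤ ∫ z, ‖z + y‖ ^ 2 ∂Q) (y : E) :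
    0 ≤ ∫ z, dirDeriv (fun z : E => ‖z‖ ^ 2) z y ∂Q := by
  have hInt : ∀ y, Integrable (fun z => ‖z + y‖ ^ 2) Q := fun y => by
    simpa using integrable_norm_sub_sq (X := fun z : E => z) measurable_id hQ (-y)
  have hn : Integrable (fun z : E => ‖z‖) Q :=
    (hQ.add (integrable_const 1)).mono' measurable_norm.aestronglyMeasurable
      (ae_of_all _ fun z => by
        simp only [norm_norm, Pi.add_apply]
        nlinarith [sq_nonneg (‖z‖ - 1)])
  have ht := tendsto_integral_of_dominated_convergence
    (F := fun (m : ℕ) (z : E) => (‖z + (1 / ((m : ℝ) + 1)) • y‖ ^ 2 - ‖z‖ ^ 2) / (1 / ((m : ℝ) + 1)))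
    (f := fun z => dirDeriv (fun z : E => ‖z‖ ^ 2) z y) (μ := Q)
    (fun z => 2 * ‖z‖ * ‖y‖ + ‖y‖ ^ 2)
    (fun m => (((hInt _).sub hQ).div_const _).aestronglyMeasurable)
    (((hn.const_mul 2).mul_const _).add (integrable_const _))
    (fun m => ae_of_all _ fun z => quotient_norm_sq_le z y (by positivity) (by
      rw [div_le_one (by positivity)]
      linarith [m.cast_nonneg (α := ℝ)]))
    (ae_of_all _ fun z => tendsto_dirDeriv convexOn_norm_sq z y)
  refine ge_of_tendsto' ht fun m => ?_
  rw [integral_div, integral_sub (hInt _) hQ]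
  have := hmin ((1 / ((m : ℝ) + 1)) • y)
  exact div_nonneg (by linarith) (by positivity)

omit [IsProbabilityMeasure Q] in
theorem integrable_dirDeriv_norm_sq (hQ : Integrable (fun z => ‖z‖ ^ 2) Q) {Y : E → E}
    (hY : Measurable Y) (hY2 : MemLp Y 2 Q) :
    Integrable (fun z => dirDeriv (fun z : E => ‖z‖ ^ 2) z (Y z)) Q := by
  have hY2' : Integrable (fun z => ‖Y z‖ ^ 2) Q := hY2.integrable_norm_pow (by norm_num)
  refine (hQ.add hY2').mono' (measurable_dirDeriv_norm_sq measurable_id hY).aestronglyMeasurable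
    (ae_of_all _ fun z => (abs_dirDeriv_norm_sq_le z (Y z)).trans ?_)
  simp only [Pi.add_apply]
  nlinarith [sq_nonneg (‖z‖ - ‖Y z‖)]

/-- A linear functional on `L²(Q; E)` dominated by the integrated directional derivative and
vanishing on constants. -/
theorem exists_linear_le_integral_dirDeriv (hQ : Integrable (fun z => ‖z‖ ^ 2) Q)
    (hmin : ∀ y, ∫ z, ‖z‖ ^ 2 ∂Q ≤ ∫ z, ‖z + y‖ ^ 2 ∂Q) :
    ∃ ℓ : Lp E 2 Q →ₗ[ℝ] ℝ, (∀ y : E, ℓ (Lp.const 2 Q y) = 0) ∧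
      ∀ Y, ℓ Y ≤ ∫ z, dirDeriv (fun z : E => ‖z‖ ^ 2) z (Y z) ∂Q := by
  have hInt : ∀ Y : Lp E 2 Q,
      Integrable (fun z => dirDeriv (fun z : E => ‖z‖ ^ 2) z (Y z)) Q := fun Y =>
    integrable_dirDeriv_norm_sq hQ (Lp.stronglyMeasurable Y).measurable (Lp.memLp Y)
  -- Hahn–Banach from the zero functional on constant functions. Domination there is exactly the
  -- nonnegativity supplied by minimality.
  obtain ⟨ℓ, h1, h2⟩ := exists_extension_of_le_sublinear
    ⟨LinearMap.range (Lp.constₗ 2 Q ℝ : E →ₗ[ℝ] Lp E 2 Q), 0⟩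
    (fun Y : Lp E 2 Q => ∫ z, dirDeriv (fun z : E => ‖z‖ ^ 2) z (Y z) ∂Q)
    (fun c hc Y => by
      rw [← integral_const_mul]
      refine integral_congr_ae ?_
      filter_upwards [Lp.coeFn_smul c Y] with z hz
      rw [hz, Pi.smul_apply, (isSublinear_dirDeriv convexOn_norm_sq z).2 c hc])
    (fun Y Z => by
      rw [← integral_add (hInt Y) (hInt Z)]
      refine integral_mono_ae (hInt _) ((hInt Y).add (hInt Z)) ?_
      filter_upwards [Lp.coeFn_add Y Z] with z hz
      rw [hz]
      exact (isSublinear_dirDeriv convexOn_norm_sq z).1 _ _)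
    (by
      rintro ⟨_, y, rfl⟩
      refine (integral_dirDeriv_norm_sq_nonneg hQ hmin y).trans_eq (integral_congr_ae ?_)
      filter_upwards [Lp.coeFn_const (p := 2) (μ := Q) y] with z hz
      simp only [Lp.constₗ_apply]
      rw [hz]
      rfl)
  exact ⟨ℓ, fun y => h1 ⟨_, y, rfl⟩, h2⟩

omit [NormedSpace ℝ E] [TopologicalSpace.SeparableSpace E] in
-- By Cauchy–Schwarz the domination makes `ℓ` bounded on `L²`; Riesz representation then supplies
-- the density.
theorem exists_density (hQ : Integrable (fun z => ‖z‖ ^ 2) Q) (ℓ : Lp ℝ 2 Q →ₗ[ℝ] ℝ) {L : ℝ}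
    (hℓ : ∀ φ, ℓ φ ≤ L * ∫ z, ‖z‖ * |φ z| ∂Q) (hL : 0 ≤ L) :
    ∃ k : E → ℝ, Measurable k ∧ Integrable k Q ∧ ∀ B (hB : MeasurableSet B),
      ∫ z in B, k z ∂Q = ℓ (indicatorConstLp 2 hB (measure_ne_top Q B) (1 : ℝ)) := by
  have hZ : MemLp (fun z : E => ‖z‖) 2 Q :=
    (memLp_two_iff_integrable_sq measurable_norm.aestronglyMeasurable).mpr hQ
  have hb : ∀ φ : Lp ℝ 2 Q, ∫ z, ‖z‖ * |φ z| ∂Q ≤ ‖hZ.toLp _‖ * ‖φ‖ := fun φ => by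
    have h1 := real_inner_le_norm (hZ.toLp _) |φ|
    rw [norm_abs_eq_norm, L2.inner_def] at h1
    refine (integral_congr_ae ?_).trans_le h1
    filter_upwards [hZ.coeFn_toLp, Lp.coeFn_abs φ] with z h2 h3
    rw [h2, h3]
    simp [mul_comm]
  have hb' : ∀ φ, ℓ φ ≤ L * ‖hZ.toLp _‖ * ‖φ‖ := fun φ => by
    rw [mul_assoc]
    exact (hℓ φ).trans (mul_le_mul_of_nonneg_left (hb φ) hL)
  let Λ : StrongDual ℝ (Lp ℝ 2 Q) := ℓ.mkContinuous (L * ‖hZ.toLp _‖) fun φ => by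
    have h1 := hb' (-φ)
    rw [map_neg, norm_neg] at h1
    rw [Real.norm_eq_abs, abs_le]
    constructor <;> linarith [hb' φ]
  let k : Lp ℝ 2 Q := (InnerProductSpace.toDual ℝ (Lp ℝ 2 Q)).symm Λ
  refine ⟨k, (Lp.stronglyMeasurable k).measurable, (Lp.memLp k).integrable (by norm_num),
    fun B hB => ?_⟩
  rw [← L2.inner_indicatorConstLp_one (𝕜 := ℝ) hB (measure_ne_top Q B) k, real_inner_comm,
    InnerProductSpace.toDual_symm_apply]
  rfl

omit [IsProbabilityMeasure Q] in
theorem exists_selection_of_dominated (hdual : TopologicalSpace.SeparableSpace (StrongDual ℝ E))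
    {k : ℕ → E → ℝ} (hk : ∀ j, Measurable (k j))
    (hdom : ∀ q : ℕ →₀ ℤ, ∀ᵐ z ∂Q, (q.sum fun j c => (c : ℝ) * k j z) ≤
      dirDeriv (fun z : E => ‖z‖ ^ 2) z
        (q.sum fun j c => (c : ℝ) • TopologicalSpace.denseSeq E j)) :
    ∃ g : E → StrongDual ℝ E, IsSubgradientSelection g ∧
      ∀ᵐ z ∂Q, ∀ j, g z (TopologicalSpace.denseSeq E j) = k j z := by
  obtain ⟨g₀, hg₀, hg₀s⟩ := exists_isSubgradientSelection (E := E)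
  -- `r` is a measurable left inverse of evaluation along the dense sequence, so reconstructing a
  -- functional from its values is measurable. On an exceptional null set an arbitrary selection
  -- `g₀` is used.
  obtain ⟨r, hr, hre⟩ := measurableEmbedding_evalDense (E := E).exists_measurable_extend
    measurable_id (fun _ => ⟨0⟩)
  have hae : ∀ᵐ z ∂Q, (∀ j, r (fun j => k j z) (TopologicalSpace.denseSeq E j) = k j z) ∧
      r (fun j => k j z) ∈ subdifferential (fun z : E => ‖z‖ ^ 2) z := by
    filter_upwards [ae_all_iff.mpr hdom] with z hz
    obtain ⟨φ, h1, h2⟩ := exists_strongDual_extension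
      (isSublinear_dirDeriv convexOn_norm_sq z) (dirDeriv_norm_sq_le z)
      (TopologicalSpace.denseRange_denseSeq E) hz
    have h3 : r (fun j => k j z) = φ := by
      have h4 : (fun j => k j z) = evalDense E φ := funext fun j => (h1 j).symm
      rw [h4]
      exact congrFun hre φ
    rw [h3]
    exact ⟨h1, mem_subdifferential_iff.mpr fun h => (h2 h).trans (dirDeriv_norm_sq_le_sub z h)⟩
  obtain ⟨N, hNsub, hN, hN0⟩ := exists_measurable_superset_of_null (ae_iff.mp hae)
  classical
  refine ⟨N.piecewise g₀ fun z => r fun j => k j z,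
    ⟨hg₀.piecewise hN (hr.comp (measurable_pi_iff.mpr hk)), fun z => ?_⟩, ?_⟩
  · by_cases hz : z ∈ N
    · rw [Set.piecewise_eq_of_mem _ _ _ hz]
      exact hg₀s z
    · rw [Set.piecewise_eq_of_notMem _ _ _ hz]
      exact (not_not.mp fun h => hz (hNsub h)).2
  · filter_upwards [compl_mem_ae_iff.mpr hN0] with z hz
    rw [Set.piecewise_eq_of_notMem _ _ _ hz]
    exact (not_not.mp fun h => hz (hNsub h)).1

omit [BorelSpace E] [TopologicalSpace.SeparableSpace E] in
theorem integrable_selection_apply (hQ : Integrable (fun z => ‖z‖ ^ 2) Q)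
    {g : E → StrongDual ℝ E} (hg : IsSubgradientSelection g) (y : E) :
    Integrable (fun z => g z y) Q := by
  refine ((hQ.add (integrable_const 1)).mul_const ‖y‖).mono'
    ((ContinuousLinearMap.apply ℝ ℝ y).continuous.measurable.comp hg.1).aestronglyMeasurable
    (ae_of_all _ fun z => ((g z).le_opNorm y).trans ?_)
  have := norm_subgradient_le (hg.2 z)
  simp only [Pi.add_apply]
  gcongr
  nlinarith [sq_nonneg (‖z‖ - 1)]

theorem exists_selection_integral_eq_zero
    (hdual : TopologicalSpace.SeparableSpace (StrongDual ℝ E))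
    (hQ : Integrable (fun z => ‖z‖ ^ 2) Q)
    (hmin : ∀ y, ∫ z, ‖z‖ ^ 2 ∂Q ≤ ∫ z, ‖z + y‖ ^ 2 ∂Q) :
    ∃ g : E → StrongDual ℝ E, IsSubgradientSelection g ∧ ∀ y, ∫ z, g z y ∂Q = 0 := by
  obtain ⟨ℓ, hℓ0, hℓ⟩ := exists_linear_le_integral_dirDeriv hQ hmin
  let B : E →L[ℝ] ℝ →L[ℝ] E := (ContinuousLinearMap.lsmul ℝ ℝ).flip
  let J : E →ₗ[ℝ] Lp ℝ 2 Q →ₗ[ℝ] Lp E 2 Q := B.compLpₗ₂ 2 Q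
  have hJ : ∀ a φ, ∀ᵐ z ∂Q, J a φ z = φ z • a := fun a φ => (B a).coeFn_compLp φ
  have hdens : ∀ a : E, ∃ k : E → ℝ, Measurable k ∧ Integrable k Q ∧ ∀ S (hS : MeasurableSet S),
      ∫ z in S, k z ∂Q = ℓ (J a (indicatorConstLp 2 hS (measure_ne_top Q S) (1 : ℝ))) := fun a =>
    exists_density hQ (ℓ.comp (J a)) (L := 2 * ‖a‖) (fun φ => by
      refine (hℓ (J a φ)).trans ?_
      rw [← integral_const_mul]
      have hi : Integrable (fun z => ‖z‖ * |φ z|) Q := by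
        have h2 : Integrable (fun z => (φ z) ^ 2) Q := (Lp.memLp φ).integrable_sq
        refine (hQ.add h2).mono' (measurable_norm.aestronglyMeasurable.mul
          (Lp.aestronglyMeasurable φ).norm) (ae_of_all _ fun z => ?_)
        simp only [norm_mul, Real.norm_eq_abs, abs_abs, abs_norm, Pi.add_apply]
        nlinarith [sq_nonneg (‖z‖ - |φ z|), sq_abs (φ z), norm_nonneg z, abs_nonneg (φ z),
          mul_nonneg (norm_nonneg z) (abs_nonneg (φ z))]
      refine integral_mono_ae (integrable_dirDeriv_norm_sq hQ
        (Lp.stronglyMeasurable _).measurable (Lp.memLp _)) (hi.const_mul _) ?_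
      filter_upwards [hJ a φ] with z hz
      rw [hz]
      refine (dirDeriv_norm_sq_le z _).trans_eq ?_
      rw [norm_smul, Real.norm_eq_abs]
      ring) (by positivity)
  -- `k j` is the density of `S ↦ ℓ (1_S • d_j)`. Testing integer combinations on all measurable
  -- sets turns the integrated domination into an almost sure one.
  choose k hkm hki hk using fun j => hdens (TopologicalSpace.denseSeq E j)
  obtain ⟨g, hg, hgk⟩ := exists_selection_of_dominated (Q := Q) hdual hkm fun q => by
    set a : E := q.sum fun j c => (c : ℝ) • TopologicalSpace.denseSeq E j with ha
    have hki' : Integrable (fun z => q.sum fun j c => (c : ℝ) * k j z) Q :=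
      integrable_finsetSum _ fun j _ => (hki j).const_mul _
    have hpi : Integrable (fun z => dirDeriv (fun z : E => ‖z‖ ^ 2) z a) Q :=
      integrable_dirDeriv_norm_sq hQ measurable_const (memLp_const a)
    refine ae_le_of_forall_setIntegral_le hki' hpi fun S hS _ => ?_
    have h1 : ∫ z in S, (q.sum fun j c => (c : ℝ) * k j z) ∂Q =
        ℓ (J a (indicatorConstLp 2 hS (measure_ne_top Q S) (1 : ℝ))) := by
      rw [ha]
      simp only [Finsupp.sum]
      rw [integral_finsetSum _ fun j _ => ((hki j).const_mul _).integrableOn, map_sum,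
        LinearMap.sum_apply, map_sum]
      refine Finset.sum_congr rfl fun j _ => ?_
      rw [integral_const_mul, hk j S hS, map_smul, LinearMap.smul_apply, map_smul, smul_eq_mul]
    rw [h1, ← integral_indicator hS]
    refine (hℓ _).trans_eq (integral_congr_ae ?_)
    filter_upwards [hJ a (indicatorConstLp 2 hS (measure_ne_top Q S) (1 : ℝ)),
      indicatorConstLp_coeFn (p := 2) (hs := hS) (hμs := measure_ne_top Q S) (c := (1 : ℝ))]
      with z h2 h3
    rw [h2, h3]
    by_cases hz : z ∈ S
    · simp [hz]
    · simp [hz, (isSublinear_dirDeriv convexOn_norm_sq z).map_zero]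
  refine ⟨g, hg, fun y => ?_⟩
  -- On the whole space the density integrates to `ℓ` of a constant, which vanishes.
  have hD : ∀ j, ∫ z, g z (TopologicalSpace.denseSeq E j) ∂Q = 0 := fun j => by
    have h1 : ∫ z, g z (TopologicalSpace.denseSeq E j) ∂Q = ∫ z in Set.univ, k j z ∂Q := by
      rw [setIntegral_univ]
      exact integral_congr_ae (hgk.mono fun z hz => hz j)
    rw [h1, hk j _ MeasurableSet.univ, ← hℓ0 (TopologicalSpace.denseSeq E j)]
    congr 1
    refine Lp.ext ?_
    filter_upwards [hJ (TopologicalSpace.denseSeq E j)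
        (indicatorConstLp 2 MeasurableSet.univ (measure_ne_top Q _) (1 : ℝ)),
      indicatorConstLp_coeFn (p := 2) (hs := MeasurableSet.univ) (hμs := measure_ne_top Q _)
        (c := (1 : ℝ)),
      Lp.coeFn_const (p := 2) (μ := Q) (TopologicalSpace.denseSeq E j)] with z h2 h3 h4
    rw [h2, h3, h4]
    simp
  have hgi := integrable_selection_apply hQ hg
  obtain ⟨φ, hφ⟩ := exists_strongDual_eq (E := E) (f := fun y => ∫ z, g z y ∂Q)
    (L := ∫ z, (‖z‖ ^ 2 + 1) ∂Q) (fun x y => by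
      simp_rw [map_add]
      exact integral_add (hgi x) (hgi y)) (fun y => by
      rw [← integral_mul_const]
      refine (abs_integral_le_integral_abs).trans (integral_mono (hgi y).abs
        ((hQ.add (integrable_const 1)).mul_const ‖y‖) fun z => ((g z).le_opNorm y).trans ?_)
      have := norm_subgradient_le (hg.2 z)
      gcongr
      nlinarith [sq_nonneg (‖z‖ - 1)])
  rw [← hφ]
  exact (TopologicalSpace.denseRange_denseSeq E).induction_on (p := fun y => φ y = 0) y
    (isClosed_eq φ.continuous continuous_const) fun j => (hφ _).trans (hD j)

variable {Ω : Type*} [MeasurableSpace Ω] {P : Measure Ω} [IsProbabilityMeasure P] {X : Ω → E}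

theorem exists_selection_firstOrderCondition
    (hdual : TopologicalSpace.SeparableSpace (StrongDual ℝ E)) (hX : Measurable X)
    (hX2 : Integrable (fun ω => ‖X ω‖ ^ 2) P) {μ : E} (hμ : IsFrechetMean P X μ) :
    ∃ g : E → StrongDual ℝ E, IsSubgradientSelection g ∧ FirstOrderCondition P X μ g := by
  have hXμ : Measurable fun ω => X ω - μ := hX.sub_const μ
  have : IsProbabilityMeasure (P.map fun ω => X ω - μ) :=
    Measure.isProbabilityMeasure_map hXμ.aemeasurable
  have hmeas : ∀ y : E, AEStronglyMeasurable (fun z => ‖z + y‖ ^ 2) (P.map fun ω => X ω - μ) :=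
    fun y => ((measurable_id.add_const y).norm.pow_const 2).aestronglyMeasurable
  obtain ⟨g, hg, hg0⟩ := exists_selection_integral_eq_zero (Q := P.map fun ω => X ω - μ) hdual
    (by
      have := hmeas 0
      simp only [add_zero] at this
      exact (integrable_map_measure this hXμ.aemeasurable).mpr
        (integrable_norm_sub_sq hX hX2 μ))
    (fun y => by
      have h0 := hmeas 0
      simp only [add_zero] at h0
      rw [integral_map hXμ.aemeasurable h0, integral_map hXμ.aemeasurable (hmeas y)]
      have := hμ (μ - y)
      simp only [dist_eq_norm] at this
      simpa only [sub_sub_eq_add_sub, sub_add_eq_add_sub] using this)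
  refine ⟨g, hg, fun y => ?_⟩
  rw [← hg0 y, integral_map hXμ.aemeasurable]
  exact ((ContinuousLinearMap.apply ℝ ℝ y).continuous.measurable.comp hg.1).aestronglyMeasurable

theorem firstOrderCondition_of_subsingleton
    (hdual : TopologicalSpace.SeparableSpace (StrongDual ℝ E)) (hX : Measurable X)
    (hX2 : Integrable (fun ω => ‖X ω‖ ^ 2) P) {μ : E} (hμ : IsFrechetMean P X μ)
    (hs : ∀ᵐ ω ∂P, (subdifferential (fun z : E => ‖z‖ ^ 2) (X ω - μ)).Subsingleton)
    {g : E → StrongDual ℝ E} (hg : IsSubgradientSelection g) : FirstOrderCondition P X μ g := by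
  obtain ⟨g', hg', hfoc⟩ := exists_selection_firstOrderCondition hdual hX hX2 hμ
  intro y
  rw [← hfoc y]
  refine integral_congr_ae ?_
  filter_upwards [hs] with ω hω
  rw [hω (hg.2 _) (hg'.2 _)]

end OptimalSelection

/-! ### Moment conditions for the truncation level. -/

section Moments

variable {S : Type*} [MeasurableSpace S] {Q : Measure S} [IsProbabilityMeasure Q]

theorem clip_mul {M r : ℝ} (hr : 0 ≤ r) (y : ℝ) : clip (M * r) (y * r) = clip M y * r := by
  unfold clip
  rw [max_mul_of_nonneg _ _ hr, min_mul_of_nonneg _ _ hr, neg_mul]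

theorem abs_sub_clip_le {M p : ℝ} (hM : 0 < M) (hp : 1 ≤ p) (y : ℝ) :
    |y - clip M y| ≤ M * (|y| / M) ^ p := by
  rcases le_or_gt |y| M with h | h
  · rw [clip_eq_self h, sub_self, abs_zero]
    positivity
  · have h1 : |y - clip M y| ≤ |y| := by
      unfold clip
      rcases le_total y M with h2 | h2 <;> rcases le_total (-M) y with h3 | h3 <;>
        simp only [min_eq_left, min_eq_right, h2] <;>
        rcases abs_cases y with ⟨h4, h5⟩ | ⟨h4, h5⟩ <;>
        rw [abs_le] <;> constructor <;>
        first
          | (rw [max_eq_left (by linarith)]; linarith)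
          | (rw [max_eq_right (by linarith)]; linarith)
    have h2 : |y| / M ≤ (|y| / M) ^ p := by
      simpa using Real.rpow_le_rpow_of_exponent_le ((one_le_div hM).mpr h.le) hp
    calc |y - clip M y| ≤ M * (|y| / M) := by rwa [mul_div_cancel₀ _ hM.ne']
      _ ≤ _ := by gcongr

/-- The assumption says `ν / (M/2) ≤ (1/80)(s/n)^(1/p)`, and `(1/80)^p ≤ 1/80` since `p ≥ 1`. This
explains `160 = 2 * 80`. -/
theorem mul_div_rpow_le {n s ν M p : ℝ} (hn : 0 < n) (hs : 0 < s) (hν : 0 ≤ ν) (hM : 0 < M)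
    (hp : 1 ≤ p) (h : 160 * ν * (n / s) ^ (1 / p) ≤ M) :
    80 * (n * (ν / (M / 2)) ^ p) ≤ s := by
  have hp0 : 0 < p := by linarith
  have h1 : ν / (M / 2) ≤ 1 / 80 * (s / n) ^ (1 / p) := by
    rw [div_le_iff₀ (by positivity)]
    have h2 : (s / n) ^ (1 / p) * (n / s) ^ (1 / p) = 1 := by
      rw [← Real.mul_rpow (by positivity) (by positivity), div_mul_div_cancel₀ hn.ne',
        div_self hs.ne', Real.one_rpow]
    have h3 := mul_le_mul_of_nonneg_left h (by positivity : 0 ≤ (s / n) ^ (1 / p))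
    calc ν = 1 / 160 * ((s / n) ^ (1 / p) * (160 * ν * (n / s) ^ (1 / p))) := by
            linear_combination (-ν) * h2
      _ ≤ 1 / 160 * ((s / n) ^ (1 / p) * M) := by gcongr
      _ = _ := by ring
  have h4 : (ν / (M / 2)) ^ p ≤ 1 / 80 * (s / n) := by
    refine (Real.rpow_le_rpow (by positivity) h1 hp0.le).trans ?_
    rw [Real.mul_rpow (by norm_num) (by positivity), ← Real.rpow_mul (by positivity),
      one_div_mul_cancel hp0.ne', Real.rpow_one]
    gcongr
    exact Real.rpow_le_self_of_le_one (by norm_num) (by norm_num) hp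
  calc 80 * (n * (ν / (M / 2)) ^ p) ≤ 80 * (n * (1 / 80 * (s / n))) := by gcongr
    _ = s := by field_simp

omit [IsProbabilityMeasure Q] in
theorem tail_le {f : S → ℝ} {p ν M n s : ℝ} (hp : 1 ≤ p) (hν : 0 ≤ ν)
    (hfp : Integrable (fun w => |f w| ^ p) Q) (hfν : ∫ w, |f w| ^ p ∂Q ≤ ν ^ p)
    (hn : 0 < n) (hs : 0 < s) (hM : 0 < M) (h : 160 * ν * (n / s) ^ (1 / p) ≤ M) :
    80 * (n * Q.real {w | M / 2 ≤ |f w|}) ≤ s := by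
  refine le_trans ?_ (mul_div_rpow_le hn hs hν hM hp h)
  gcongr
  have h1 := mul_meas_ge_le_integral_of_nonneg (μ := Q)
    (ae_of_all _ fun w => Real.rpow_nonneg (abs_nonneg (f w)) p) hfp ((M / 2) ^ p)
  have h2 : {w | (M / 2) ^ p ≤ |f w| ^ p} = {w | M / 2 ≤ |f w|} := by
    ext w
    exact Real.rpow_le_rpow_iff (by positivity) (abs_nonneg _) (by linarith)
  rw [h2] at h1
  rw [Real.div_rpow hν (by positivity), le_div_iff₀ (by positivity)]
  linarith

/-- As `f` is centred, the mean of its clip is minus the mean of the clipped-off part, which is at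
most `M (|f| / M)^p` pointwise. -/
theorem bias_le {f : S → ℝ} (hf : Measurable f) {p ν M n s : ℝ} (hp : 1 ≤ p) (hν : 0 ≤ ν)
    (hfi : Integrable f Q) (hf0 : ∫ w, f w ∂Q = 0)
    (hfp : Integrable (fun w => |f w| ^ p) Q) (hfν : ∫ w, |f w| ^ p ∂Q ≤ ν ^ p)
    (hn : 0 < n) (hs : 0 < s) (hM : 0 < M) (h : 160 * ν * (n / s) ^ (1 / p) ≤ M) :
    n * |∫ w, clip M (f w) ∂Q| ≤ s * M := by
  have hci : Integrable (fun w => clip M (f w)) Q :=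
    integrable_of_measurable_of_abs_le ((measurable_clip M).comp hf) fun w => abs_clip_le hM.le _
  have h1 : |∫ w, clip M (f w) ∂Q| ≤ M * (ν / M) ^ p := by
    have h2 : ∫ w, clip M (f w) ∂Q = -∫ w, (f w - clip M (f w)) ∂Q := by
      rw [integral_sub hfi hci, hf0]
      ring
    rw [h2, abs_neg]
    calc |∫ w, (f w - clip M (f w)) ∂Q| ≤ ∫ w, |f w - clip M (f w)| ∂Q :=
          abs_integral_le_integral_abs
      _ ≤ ∫ w, M * (|f w| ^ p / M ^ p) ∂Q := by
          refine integral_mono (hfi.sub hci).abs ((hfp.div_const _).const_mul _) fun w => ?_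
          have := abs_sub_clip_le hM hp (f w)
          rwa [Real.div_rpow (abs_nonneg _) hM.le] at this
      _ = M * ((∫ w, |f w| ^ p ∂Q) / M ^ p) := by rw [integral_const_mul, integral_div]
      _ ≤ M * (ν ^ p / M ^ p) := by gcongr
      _ = _ := by rw [Real.div_rpow hν hM.le]
  have h2 := mul_div_rpow_le hn hs hν hM hp h
  have h3 : (ν / M) ^ p ≤ (ν / (M / 2)) ^ p := by
    gcongr
    linarith
  calc n * |∫ w, clip M (f w) ∂Q| ≤ n * (M * (ν / (M / 2)) ^ p) := by
        gcongr
        exact h1.trans (by gcongr)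
    _ = (n * (ν / (M / 2)) ^ p) * M := by ring
    _ ≤ s * M := by
        gcongr
        have : 0 ≤ n * (ν / (M / 2)) ^ p := by positivity
        linarith

end Moments

/-! ### The process of subgradients indexed by the unit sphere. -/

section SubgradientProcess

variable {E : Type*} [NormedAddCommGroup E] [NormedSpace ℝ E] [MeasurableSpace E] [BorelSpace E]
  {Q : Measure E} [IsProbabilityMeasure Q] {g : E → StrongDual ℝ E} {n : ℕ}

omit [BorelSpace E] in
theorem IsSubgradientSelection.measurable_apply (hg : IsSubgradientSelection g) (v : E) :
    Measurable fun z => g z v :=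
  (ContinuousLinearMap.apply ℝ ℝ v).continuous.measurable.comp hg.1

omit [BorelSpace E] in
theorem IsSubgradientSelection.norm_le (hg : IsSubgradientSelection g) (z : E) :
    ‖g z‖ ≤ 2 * ‖z‖ := norm_subgradient_le (hg.2 z)

omit [BorelSpace E] in
-- The supremum over directions is at most the dual norm of the sign sum, to which type 2 applies.
-- The form `(A²/ρ + ρ)/2` replaces a square root, so that integrating needs only second moments.
theorem signAvg_iSup_le {K ρ : ℝ} (hρ : 0 < ρ) (hK0 : 0 ≤ K)
    (hK : ∀ a b : StrongDual ℝ E, ‖a + b‖ ^ 2 + ‖a - b‖ ^ 2 ≤ 2 * (‖a‖ ^ 2 + K * ‖b‖ ^ 2))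
    (hg : IsSubgradientSelection g) {ι : Type*} [Finite ι] [Nonempty ι] {v : ι → E}
    (hv : ∀ j, ‖v j‖ ≤ 1) (x : Fin n → E) :
    (signAvg fun ε => ⨆ j, ∑ i, sgn (ε i) * g (x i) (v j)) ≤
      ((∑ i, 4 * K * ‖x i‖ ^ 2) / ρ + ρ) / 2 := by
  have h1 : ∀ ε : Fin n → Bool, ⨆ j, ∑ i, sgn (ε i) * g (x i) (v j) ≤
      ‖∑ i, sgn (ε i) • g (x i)‖ := fun ε => ciSup_le fun j => by
    have h2 := ContinuousLinearMap.le_opNorm (∑ i, sgn (ε i) • g (x i)) (v j)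
    have h3 : (∑ i, sgn (ε i) • g (x i)) (v j) = ∑ i, sgn (ε i) * g (x i) (v j) := by
      simp
    rw [h3] at h2
    refine (le_abs_self _).trans (h2.trans ?_)
    exact mul_le_of_le_one_right (norm_nonneg _) (hv j)
  have h4 : signAvg (fun ε : Fin n → Bool => ‖∑ i, sgn (ε i) • g (x i)‖) ^ 2 ≤
      ∑ i, 4 * K * ‖x i‖ ^ 2 := by
    refine (signAvg_sq_le _).trans ?_
    have h5 := signAvg_norm_sq_le hK (fun i => g (x i)) 0
    simp only [zero_add, norm_zero] at h5
    refine h5.trans ?_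
    rw [Finset.mul_sum, zero_pow two_ne_zero, zero_add]
    refine Finset.sum_le_sum fun i _ => ?_
    have := pow_le_pow_left₀ (norm_nonneg _) (hg.norm_le (x i)) 2
    nlinarith
  refine (signAvg_mono h1).trans ?_
  set A := signAvg (fun ε : Fin n → Bool => ‖∑ i, sgn (ε i) • g (x i)‖)
  rw [le_div_iff₀ two_pos, ← sub_le_iff_le_add, le_div_iff₀ hρ]
  nlinarith [sq_nonneg (A - ρ)]

omit [BorelSpace E] in
theorem integrable_signAvg_iSup (hQ : Integrable (fun z => ‖z‖ ^ 2) Q)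
    (hg : IsSubgradientSelection g) {ι : Type*} [Finite ι] [Nonempty ι] (v : ι → E) :
    Integrable (fun x : Fin n → E => signAvg fun ε => ⨆ j, ∑ i, sgn (ε i) * g (x i) (v j))
      (iidMeasure Q n) := by
  refine integrable_signAvg fun ε => ?_
  have hi : ∀ j, Integrable (fun x : Fin n → E => ∑ i, sgn (ε i) * g (x i) (v j))
      (iidMeasure Q n) := fun j => integrable_finsetSum _ fun i _ =>
    (integrable_iid_eval (integrable_selection_apply hQ hg (v j)) i).const_mul _
  have := Fintype.ofFinite ι
  refine (integrable_finsetSum Finset.univ fun j _ => (hi j).abs).mono'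
    (AEMeasurable.aestronglyMeasurable (AEMeasurable.iSup fun j => (hi j).aemeasurable))
    (ae_of_all _ fun x => ?_)
  refine abs_iSup_le_of_finite fun j => ?_
  exact Finset.single_le_sum (f := fun j => |∑ i, sgn (ε i) * g (x i) (v j)|)
    (fun j _ => abs_nonneg _) (Finset.mem_univ j)

theorem integral_signAvg_iSup_le {K ρ : ℝ} (hρ : 0 < ρ) (hK0 : 0 ≤ K)
    (hK : ∀ a b : StrongDual ℝ E, ‖a + b‖ ^ 2 + ‖a - b‖ ^ 2 ≤ 2 * (‖a‖ ^ 2 + K * ‖b‖ ^ 2))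
    (hQ : Integrable (fun z => ‖z‖ ^ 2) Q) (hρV : 4 * K * n * ∫ z, ‖z‖ ^ 2 ∂Q ≤ ρ ^ 2)
    (hg : IsSubgradientSelection g) {ι : Type*} [Finite ι] [Nonempty ι] {v : ι → E}
    (hv : ∀ j, ‖v j‖ ≤ 1) :
    ∫ x : Fin n → E, (signAvg fun ε => ⨆ j, ∑ i, sgn (ε i) * g (x i) (v j)) ∂(iidMeasure Q n) ≤
      ρ := by
  have hi : ∀ i : Fin n, Integrable (fun x : Fin n → E => 4 * K * ‖x i‖ ^ 2) (iidMeasure Q n) :=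
    fun i => (integrable_iid_eval hQ i).const_mul _
  have hs := integrable_finsetSum Finset.univ fun i _ => hi i
  refine (integral_mono (integrable_signAvg_iSup hQ hg v)
    (((hs.div_const ρ).add (integrable_const ρ)).div_const 2)
    fun x => signAvg_iSup_le hρ hK0 hK hg hv x).trans ?_
  have h1 : ∫ x : Fin n → E, ((∑ i, 4 * K * ‖x i‖ ^ 2) / ρ + ρ) / 2 ∂(iidMeasure Q n) =
      ((n * (4 * K * ∫ z, ‖z‖ ^ 2 ∂Q)) / ρ + ρ) / 2 := by
    rw [integral_div, integral_add (hs.div_const ρ) (integrable_const ρ), integral_div,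
      integral_finsetSum _ fun i _ => hi i]
    simp_rw [integral_const_mul,
      fun i : Fin n => integral_iid_eval (Q := Q) (measurable_norm.pow_const 2 :
        Measurable fun z : E => ‖z‖ ^ 2) i]
    simp
  refine h1.trans_le ?_
  have h2 : (n * (4 * K * ∫ z, ‖z‖ ^ 2 ∂Q)) / ρ ≤ ρ := by
    rw [div_le_iff₀ hρ]
    nlinarith
  linarith

/-- The samples on which some direction from `D` has more than `s` large values or a large sum of
clipped values. -/
def badSamples (g : E → StrongDual ℝ E) (n : ℕ) (D : Set E) (s M B : ℝ) : Set (Fin n → E) :=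
  {x | ∃ v ∈ D, s < ((Finset.univ.filter fun i => M < |g (x i) v|).card : ℝ) ∨
    B < ∑ i, clip M (g (x i) v)}

omit [BorelSpace E] in
theorem measurableSet_badSamples (hg : IsSubgradientSelection g) {D : Set E} (hD : D.Countable)
    (s M B : ℝ) : MeasurableSet (badSamples g n D s M B) := by
  have : badSamples g n D s M B = ⋃ v ∈ D,
      ({x | s < ((Finset.univ.filter fun i => M < |g (x i) v|).card : ℝ)} ∪
        {x | B < ∑ i, clip M (g (x i) v)}) := by
    ext x
    simp [badSamples]
  rw [this]
  have hm : ∀ v (i : Fin n), Measurable fun x : Fin n → E => g (x i) v := fun v i =>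
    (hg.measurable_apply v).comp (measurable_pi_apply i)
  refine MeasurableSet.biUnion hD fun v _ => MeasurableSet.union ?_ ?_
  · have h1 : ∀ x : Fin n → E, ((Finset.univ.filter fun i => M < |g (x i) v|).card : ℝ) =
        ∑ i, Set.indicator {x : Fin n → E | M < |g (x i) v|} 1 x := fun x => by
      rw [Finset.card_filter]
      push_cast
      exact Finset.sum_congr rfl fun i _ => by simp [Set.indicator_apply]
    simp_rw [h1]
    exact measurableSet_lt measurable_const (Finset.measurable_sum _ fun i _ =>
      measurable_one.indicator (measurableSet_lt measurable_const
        ((continuous_abs.measurable).comp (hm v i))))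
  · exact measurableSet_lt measurable_const (Finset.measurable_sum _ fun i _ =>
      (measurable_clip M).comp (hm v i))

omit [MeasurableSpace E] [BorelSpace E] in
-- Both defining conditions are strict, hence persist for directions near `v`. Countably many
-- directions therefore control the sphere, and the bad event is measurable.
theorem notMem_badSamples_of_dense {D D' : Set E} (hD : D' ⊆ closure D) {s M B : ℝ}
    {x : Fin n → E} (hx : x ∉ badSamples g n D s M B) : x ∉ badSamples g n D' s M B := by
  rintro ⟨v, hv, h⟩
  have hopen : ∀ᶠ w in nhds v, s < ((Finset.univ.filter fun i => M < |g (x i) w|).card : ℝ) ∨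
      B < ∑ i, clip M (g (x i) w) := by
    rcases h with h | h
    · have h1 : ∀ᶠ w in nhds v, ∀ i, M < |g (x i) v| → M < |g (x i) w| := by
        refine Filter.eventually_all.mpr fun i => ?_
        by_cases hi : M < |g (x i) v|
        · exact Filter.Eventually.mono
            ((isOpen_lt continuous_const (g (x i)).continuous.abs).mem_nhds hi) fun w hw _ => hw
        · exact Filter.Eventually.of_forall fun w hw => absurd hw hi
      refine h1.mono fun w hw => Or.inl (h.trans_le ?_)
      exact_mod_cast Finset.card_le_card fun i => by simpa using hw i
    · have hc : Continuous fun w => ∑ i, clip M (g (x i) w) :=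
        continuous_finsetSum _ fun i _ => (continuous_clip M).comp (g (x i)).continuous
      exact Filter.Eventually.mono ((isOpen_lt continuous_const hc).mem_nhds h)
        fun w hw => Or.inr hw
  obtain ⟨w, hw, hwD⟩ := mem_closure_iff_nhds.mp (hD hv) _ hopen
  exact hx ⟨w, hwD, hw⟩

omit [MeasurableSpace E] [BorelSpace E] in
theorem mul_trimmedAvg_le_of_notMem {s k t : ℕ} (hkst : k + s ≤ t) (ht : 2 * t < n) {M B : ℝ}
    (hM : 0 ≤ M) (hB : 0 ≤ B) {x : Fin n → E}
    (hx : x ∉ badSamples g n (Metric.sphere 0 1) s M B) {y : Fin n → E}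
    (hxy : ∃ T : Finset (Fin n), T.card ≤ k ∧ ∀ i ∉ T, x i = y i) (v : E) :
    n * trimmedAvg t (fun i => g (y i) v) ≤ (2 * B + 8 * (t * M)) * ‖v‖ := by
  obtain ⟨T, hT, hTxy⟩ := hxy
  have hcard : (Finset.univ.filter fun i => g (x i) v ≠ g (y i) v).card ≤ k := by
    refine (Finset.card_le_card fun i hi => ?_).trans hT
    by_contra h
    simp [hTxy i h] at hi
  have hmain : (Finset.univ.filter fun i => M * ‖v‖ < |g (x i) v|).card ≤ s ∧
      ∑ i, clip (M * ‖v‖) (g (x i) v) ≤ B * ‖v‖ := by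
    rcases eq_or_ne v 0 with rfl | hv
    · simp [clip]
    · have hv0 : 0 < ‖v‖ := norm_pos_iff.mpr hv
      -- Everything is homogeneous: direction `v` at level `M‖v‖` is the unit direction `w` at level
      -- `M`.
      set w : E := ‖v‖⁻¹ • v
      have hw : w ∈ Metric.sphere (0 : E) 1 := by
        simp [w, norm_smul, hv0.ne']
      have hvw : ∀ i, g (x i) v = g (x i) w * ‖v‖ := fun i => by
        simp only [w, map_smul, smul_eq_mul]
        field_simp
      have h1 : ¬ _ := fun h => hx ⟨w, hw, h⟩
      rw [not_or, not_lt, not_lt] at h1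
      constructor
      · have h2 := h1.1
        simp_rw [hvw, abs_mul, abs_norm, mul_lt_mul_iff_left₀ hv0]
        exact_mod_cast h2
      · simp_rw [hvw, clip_mul hv0.le, ← Finset.sum_mul]
        gcongr
        exact h1.2
  refine (mul_trimmedAvg_le hkst ht (by positivity) (by positivity) hcard hmain.1
    hmain.2).trans_eq ?_
  ring

theorem measure_badSamples_le [TopologicalSpace.SeparableSpace E] {K ρ : ℝ} (hρ : 0 < ρ)
    (hK0 : 0 ≤ K)
    (hK : ∀ a b : StrongDual ℝ E, ‖a + b‖ ^ 2 + ‖a - b‖ ^ 2 ≤ 2 * (‖a‖ ^ 2 + K * ‖b‖ ^ 2))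
    (hQ : Integrable (fun z => ‖z‖ ^ 2) Q) (hρV : 4 * K * n * ∫ z, ‖z‖ ^ 2 ∂Q ≤ ρ ^ 2)
    (hg : IsSubgradientSelection g) (hfoc : ∀ v, ∫ z, g z v ∂Q = 0) (hn : 0 < n)
    {s M u σ p ν : ℝ} (hM : 0 < M) (hρM : 80 * ρ ≤ s * M) (hu : 0 < u) (hus : u ≤ s)
    (hσ : ∀ v : E, ‖v‖ = 1 → ∫ z, g z v ^ 2 ∂Q ≤ σ ^ 2) (hp : 1 ≤ p) (hν : 0 ≤ ν)
    (hpi : ∀ v : E, ‖v‖ = 1 → Integrable (fun z => |g z v| ^ p) Q)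
    (hpν : ∀ v : E, ‖v‖ = 1 → ∫ z, |g z v| ^ p ∂Q ≤ ν ^ p)
    (hνM : 160 * ν * (n / s) ^ (1 / p) ≤ M) :
    ∃ D : Set E, D.Countable ∧ Metric.sphere 0 1 ⊆ closure D ∧
      iidMeasure Q n (badSamples g n D s M (18 * (s * M) + 48 * √(n * σ ^ 2 * u))) ≤
        ENNReal.ofReal (2 * Real.exp (-u)) := by
  have hn' : (0 : ℝ) < n := by exact_mod_cast hn
  have hs : 0 < s := hu.trans_le hus
  have hsq : ∀ v : E, Integrable (fun z => g z v ^ 2) Q := fun v => by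
    refine ((hQ.const_mul (4 * ‖v‖ ^ 2))).mono'
      ((hg.measurable_apply v).pow_const 2).aestronglyMeasurable (ae_of_all _ fun z => ?_)
    rw [Real.norm_eq_abs, abs_pow]
    have h1 : |g z v| ≤ 2 * ‖z‖ * ‖v‖ := ((g z).le_opNorm v).trans (by
      gcongr
      exact hg.norm_le z)
    refine (pow_le_pow_left₀ (abs_nonneg _) h1 2).trans_eq ?_
    ring
  -- The bound does not depend on the number of directions, so it survives the increasing union to a
  -- countable dense set.
  have hfin : ∀ {ι : Type} [Finite ι] [Nonempty ι] (v : ι → E), (∀ j, ‖v j‖ = 1) →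
      iidMeasure Q n (badSamples g n (Set.range v) s M
        (18 * (s * M) + 48 * √(n * σ ^ 2 * u))) ≤ ENNReal.ofReal (2 * Real.exp (-u)) := by
    intro ι _ _ v hv
    have h := measureReal_bad_le (n := n) (Q := Q) (f := fun j z => g z (v j))
      (fun j => hg.measurable_apply _) (integrable_signAvg_iSup hQ hg v)
      (integral_signAvg_iSup_le hρ hK0 hK hQ hρV hg fun j => (hv j).le) hM hρM hu hus
      (sq_nonneg σ)
      (fun j => tail_le hp hν (hpi _ (hv j)) (hpν _ (hv j)) hn' hs hM hνM)
      (fun j => hsq (v j)) (fun j => hσ _ (hv j))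
      (fun j => bias_le (hg.measurable_apply _) hp hν (integrable_selection_apply hQ hg _)
        (hfoc _) (hpi _ (hv j)) (hpν _ (hv j)) hn' hs hM hνM)
    rw [← ofReal_measureReal]
    refine ENNReal.ofReal_le_ofReal (le_trans (le_of_eq ?_) h)
    congr 1
    ext x
    simp [badSamples]
  rcases (Metric.sphere (0 : E) 1).eq_empty_or_nonempty with he | ⟨v₀, hv₀⟩
  · refine ⟨∅, Set.countable_empty, by rw [he]; exact Set.empty_subset _, ?_⟩
    have : badSamples g n ∅ s M (18 * (s * M) + 48 * √(n * σ ^ 2 * u)) = ∅ := by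
      ext x
      simp [badSamples]
    rw [this]
    simp
  · have := UniformSpace.secondCountable_of_separable E
    have : Nonempty (Metric.sphere (0 : E) 1) := ⟨⟨v₀, hv₀⟩⟩
    let d : ℕ → E := fun j => (TopologicalSpace.denseSeq (Metric.sphere (0 : E) 1) j : E)
    have hd1 : ∀ j, ‖d j‖ = 1 := fun j =>
      mem_sphere_zero_iff_norm.mp (TopologicalSpace.denseSeq (Metric.sphere (0 : E) 1) j).2
    refine ⟨Set.range d, Set.countable_range d, fun v hv => ?_, ?_⟩
    · have h1 := TopologicalSpace.denseRange_denseSeq (Metric.sphere (0 : E) 1) ⟨v, hv⟩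
      have h2 := image_closure_subset_closure_image continuous_subtype_val
        (Set.mem_image_of_mem Subtype.val h1)
      rwa [← Set.range_comp] at h2
    · set B := 18 * (s * M) + 48 * √(n * σ ^ 2 * u)
      have hU : badSamples g n (Set.range d) s M B =
          ⋃ N : ℕ, badSamples g n (Set.range fun j : Fin (N + 1) => d j) s M B := by
        ext x
        simp only [badSamples, Set.mem_iUnion, Set.mem_ofPred_eq]
        constructor
        · rintro ⟨_, ⟨j, rfl⟩, h⟩
          exact ⟨j, d j, ⟨⟨j, Nat.lt_succ_self j⟩, rfl⟩, h⟩
        · rintro ⟨N, _, ⟨j, rfl⟩, h⟩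
          exact ⟨d j, ⟨j, rfl⟩, h⟩
      have hmono : Monotone fun N : ℕ =>
          badSamples g n (Set.range fun j : Fin (N + 1) => d j) s M B := by
        rintro N N' hN x ⟨_, ⟨j, rfl⟩, h⟩
        exact ⟨d j, ⟨⟨j, by omega⟩, rfl⟩, h⟩
      rw [hU, hmono.measure_iUnion]
      exact iSup_le fun N => hfin (fun j : Fin (N + 1) => d j) fun j => hd1 j

end SubgradientProcess

/-! ### Arithmetic of the trimming level and of the error bound. -/

section TrimLevel

variable {n : ℕ} {ε δ : ℝ}

theorem log_two_div_pos (hδ : δ ∈ Set.Ioo (0 : ℝ) 1) : 1 / 2 ≤ Real.log (2 / δ) := by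
  have h1 : Real.log 2 ≤ Real.log (2 / δ) := by
    refine Real.log_le_log two_pos ?_
    rw [le_div_iff₀ hδ.1]
    linarith [hδ.2]
  linarith [Real.log_two_gt_d9]

theorem log_two_div_le (hδ : δ ∈ Set.Ioo (0 : ℝ) 1) : Real.log (2 / δ) ≤ Real.log (3 / δ) := by
  have := hδ.1
  refine Real.log_le_log (by positivity) ?_
  gcongr
  norm_num

theorem lt_half_of_trimLevel_lt (hδ : δ ∈ Set.Ioo (0 : ℝ) 1)
    (ht : (trimLevel n ε δ : ℝ) < n / 2) : 0 < n ∧ ε < 1 / 2 := by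
  have hn : 0 < n := by
    rcases Nat.eq_zero_or_pos n with rfl | h
    · have := (Nat.cast_nonneg (α := ℝ) (trimLevel 0 ε δ))
      simp at ht
      linarith
    · exact h
  refine ⟨hn, ?_⟩
  have hn' : (0 : ℝ) < n := by exact_mod_cast hn
  have h1 : 1 ≤ max ⌈Real.log (2 / δ)⌉₊ ⌈min ε (1 / 2 - ε) / 2 * n⌉₊ :=
    le_max_of_le_left (Nat.one_le_ceil_iff.mpr (by linarith [log_two_div_pos hδ]))
  have h2 : (1 : ℝ) ≤ (max ⌈Real.log (2 / δ)⌉₊ ⌈min ε (1 / 2 - ε) / 2 * n⌉₊ : ℕ) := by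
    exact_mod_cast h1
  have h3 := Nat.lt_floor_add_one (ε * n)
  unfold trimLevel at ht
  push_cast at ht h2
  nlinarith

/-- `s` is the part of the trimming level reserved for large clean values. The last alternative
decides which moment is used: either `s` comes from the confidence level, or it is at most `εn`. -/
theorem trimLevel_decomposition (hε : 0 ≤ ε) (hδ : δ ∈ Set.Ioo (0 : ℝ) 1)
    (ht : (trimLevel n ε δ : ℝ) < n / 2) :
    ∃ s : ℕ, ⌊ε * n⌋₊ + s = trimLevel n ε δ ∧ Real.log (2 / δ) ≤ s ∧
      (trimLevel n ε δ : ℝ) ≤ 2 * (1 + ε / min ε (1 / 2 - ε)) * s ∧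
      ((s : ℝ) ≤ 3 * Real.log (3 / δ) ∨ 0 < ε ∧ (s : ℝ) ≤ ε * n) := by
  obtain ⟨hn, hε2⟩ := lt_half_of_trimLevel_lt hδ ht
  have hn' : (0 : ℝ) < n := by exact_mod_cast hn
  set a := ⌈Real.log (2 / δ)⌉₊ with ha
  set m := min ε (1 / 2 - ε) with hm
  set b := ⌈m / 2 * n⌉₊ with hb
  have hm0 : 0 ≤ m := le_min hε (by linarith)
  have hlog := log_two_div_pos hδ
  have ha1 : 1 ≤ a := Nat.one_le_ceil_iff.mpr (by linarith)
  have hmax : ((max a b : ℕ) : ℝ) = max (a : ℝ) b := Nat.cast_max ..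
  have hfl := Nat.floor_le (by positivity : 0 ≤ ε * n)
  refine ⟨max a b, rfl, ?_, ?_, ?_⟩
  · rw [hmax]
    exact (Nat.le_ceil _).trans (le_max_left _ _)
  · have hbs : m / 2 * n ≤ ((max a b : ℕ) : ℝ) := by
      rw [hmax]
      exact (Nat.le_ceil _).trans (le_max_right _ _)
    have h0 : (0 : ℝ) ≤ ((max a b : ℕ) : ℝ) := Nat.cast_nonneg _
    have h1 : (trimLevel n ε δ : ℝ) = (⌊ε * n⌋₊ : ℝ) + ((max a b : ℕ) : ℝ) := by
      unfold trimLevel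
      push_cast
      rfl
    rw [h1]
    have h2 : ε * n ≤ 2 * (ε / m) * ((max a b : ℕ) : ℝ) := by
      rcases hε.eq_or_lt with h | h
      · rw [← h]
        simp
      · have hm1 : 0 < m := lt_min h (by linarith)
        calc ε * n = 2 * (ε / m) * (m / 2 * n) := by field_simp
          _ ≤ _ := by gcongr
    nlinarith
  · rcases le_or_gt b a with h | h
    · left
      rw [max_eq_left h]
      have h1 := Nat.ceil_lt_add_one (by linarith : 0 ≤ Real.log (2 / δ))
      rw [← ha] at h1
      linarith [log_two_div_le hδ]
    · right
      rw [max_eq_right h.le]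
      -- Then `m n / 2 > 1`, so rounding up at most doubles it and `b ≤ m n ≤ ε n`.
      have hb2 : 2 ≤ b := by omega
      have h1 : 1 < m / 2 * n := by
        have := Nat.lt_ceil.mp (show 1 < b by omega)
        exact_mod_cast this
      have h2 := Nat.ceil_lt_add_one (by linarith : 0 ≤ m / 2 * n)
      rw [← hb] at h2
      have hmε : m * n ≤ ε * n := by
        gcongr
        exact min_le_left _ _
      constructor
      · by_contra hc
        have : ε = 0 := le_antisymm (not_lt.mp hc) hε
        rw [this] at hmε
        linarith
      · linarith

/-- The level `M` is the smallest allowed by the Rademacher and moment conditions together, so `s M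
/ n` is of the order of the three error terms. The slack `τ` in the choice of `p` is absorbed in the
strong term, and the divisor `1000` absorbs the numerical constants. -/
theorem le_error_of_moments {k R n s t V ρ ν p σ u L I M τ : ℝ} (hk : 0 < k) (hR : 1 ≤ R)
    (hn : 0 < n) (hs : 0 < s) (ht : t ≤ 2 * R * s) (hV : 0 ≤ V) (hτ : τ = √(V / (k * n)))
    (hρ : ρ = 2 * n * τ) (hI : 0 ≤ I) (huL : u ≤ L) (hM0 : 0 ≤ M)
    (hM : M = 80 * ρ / s + 160 * ν * (n / s) ^ (1 / p))
    (hν : ν * (s / n) ^ (1 - 1 / p) ≤ 2 * √(σ ^ 2 * L / n) + I + τ) :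
    2 * ((2 * (18 * (s * M) + 48 * √(n * σ ^ 2 * u)) + 8 * (t * M)) / n) / (k / 2) ≤
      928 * R / (k / 1000) * (23 * √(V / (k / 1000 * n)) + √(σ ^ 2 * L / n) + I) := by
  set a := √(σ ^ 2 * L / n) with ha
  have ha0 : 0 ≤ a := Real.sqrt_nonneg _
  have hτ0 : 0 ≤ τ := hτ ▸ Real.sqrt_nonneg _
  have hid : s / n * (n / s) ^ (1 / p) = (s / n) ^ (1 - 1 / p) := by
    rw [Real.rpow_sub (by positivity), Real.rpow_one, ← inv_div s n,
      Real.inv_rpow (by positivity), div_eq_mul_inv (s / n)]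
  have hsM : s * M ≤ (320 * τ + 320 * a + 160 * I) * n := by
    have h1 : s * M = (160 * τ + 160 * (ν * (s / n) ^ (1 - 1 / p))) * n := by
      rw [hM, hρ, ← hid]
      field_simp
      ring
    rw [h1]
    refine mul_le_mul_of_nonneg_right ?_ hn.le
    linarith
  have hsq : √(n * σ ^ 2 * u) ≤ a * n := by
    rw [ha, ← Real.sqrt_sq hn.le, ← Real.sqrt_mul' _ (sq_nonneg n), Real.sqrt_sq hn.le]
    refine Real.sqrt_le_sqrt ?_
    calc n * σ ^ 2 * u ≤ n * σ ^ 2 * L := by gcongr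
      _ = _ := by field_simp
  have htM : t * M ≤ 2 * R * (s * M) := by
    rw [← mul_assoc]
    gcongr
  have hτ' : τ ≤ √(V / (k / 1000 * n)) := by
    rw [hτ]
    refine Real.sqrt_le_sqrt ?_
    gcongr
    linarith
  set T := √(V / (k / 1000 * n))
  have hsM0 : 0 ≤ s * M := by positivity
  have hmain : 2 * (18 * (s * M) + 48 * √(n * σ ^ 2 * u)) + 8 * (t * M) ≤
      R * (17000 * τ + 17000 * a + 17000 * I) * n := by
    -- `36 = 2 * 18` comes from the clipped sums and `16 R` from `8 t M` with `t ≤ 2 R s`; then `52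
    -- * 320 + 96 ≤ 17000`.
    have h1 : 36 * (s * M) + 16 * R * (s * M) ≤ 52 * R * (s * M) := by nlinarith
    have h2 : 52 * R * (s * M) ≤ 52 * R * ((320 * τ + 320 * a + 160 * I) * n) := by gcongr
    have h3 : 96 * (a * n) ≤ R * (96 * a) * n := by
      have : 0 ≤ a * n := by positivity
      nlinarith
    have h4 : 0 ≤ R * n * τ := by positivity
    have h5 : 0 ≤ R * n * a := by positivity
    have h6 : 0 ≤ R * n * I := by positivity
    nlinarith
  calc 2 * ((2 * (18 * (s * M) + 48 * √(n * σ ^ 2 * u)) + 8 * (t * M)) / n) / (k / 2)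
      ≤ 2 * ((R * (17000 * τ + 17000 * a + 17000 * I) * n) / n) / (k / 2) := by gcongr
    _ = R / k * (68000 * (τ + a + I)) := by field_simp; ring
    _ ≤ R / k * (928000 * (23 * T + a + I)) := by
        gcongr R / k * ?_
        linarith
    _ = _ := by field_simp; ring

end TrimLevel

/-! ### From the law of `X - μ` to the probability space. -/

section Transfer

variable {E : Type*} [NormedAddCommGroup E] [NormedSpace ℝ E] [MeasurableSpace E] [BorelSpace E]
  [TopologicalSpace.SeparableSpace E] {Ω : Type*} [MeasurableSpace Ω] {P : Measure Ω}
  [IsProbabilityMeasure P] {X : Ω → E} {μ : E} {g : E → StrongDual ℝ E} {n : ℕ}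

omit [TopologicalSpace.SeparableSpace E] in
theorem nu_two_ne_top (hX : Measurable X) (hX2 : Integrable (fun ω => ‖X ω‖ ^ 2) P)
    (hg : IsSubgradientSelection g) : nu P X μ g 2 ≠ ⊤ := by
  have h0 : MemLp (fun ω => 2 * ‖X ω - μ‖) 2 P :=
    ((memLp_two_iff_integrable_sq (hX.sub_const μ).norm.aestronglyMeasurable).mpr
      (integrable_norm_sub_sq hX hX2 μ)).const_mul 2
  refine ne_top_of_le_ne_top h0.2.ne (iSup₂_le fun v hv => ?_)
  rw [ENNReal.ofReal_ofNat]
  refine eLpNorm_mono_real fun ω => ((g _).le_opNorm v).trans ?_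
  rw [mem_sphere_zero_iff_norm.mp hv, mul_one]
  exact hg.norm_le _

omit [TopologicalSpace.SeparableSpace E] [IsProbabilityMeasure P] in
theorem moment_of_nu (hX : Measurable X) (hg : IsSubgradientSelection g) {p : ℝ} (hp : 1 ≤ p)
    (hν : nu P X μ g p ≠ ⊤) {v : E} (hv : ‖v‖ = 1) :
    Integrable (fun z => |g z v| ^ p) (P.map fun ω => X ω - μ) ∧
      ∫ z, |g z v| ^ p ∂(P.map fun ω => X ω - μ) ≤ (nu P X μ g p).toReal ^ p := by
  have hp0 : 0 < p := by linarith
  have hXμ : Measurable fun ω => X ω - μ := hX.sub_const μ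
  have hle : eLpNorm (fun z => g z v) (ENNReal.ofReal p) (P.map fun ω => X ω - μ) ≤
      nu P X μ g p := by
    rw [eLpNorm_map_measure (hg.measurable_apply v).aestronglyMeasurable hXμ.aemeasurable]
    exact le_iSup₂_of_le v (mem_sphere_zero_iff_norm.mpr hv) le_rfl
  have hm : MemLp (fun z => g z v) (ENNReal.ofReal p) (P.map fun ω => X ω - μ) :=
    ⟨(hg.measurable_apply v).aestronglyMeasurable, hle.trans_lt hν.lt_top⟩
  have hp1 : ENNReal.ofReal p ≠ 0 := by simpa using hp0
  have hi := hm.integrable_norm_rpow hp1 ENNReal.ofReal_ne_top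
  rw [ENNReal.toReal_ofReal hp0.le] at hi
  refine ⟨hi, ?_⟩
  have h1 := hm.eLpNorm_eq_integral_rpow_norm hp1 ENNReal.ofReal_ne_top
  rw [ENNReal.toReal_ofReal hp0.le] at h1
  rw [h1] at hle
  have h2 := ENNReal.toReal_mono hν hle
  have hnn : 0 ≤ ∫ z, ‖g z v‖ ^ p ∂(P.map fun ω => X ω - μ) := integral_nonneg fun z => by positivity
  rw [ENNReal.toReal_ofReal (by positivity)] at h2
  have h3 := Real.rpow_le_rpow (by positivity) h2 hp0.le
  rwa [← Real.rpow_mul hnn, inv_mul_cancel₀ hp0.ne', Real.rpow_one] at h3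

omit [MeasurableSpace E] [BorelSpace E] [TopologicalSpace.SeparableSpace E]
  [IsProbabilityMeasure P] in
-- If `s` is of order `log (3/δ)`, the second moment gives the weak variance term. If `s ≤ ε n`, an
-- exponent within `τ` of the infimum is used, since the infimum need not be attained.
theorem exists_exponent {s ε L τ : ℝ} (hs0 : 0 < s) (hn : 0 < n) (hτ : 0 < τ)
    (hν2 : nu P X μ g 2 ≠ ⊤) (hs : s ≤ 3 * L ∨ 0 < ε ∧ s ≤ ε * n) :
    ∃ p : ℝ, 1 ≤ p ∧ nu P X μ g p ≠ ⊤ ∧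
      (nu P X μ g p).toReal * (s / n) ^ (1 - 1 / p) ≤
        2 * √((nu P X μ g 2).toReal ^ 2 * L / n) +
          (⨅ p ∈ Set.Ici (1 : ℝ), nu P X μ g p * ENNReal.ofReal (ε ^ (1 - 1 / p))).toReal + τ := by
  have hn' : (0 : ℝ) < n := by exact_mod_cast hn
  set I := ⨅ p ∈ Set.Ici (1 : ℝ), nu P X μ g p * ENNReal.ofReal (ε ^ (1 - 1 / p)) with hI
  rcases hs with hs | ⟨hε, hs⟩
  · refine ⟨2, by norm_num, hν2, ?_⟩
    have h1 : (nu P X μ g 2).toReal * (s / n) ^ (1 - 1 / (2 : ℝ)) ≤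
        2 * √((nu P X μ g 2).toReal ^ 2 * L / n) := by
      rw [show (1 - 1 / (2 : ℝ)) = 1 / 2 by norm_num, ← Real.sqrt_eq_rpow, mul_div_assoc,
        Real.sqrt_mul (sq_nonneg _), Real.sqrt_sq ENNReal.toReal_nonneg]
      have h2 : √(s / n) ≤ 2 * √(L / n) := by
        rw [show (2 : ℝ) = √4 by
          rw [show (4 : ℝ) = 2 ^ 2 by norm_num, Real.sqrt_sq (by norm_num)],
          ← Real.sqrt_mul (by norm_num)]
        refine Real.sqrt_le_sqrt ?_
        rw [← mul_div_assoc]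
        gcongr
        linarith
      calc _ ≤ (nu P X μ g 2).toReal * (2 * √(L / n)) := by gcongr
        _ = _ := by ring
    linarith [ENNReal.toReal_nonneg (a := I)]
  · have hItop : I ≠ ⊤ := by
      refine ne_top_of_le_ne_top (ENNReal.mul_ne_top hν2 ENNReal.ofReal_ne_top)
        (iInf₂_le (2 : ℝ) (by norm_num : (2 : ℝ) ∈ Set.Ici (1 : ℝ)))
    have hlt : I < I + ENNReal.ofReal τ :=
      ENNReal.lt_add_right hItop (by simpa using hτ)
    conv_lhs at hlt => rw [hI]
    simp only [iInf_lt_iff] at hlt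
    obtain ⟨p, hp, hlt⟩ := hlt
    have hp1 : (1 : ℝ) ≤ p := hp
    have hεp : 0 < ε ^ (1 - 1 / p) := Real.rpow_pos_of_pos hε _
    have hνp : nu P X μ g p ≠ ⊤ := by
      intro h
      rw [h, ENNReal.top_mul (by simpa using hεp)] at hlt
      exact absurd hlt (by simp)
    refine ⟨p, hp1, hνp, ?_⟩
    have h1 := ENNReal.toReal_mono (by simp [hItop]) hlt.le
    rw [ENNReal.toReal_mul, ENNReal.toReal_ofReal hεp.le,
      ENNReal.toReal_add hItop ENNReal.ofReal_ne_top, ENNReal.toReal_ofReal hτ.le] at h1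
    have h2 : (s / n) ^ (1 - 1 / p) ≤ ε ^ (1 - 1 / p) := by
      refine Real.rpow_le_rpow (by positivity) ((div_le_iff₀ hn').mpr hs) ?_
      rw [sub_nonneg]
      exact (div_le_one (by linarith)).mpr hp1
    have h3 := mul_le_mul_of_nonneg_left h2 (ENNReal.toReal_nonneg (a := nu P X μ g p))
    linarith [Real.sqrt_nonneg ((nu P X μ g 2).toReal ^ 2 * L / n)]

omit [NormedSpace ℝ E] [TopologicalSpace.SeparableSpace E] in
theorem exists_event_of_iid {Xs Xc : Fin n → Ω → E} (hind : iIndepFun Xs P)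
    (hid : ∀ i, IdentDistrib (Xs i) X P P) {ε δ : ℝ} (hcont : IsContamination P ε Xs Xc)
    (hδ : 0 ≤ δ) {Bad : Set (Fin n → E)} (hBad : MeasurableSet Bad)
    (hBadδ : iidMeasure (P.map fun ω => X ω - μ) n Bad ≤ ENNReal.ofReal δ) :
    ∃ A : Set Ω, MeasurableSet A ∧ ENNReal.ofReal (1 - δ) ≤ P A ∧
      ∀ ω ∈ A, (fun i => Xs i ω - μ) ∉ Bad ∧
        ∃ T : Finset (Fin n), T.card ≤ ⌊ε * n⌋₊ ∧ ∀ i ∉ T, Xs i ω = Xc i ω := by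
  classical
  have hsub : Measurable fun z : E => z - μ := measurable_id.sub_const μ
  have hae : ∀ i, AEMeasurable (fun ω => Xs i ω - μ) P := fun i =>
    hsub.comp_aemeasurable (hid i).aemeasurable_fst
  have hind' : iIndepFun (fun i ω => Xs i ω - μ) P := hind.comp (fun _ z => z - μ) fun _ => hsub
  have hlaw : P.map (fun ω i => Xs i ω - μ) = iidMeasure (P.map fun ω => X ω - μ) n := by
    rw [(iIndepFun_iff_map_fun_eq_pi_map hae).mp hind']
    congr 1
    funext i
    exact ((hid i).comp hsub).map_eq
  set N : Set Ω := {ω | (fun i => Xs i ω - μ) ∈ Bad} ∪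
    {ω | ¬ ((Finset.univ.filter fun i => Xs i ω ≠ Xc i ω).card : ℝ) ≤ ε * n} with hN
  have hPN : P N ≤ ENNReal.ofReal δ := by
    refine (measure_union_le _ _).trans ?_
    have h0 : P {ω | ¬ ((Finset.univ.filter fun i => Xs i ω ≠ Xc i ω).card : ℝ) ≤ ε * n} = 0 := by
      rw [← ae_iff]
      filter_upwards [hcont.2] with ω hω
      convert hω
    rw [h0, add_zero]
    refine le_trans (le_of_eq ?_) hBadδ
    rw [← hlaw, Measure.map_apply_of_aemeasurable (aemeasurable_pi_iff.mpr hae) hBad]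
    rfl
  -- The exceptional set need not be measurable; its measurable hull has the same measure.
  refine ⟨(toMeasurable P N)ᶜ, (measurableSet_toMeasurable P N).compl, ?_, fun ω hω => ?_⟩
  · rw [prob_compl_eq_one_sub (measurableSet_toMeasurable P N), measure_toMeasurable,
      ENNReal.ofReal_sub _ hδ, ENNReal.ofReal_one]
    exact tsub_le_tsub_left hPN 1
  · have hωN : ω ∉ N := fun h => hω (subset_toMeasurable P N h)
    rw [hN, Set.mem_union, not_or] at hωN
    refine ⟨hωN.1, Finset.univ.filter fun i => Xs i ω ≠ Xc i ω,
      Nat.le_floor (not_not.mp hωN.2), fun i hi => ?_⟩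
    simpa using hi

theorem exists_bad_samples {k ε δ : ℝ} (hk : 0 < k) (hE : SqMidpointConvex E k)
    (hX : Measurable X) (hX2 : Integrable (fun ω => ‖X ω‖ ^ 2) P)
    (hg : IsSubgradientSelection g) (hfoc : FirstOrderCondition P X μ g)
    (hε : 0 ≤ ε) (hδ : δ ∈ Set.Ioo (0 : ℝ) 1) (ht : (trimLevel n ε δ : ℝ) < n / 2) :
    ∃ (Bad : Set (Fin n → E)) (s : ℕ) (M B : ℝ), MeasurableSet Bad ∧
      iidMeasure (P.map fun ω => X ω - μ) n Bad ≤ ENNReal.ofReal δ ∧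
      ⌊ε * n⌋₊ + s = trimLevel n ε δ ∧ 0 ≤ M ∧ 0 ≤ B ∧
      (∀ x ∉ Bad, x ∉ badSamples g n (Metric.sphere 0 1) s M B) ∧
      2 * ((2 * B + 8 * (trimLevel n ε δ * M)) / n) / (k / 2) ≤
        errorBound P X μ g (k / 1000) n ε δ := by
  obtain ⟨hn, hε2⟩ := lt_half_of_trimLevel_lt hδ ht
  have hn' : (0 : ℝ) < n := by exact_mod_cast hn
  obtain ⟨s, hst, hus, htR, hs3⟩ := trimLevel_decomposition hε hδ ht
  have hu := log_two_div_pos hδ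
  have hs0 : (0 : ℝ) < s := by linarith
  have hXμ : Measurable fun ω => X ω - μ := hX.sub_const μ
  set Q := P.map fun ω => X ω - μ with hQdef
  have hQP : IsProbabilityMeasure Q := Measure.isProbabilityMeasure_map hXμ.aemeasurable
  have hnorm : AEStronglyMeasurable (fun z : E => ‖z‖ ^ 2) Q :=
    (measurable_norm.pow_const 2).aestronglyMeasurable
  have hQ : Integrable (fun z : E => ‖z‖ ^ 2) Q :=
    (integrable_map_measure hnorm hXμ.aemeasurable).mpr (integrable_norm_sub_sq hX hX2 μ)
  have hVQ : ∫ z, ‖z‖ ^ 2 ∂Q = ∫ ω, ‖X ω - μ‖ ^ 2 ∂P := integral_map hXμ.aemeasurable hnorm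
  have hV0 : 0 ≤ ∫ ω, ‖X ω - μ‖ ^ 2 ∂P := integral_nonneg fun ω => by positivity
  have hR0 : 0 ≤ ε / min ε (1 / 2 - ε) := div_nonneg hε (le_min hε (by linarith))
  set V := ∫ ω, ‖X ω - μ‖ ^ 2 ∂P with hV
  -- The degenerate case `X = μ` almost surely is separate, because `τ` and `M` must be positive
  -- below. There all subgradients vanish on the good event, and `M = B = 0` works.
  rcases hV0.eq_or_lt with hV0 | hVpos
  · refine ⟨{x | ∃ i, x i ≠ 0}, s, 0, 0, ?_, ?_, hst, le_rfl, le_rfl, ?_, ?_⟩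
    · have : {x : Fin n → E | ∃ i, x i ≠ 0} = ⋃ i, {x | x i ≠ 0} := by
        ext x
        simp
      rw [this]
      exact MeasurableSet.iUnion fun i =>
        (measurableSet_eq_fun (measurable_pi_apply i) measurable_const).compl
    · have hz : ∀ᵐ z ∂Q, z = 0 := by
        have := (integral_eq_zero_iff_of_nonneg (fun z => by positivity) hQ).mp
          (hVQ.trans hV0.symm)
        filter_upwards [this] with z hz
        simpa using hz
      have hx : ∀ᵐ x ∂(iidMeasure Q n), ∀ i, x i = 0 := ae_all_iff.mpr fun i =>
        (measurePreserving_eval (fun _ : Fin n => Q) i).quasiMeasurePreserving.ae hz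
      have h0 : iidMeasure Q n {x | ∃ i, x i ≠ 0} = 0 := by
        rw [ae_iff] at hx
        simpa using hx
      rw [h0]
      exact zero_le
    · rintro x hx ⟨v, -, h⟩
      have hx0 : ∀ i, x i = 0 := fun i => not_not.mp fun h => hx ⟨i, h⟩
      have hg0 : g 0 = 0 := by simpa using hg.norm_le 0
      simp [hx0, hg0, clip] at h
      linarith
    · have hc : 0 ≤ errorBound P X μ g (k / 1000) n ε δ := by
        unfold errorBound contamConst
        positivity
      simpa using hc
  · set τ := √(V / (k * n)) with hτ
    have hτ0 : 0 < τ := Real.sqrt_pos.mpr (by positivity)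
    set ρ := 2 * n * τ with hρ
    have hρ0 : 0 < ρ := by positivity
    have hν2 : nu P X μ g 2 ≠ ⊤ := nu_two_ne_top hX hX2 hg
    obtain ⟨p, hp, hνp, hνle⟩ := exists_exponent (s := s) (L := Real.log (3 / δ)) hs0 hn hτ0
      hν2 hs3
    set ν := (nu P X μ g p).toReal with hν
    have hν0 : 0 ≤ ν := ENNReal.toReal_nonneg
    set σ := (nu P X μ g 2).toReal with hσ
    set M := 80 * ρ / s + 160 * ν * ((n : ℝ) / s) ^ (1 / p) with hM
    have hM0 : 0 < M := by positivity
    set u := Real.log (2 / δ) with hudef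
    have hexp : 2 * Real.exp (-u) = δ := by
      have := hδ.1
      rw [hudef, Real.exp_neg, Real.exp_log (by positivity)]
      field_simp
    -- `K = 1 / k` is the smoothness constant of the dual, and `ρ = 2 n τ` makes `ρ² = 4 K n V` an
    -- equality.
    obtain ⟨D, hDc, hDd, hDδ⟩ := measure_badSamples_le (n := n) (Q := Q) (K := 1 / k) (ρ := ρ)
      (s := s) (M := M) (u := u) (σ := σ) (p := p) (ν := ν) hρ0 (by positivity)
      (fun a b => by
        have := hE.dual_smooth hk a b
        rwa [div_eq_inv_mul, ← one_div] at this) hQ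
      (by
        rw [hVQ, hρ, mul_pow, hτ, Real.sq_sqrt (by positivity)]
        refine le_of_eq ?_
        field_simp
        ring) hg
      (fun v => by
        rw [hQdef, integral_map hXμ.aemeasurable (hg.measurable_apply v).aestronglyMeasurable]
        exact hfoc v) hn hM0
      (by
        rw [hM, mul_add, mul_div_cancel₀ _ hs0.ne']
        have : 0 ≤ s * (160 * ν * ((n : ℝ) / s) ^ (1 / p)) := by positivity
        linarith) (by linarith) hus
      (fun v hv => by
        have := (moment_of_nu (P := P) (μ := μ) hX hg (p := 2) (by norm_num) hν2 hv).2
        simpa using this) hp hν0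
      (fun v hv => (moment_of_nu hX hg hp hνp hv).1)
      (fun v hv => (moment_of_nu hX hg hp hνp hv).2)
      (by
        rw [hM]
        have : 0 ≤ 80 * ρ / s := by positivity
        linarith)
    rw [hexp] at hDδ
    refine ⟨badSamples g n D s M (18 * (s * M) + 48 * √(n * σ ^ 2 * u)), s, M,
      18 * (s * M) + 48 * √(n * σ ^ 2 * u), measurableSet_badSamples hg hDc _ _ _, hDδ, hst,
      hM0.le, by positivity, fun x hx => notMem_badSamples_of_dense hDd hx, ?_⟩
    exact le_error_of_moments (R := 1 + ε / min ε (1 / 2 - ε)) hk (by linarith) hn' hs0 htR hV0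
      hτ hρ ENNReal.toReal_nonneg (log_two_div_le hδ) hM0.le hM hνle

end Transfer

end TrimmedFrechet

/-! ### Assembly of the three assertions. -/

theorem mainTheorem2 (c : ℝ) (hc : 0 < c) :
    ∃ C : ℝ, 0 < C ∧
      ∀ (E : Type*) [NormedAddCommGroup E] [NormedSpace ℝ E] [CompleteSpace E]
        [TopologicalSpace.SeparableSpace E] [MeasurableSpace E] [BorelSpace E],
        TrimmedFrechet.UniformlyConvexTwo E c →
      ∀ (Ω : Type*) [MeasurableSpace Ω] (P : Measure Ω) [IsProbabilityMeasure P]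
        (X : Ω → E), Measurable X → Integrable (fun ω => ‖X ω‖ ^ 2) P →
        -- the Fréchet mean exists and is unique
        (∃! μ : E, TrimmedFrechet.IsFrechetMean P X μ) ∧
        ∀ μ : E, TrimmedFrechet.IsFrechetMean P X μ →
          -- a measurable subgradient selection with the first-order condition exists
          (∃ g : E → StrongDual ℝ E, TrimmedFrechet.IsSubgradientSelection g ∧
            TrimmedFrechet.FirstOrderCondition P X μ g) ∧
          -- the condition is automatic if `‖·‖²` has a.s. only one subgradient at `X - μ`
          ((∀ᵐ ω ∂P,
              (TrimmedFrechet.subdifferential (fun z : E => ‖z‖ ^ 2) (X ω - μ)).Subsingleton) →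
            ∀ g : E → StrongDual ℝ E, TrimmedFrechet.IsSubgradientSelection g →
              TrimmedFrechet.FirstOrderCondition P X μ g) ∧
          -- the error bound, for every value of the estimator on one event
          ∀ g : E → StrongDual ℝ E, TrimmedFrechet.IsSubgradientSelection g →
            TrimmedFrechet.FirstOrderCondition P X μ g →
          ∀ (n : ℕ) (ε δ : ℝ), ε ∈ Set.Ico (0 : ℝ) 1 → δ ∈ Set.Ioo (0 : ℝ) 1 →
            (TrimmedFrechet.trimLevel n ε δ : ℝ) < n / 2 →
          ∀ Xs Xc : Fin n → Ω → E, iIndepFun Xs P → (∀ i, IdentDistrib (Xs i) X P P) →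
            TrimmedFrechet.IsContamination P ε Xs Xc →
          ∃ A : Set Ω, MeasurableSet A ∧ ENNReal.ofReal (1 - δ) ≤ P A ∧
            ∀ ω ∈ A, ∀ m : E,
              TrimmedFrechet.IsTrimmedFrechetMean (TrimmedFrechet.trimLevel n ε δ)
                (fun i => Xc i ω) m →
              ‖m - μ‖ ≤ TrimmedFrechet.errorBound P X μ g C n ε δ := by
  have hk : 0 < min (1 / 4) (c / 6) := by positivity
  refine ⟨min (1 / 4) (c / 6) / 1000, by positivity, ?_⟩
  intro E _ _ _ _ _ _ hUC Ω _ P _ X hX hX2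
  have hE := TrimmedFrechet.UniformlyConvexTwo.sqMidpointConvex hc hUC
  have hdual := hE.separableSpace_dual hk
  refine ⟨TrimmedFrechet.existsUnique_isFrechetMean hk hE hX hX2, fun μ hμ =>
    ⟨TrimmedFrechet.exists_selection_firstOrderCondition hdual hX hX2 hμ,
      fun hs g hg => TrimmedFrechet.firstOrderCondition_of_subsingleton hdual hX hX2 hμ hs hg, ?_⟩⟩
  intro g hg hfoc n ε δ hε hδ ht Xs Xc hind hid hcont
  obtain ⟨Bad, s, M, B, hBad, hBadδ, hst, hM, hB, hsub, hbound⟩ :=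
    TrimmedFrechet.exists_bad_samples hk hE hX hX2 hg hfoc hε.1 hδ ht
  obtain ⟨A, hA, hPA, hAω⟩ :=
    TrimmedFrechet.exists_event_of_iid hind hid hcont hδ.1.le hBad hBadδ
  refine ⟨A, hA, hPA, fun ω hω m hm => ?_⟩
  obtain ⟨hωB, T, hT, hTX⟩ := hAω ω hω
  obtain ⟨hn, -⟩ := TrimmedFrechet.lt_half_of_trimLevel_lt hδ ht
  have hn' : (0 : ℝ) < n := by exact_mod_cast hn
  have ht2 : 2 * TrimmedFrechet.trimLevel n ε δ < n := by
    have : (2 * TrimmedFrechet.trimLevel n ε δ : ℝ) < n := by linarith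
    exact_mod_cast this
  -- Here `κ = k / 2` and `W = (2 B + 8 t M) / n`. The event depends only on the sample and not on
  -- `m`, so the bound covers all minimizers at once.
  refine (hm.norm_sub_le ht2 (half_pos hk) (by positivity) (g := g)
    (fun u w => hE.subgradient_le (hg.2 u) w) fun v => ?_).trans hbound
  have := TrimmedFrechet.mul_trimmedAvg_le_of_notMem hst.le ht2 hM hB (hsub _ hωB)
    (y := fun i => Xc i ω - μ) ⟨T, hT, fun i hi => by rw [hTX i hi]⟩ v
  rw [div_mul_eq_mul_div, le_div_iff₀ hn']
  linarith
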